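/- Let $C=(C_{i,j})_{i,j\in I}$ be the Cartan matrix of a finite-dimensional simple Lie algebra $\mathfrak g$ (so $C_{i,j}=\langle\alpha_i^\vee,\alpha_j\rangle$), let $d_i$ be the relatively prime positive integers with $d_iC_{i,j}=d_jC_{j,i}$, let $P=\bigoplus_i\mathbb Z\omega_i$ be the weight lattice, $\alpha_i=\sum_jC_{j,i}\omega_j$ the simple roots, $Q^+=\sum_i\mathbb Z_{\ge0}\alpha_i$, $W$ the Weyl group with simple reflections $s_i$ and length $l$. Let $q\in\mathbb C^\times$ be not a root of unity and $q_i=q^{d_i}$. **Rings.** Let $\mathcal Y'=\mathbb Z[\Psi_{i,a}^{\pm1},y_j^{\pm1}]_{i,j\in I,\,a\in\mathbb C^\times}$ and write $[\omega]=\prod_jy_j^{n_j}$ for $\omega=\sum_j n_j\omega_j\in P$. The weight of a monomial is the weight $\omega$ of its factor $[\omega]$ (the $\Psi_{i,a}$ have weight $0$). Put $Y_{i,a}=[\omega_i]\Psi_{i,aq_i^{-1}}\Psi_{i,aq_i}^{-1}$, $\mathcal Y=\mathbb Z[Y_{i,a}^{\pm1}]\subset\mathcal Y'$, $$A_{i,a}=Y_{i,aq_i^{-1}}Y_{i,aq_i}\Bigl(\prod_{C_{j,i}=-1}Y_{j,a}\prod_{C_{j,i}=-2}Y_{j,aq^{-1}}Y_{j,aq}\prod_{C_{j,i}=-3}Y_{j,aq^{-2}}Y_{j,a}Y_{j,aq^2}\Bigr)^{-1},$$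 $$\tilde\Psi_{i,a}=\Psi_{i,a}^{-1}\prod_{C_{i,j}=-1}\Psi_{j,aq_i}\prod_{C_{i,j}=-2}\Psi_{j,a}\Psi_{j,aq^2}\prod_{C_{i,j}=-3}\Psi_{j,aq^{-1}}\Psi_{j,aq}\Psi_{j,aq^3}.$$ For $w\in W$ let $\mu\le_w\lambda$ mean $w(\lambda-\mu)\in Q^+$. The $w$-completion of a ring of Laurent polynomials spanned by a group of monomials consists of the formal integral combinations of these monomials whose weights lie in a finite union of cones $\{\mu:\mu\le_w\lambda\}$ and in which each weight occurs only finitely many times. Let $\widetilde{\mathcal Y}^w$ be the $w$-completion of $\mathcal Y$, let $\widetilde{\mathcal Y}'^w=\mathcal Y'\otimes_{\mathcal Y}\widetilde{\mathcal Y}^w$, realized through multiplication as the ring of finite sums of products $PR$ with $P\in\mathcal Y'$, $R\in\widetilde{\mathcal Y}^w$, and let $\overline{\mathcal Y}'^w$ be the ring of finite sums of products $PR$ with $P\in\mathbb Z[\Psi_{i,a}^{\pm1}]$ and $R$ in the $w$-completion of $\mathbb Z[Y_{i,a}^{\pm1},y_j^{\pm1}]$. Put $$\Pi=\bigoplus_{w\in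 W}\widetilde{\mathcal Y}^w,\qquad\Pi'=\bigoplus_{w\in W}\widetilde{\mathcal Y}'^w,\qquad\overline\Pi'=\bigoplus_{w\in W}\overline{\mathcal Y}'^w;$$ monomials are embedded diagonally. Let $\Sigma_{i,a}\in\Pi$ be the element whose $w$-component is $$\sum_{k\ge0}\prod_{0<j\le k}A_{i,aq_i^{-2j+2}}^{-1}\ \text{ if } l(w)<l(ws_i),\qquad-\sum_{k\ge1}\prod_{0<j\le k}A_{i,aq_i^{2j}}\ \text{ if } l(ws_i)<l(w).$$ **Operators.** Below, a ring endomorphism of $\Pi$, $\Pi'$ or $\overline\Pi'$ is called *$i$-continuous* if it maps the $v$-component to the $vs_i$-component for every $v\in W$ and commutes with the infinite sums of monomials that represent elements of the components. **Statement.** The elements $\Sigma_{i,a}\in\Pi$ are well defined, and multiplication identifies $\mathcal Y'\otimes_{\mathcal Y}\widetilde{\mathcal Y}^w$ with the ring of finite sums above. For every $i\in I$ there is exactly one $i$-continuous ring endomorphism $\Theta_i$ of $\Pi$ with $$\Theta_i(Y_{j,a})=Y_{j,a}\ (j\ne i),\qquad\Theta_i(Y_{i,a})=Y_{i,a}A_{i,aq_i^{-1}}^{-1}\frac{\Sigma_{i,aq_i^{-3}}}{\Sigma_{i,aq_i^{-1}}},$$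 and $s_i\mapsto\Theta_i$ defines an action of $W$ on $\Pi$ by ring automorphisms. For every $i\in I$ there is exactly one $i$-continuous ring endomorphism $\Theta_i'$ of $\Pi'$, and exactly one of $\overline\Pi'$, with $$\Theta_i'([\omega])=[s_i(\omega)]\ (\omega\in P),\qquad\Theta_i'(\Psi_{j,a})=\Psi_{j,a}\ (j\neq i),\qquad\Theta_i'(\Psi_{i,a})=\tilde\Psi_{i,aq_i^{-2}}\,\Sigma_{i,aq_i^{-2}}$$ for all $a\in\mathbb C^\times$. The operators $\Theta'_i$ are automorphisms and generate an action of the braid group associated with $\mathfrak g$ on $\Pi'$ and on $\overline\Pi'$ (that is, they satisfy the braid relations $\Theta_i'\Theta_j'\Theta_i'\cdots=\Theta_j'\Theta_i'\Theta_j'\cdots$ with $m_{ij}=2,3,4,6$ factors for $C_{i,j}C_{j,i}=0,1,2,3$). Their restrictions to $\Pi$ are the operators $\Theta_i$, so this braid group action extends the Weyl group action on $\Pi$. -/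

import Mathlib

noncomputable section

open scoped Classical

/-- An indecomposable Cartan matrix `C` of finite type, with index set `I`, together with its
relatively prime positive symmetrizers `d i`.  These are exactly the Cartan matrices of the
finite-dimensional simple complex Lie algebras, in the convention `C i j = ⟨α_i^∨, α_j⟩`.
(`I` is non-empty because the greatest common divisor of the empty family is `0`.) -/
structure CartanDatum (I : Type*) [Fintype I] where
  C : Matrix I I ℤ
  d : I → ℕ
  diag_eq_two : ∀ i, C i i = 2
  nonpos : ∀ i j, i ≠ j → C i j ≤ 0
  d_pos : ∀ i, 0 < d i
  d_coprime : Finset.univ.gcd d = 1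
  symm : ∀ i j, (d i : ℤ) * C i j = (d j : ℤ) * C j i
  posDef : ∀ x : I → ℤ, x ≠ 0 → 0 < ∑ i, ∑ j, x i * ((d i : ℤ) * C i j) * x j
  indecomposable : ∀ S : Set I, S.Nonempty → (∀ i ∈ S, ∀ j ∉ S, C i j = 0) → S = Set.univ

namespace CartanDatum

variable {I : Type*} [Fintype I] (D : CartanDatum I)

/-! ### Weight lattice, Weyl group, braid group -/

/-- The simple root `α_i = ∑ k, C k i • ω_k` in the weight lattice `P = ⨁ ℤ ω_k = (I → ℤ)`. -/
def root (i : I) : I → ℤ := fun k => D.C k i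

/-- The simple reflection `s_i` on `P`: `s_i ω_j = ω_j - δ_{ij} α_i`. -/
def refl (i : I) : Module.End ℤ (I → ℤ) :=
  LinearMap.id - (LinearMap.proj i).smulRight (D.root i)

/-- The order `m_{ij}` of `s_i s_j`: `2, 3, 4, 6` for `C_{ij} C_{ji} = 0, 1, 2, 3`. -/
def cox : CoxeterMatrix I where
  M := Matrix.of fun i j =>
    if i = j then 1
    else if D.C i j * D.C j i = 0 then 2
    else if D.C i j * D.C j i = 1 then 3
    else if D.C i j * D.C j i = 2 then 4
    else 6
  isSymm := by
    ext i j
    simp only [Matrix.transpose_apply, Matrix.of_apply, mul_comm (D.C j i), eq_comm (a := j)]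
  diagonal i := by simp
  off_diagonal i j h := by
    simp only [Matrix.of_apply, if_neg h]
    split_ifs <;> norm_num

/-- The Weyl group, as the Coxeter group generated by the simple reflections. -/
abbrev W : Type _ := D.cox.Group

/-- The simple reflection `s_i ∈ W`. -/
abbrev s (i : I) : D.W := D.cox.simple i

/-- The length function of `W`. -/
abbrev len (w : D.W) : ℕ := D.cox.toCoxeterSystem.length w

lemma refl_apply (i : I) (x : I → ℤ) : D.refl i x = x - x i • D.root i := by
  simp [refl]

lemma root_self (i : I) : D.root i i = 2 := D.diag_eq_two i

lemma quad_pair (i j : I) (h : i ≠ j) : D.C i j * D.C j i < 4 := by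
  have hx : (Pi.single i (-D.C i j) + Pi.single j 2 : I → ℤ) ≠ 0 := by
    intro h0
    have := congrFun h0 j
    simp [h] at this
  have := D.posDef _ hx
  have e : ∑ k, ∑ l, (Pi.single i (-D.C i j) + Pi.single j 2 : I → ℤ) k *
      ((D.d k : ℤ) * D.C k l) * (Pi.single i (-D.C i j) + Pi.single j 2 : I → ℤ) l
      = 2 * (D.d j : ℤ) * (4 - D.C i j * D.C j i) := by
    simp only [Pi.add_apply, Pi.single_apply, add_mul, mul_add, Finset.sum_add_distrib, ite_mul,
      mul_ite, zero_mul, mul_zero, Finset.sum_ite_eq', Finset.mem_univ, if_true,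
      D.diag_eq_two]
    ring
  rw [e] at this
  have hd : (0 : ℤ) < 2 * (D.d j : ℤ) := by have := D.d_pos j; positivity
  have := pos_of_mul_pos_right this hd.le
  linarith

lemma refl_pair (i j : I) (x : I → ℤ) (u v : ℤ) :
    (D.refl i * D.refl j) (x - u • D.root i - v • D.root j) =
      x - (x i - u - D.C i j * (x j - u * D.C j i - v)) • D.root i
        - (x j - u * D.C j i - v) • D.root j := by
  rw [Module.End.mul_apply, refl_apply, refl_apply]
  ext k
  simp only [Pi.sub_apply, Pi.smul_apply, smul_eq_mul, root_self]
  simp only [root]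
  ring

lemma refl_sq (i : I) : D.refl i * D.refl i = 1 := by
  ext1 x
  ext1
  ext k
  simp only [LinearMap.comp_apply, Module.End.mul_apply, Module.End.one_apply, refl_apply,
    Pi.sub_apply, Pi.smul_apply, smul_eq_mul, root_self]
  ring

lemma cartan_cases (i j : I) (h : i ≠ j) :
    (D.C i j = 0 ∧ D.C j i = 0) ∨ (D.C i j = -1 ∧ D.C j i = -1) ∨
    (D.C i j = -1 ∧ D.C j i = -2) ∨ (D.C i j = -2 ∧ D.C j i = -1) ∨
    (D.C i j = -1 ∧ D.C j i = -3) ∨ (D.C i j = -3 ∧ D.C j i = -1) := by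
  have h1 := D.quad_pair i j h
  have h2 := D.nonpos i j h
  have h3 := D.nonpos j i h.symm
  have h4 := D.symm i j
  have hi : (0 : ℤ) < D.d i := by exact_mod_cast D.d_pos i
  have hj : (0 : ℤ) < D.d j := by exact_mod_cast D.d_pos j
  generalize D.C i j = p at *
  generalize D.C j i = r at *
  rcases eq_or_ne p 0 with rfl | hp
  · left
    refine ⟨rfl, ?_⟩
    have : (D.d j : ℤ) * r = 0 := by rw [← h4]; ring
    exact (mul_eq_zero.1 this).resolve_left hj.ne'
  · have hr : r ≠ 0 := by
      rintro rfl
      have : (D.d i : ℤ) * p = 0 := by rw [h4]; ring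
      exact hp ((mul_eq_zero.1 this).resolve_left hi.ne')
    have hp' : p ≤ -1 := by omega
    have hr' : r ≤ -1 := by omega
    have : -4 < p := by nlinarith
    have : -4 < r := by nlinarith
    interval_cases p <;> interval_cases r <;> simp_all

lemma refl_liftable : D.cox.IsLiftable D.refl := by
  intro i j
  rcases eq_or_ne i j with rfl | h
  · simp [refl_sq]
  · refine LinearMap.ext fun x => ?_
    have base : x = x - (0 : ℤ) • D.root i - (0 : ℤ) • D.root j := by simp
    rcases D.cartan_cases i j h with c | c | c | c | c | c <;>
    · obtain ⟨c1, c2⟩ := c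
      simp only [cox, Matrix.of_apply, h, if_false, c1, c2]
      norm_num
      nth_rewrite 1 [base]
      simp only [pow_succ, pow_zero, one_mul, Module.End.mul_apply (_ * _) (_ * _), refl_pair,
        c1, c2]
      ext k
      simp only [Pi.sub_apply, Pi.smul_apply, smul_eq_mul]
      ring

/-- The action of `W` on the weight lattice `P`. -/
def act : D.W →* Module.End ℤ (I → ℤ) := D.cox.toCoxeterSystem.lift ⟨D.refl, D.refl_liftable⟩

/-- The relations `σ_i σ_j σ_i ⋯ = σ_j σ_i σ_j ⋯` (`m_{ij}` factors on either side). -/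
def braidRels : Set (FreeGroup I) :=
  {r | ∃ i j, r = ((CoxeterSystem.alternatingWord i j (D.cox i j)).map FreeGroup.of).prod *
    (((CoxeterSystem.alternatingWord j i (D.cox i j)).map FreeGroup.of).prod)⁻¹}

/-- The braid group associated with the Cartan matrix. -/
abbrev Braid : Type _ := PresentedGroup D.braidRels

/-- The generators of the braid group. -/
abbrev gen (i : I) : D.Braid := PresentedGroup.of i

/-! ### The partial orderings on weights and monomials -/

/-- Membership in `Q⁺ = ∑ ℤ_{≥ 0} α_i`. -/
def QPos (x : I → ℤ) : Prop := ∃ k : I → ℕ, x = ∑ i, (k i : ℤ) • D.root i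

/-- `x ≤_w y`, that is `w x ≤ w y` for the standard ordering of weights. -/
def LeW (w : D.W) (x y : I → ℤ) : Prop := D.QPos (D.act w (y - x))

lemma root_indep (c : I → ℤ) (h : ∑ i, c i • D.root i = 0) : c = 0 := by
  by_contra hc
  have := D.posDef c hc
  have e : ∑ i, ∑ j, c i * ((D.d i : ℤ) * D.C i j) * c j
      = ∑ i, c i * (D.d i : ℤ) * (∑ j, c j • D.root j) i := by
    refine Finset.sum_congr rfl fun i _ => ?_
    rw [Finset.sum_apply, Finset.mul_sum]
    refine Finset.sum_congr rfl fun j _ => ?_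
    simp only [Pi.smul_apply, smul_eq_mul, root]
    ring
  rw [e, h] at this
  simp at this

lemma QPos.add {D : CartanDatum I} {x y : I → ℤ} (hx : D.QPos x) (hy : D.QPos y) :
    D.QPos (x + y) := by
  obtain ⟨k, rfl⟩ := hx
  obtain ⟨l, rfl⟩ := hy
  exact ⟨k + l, by simp [add_smul, Finset.sum_add_distrib]⟩

lemma QPos.zero : D.QPos 0 := ⟨0, by simp⟩

lemma act_injective (w : D.W) : Function.Injective (D.act w) := by
  refine Function.LeftInverse.injective (g := D.act w⁻¹) fun x => ?_
  rw [← Module.End.mul_apply, ← map_mul]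
  simp

lemma LeW.refl' (w : D.W) (x : I → ℤ) : D.LeW w x x := by
  simpa [LeW] using QPos.zero D

lemma LeW.trans {D : CartanDatum I} {w : D.W} {x y z : I → ℤ} (h : D.LeW w x y)
    (h' : D.LeW w y z) : D.LeW w x z := by
  have := QPos.add h h'
  rw [← map_add] at this
  rwa [LeW, show z - x = y - x + (z - y) by abel]

lemma LeW.add {D : CartanDatum I} {w : D.W} {x y x' y' : I → ℤ} (h : D.LeW w x y)
    (h' : D.LeW w x' y') : D.LeW w (x + x') (y + y') := by
  have := QPos.add h h'
  rw [← map_add] at this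
  rwa [LeW, show y + y' - (x + x') = y - x + (y' - x') by abel]

lemma LeW.antisymm {D : CartanDatum I} {w : D.W} {x y : I → ℤ} (h : D.LeW w x y)
    (h' : D.LeW w y x) : x = y := by
  obtain ⟨k, hk⟩ := h
  obtain ⟨l, hl⟩ := h'
  have h0 : ∑ i, ((k i : ℤ) + l i) • D.root i = 0 := by
    simp only [add_smul, Finset.sum_add_distrib]
    rw [← hk, ← hl, ← map_add]
    simp
  have h1 := D.root_indep _ h0
  have h2 : k = 0 := by
    funext i
    have := congrFun h1 i
    simp only [Pi.zero_apply] at this ⊢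
    omega
  subst h2
  have : D.act w (y - x) = D.act w 0 := by rw [hk]; simp
  exact (sub_eq_zero.1 (D.act_injective w this)).symm

/-- An interval for `≤_w` is finite. -/
lemma finite_interval (w : D.W) (x y : I → ℤ) : {z | D.LeW w x z ∧ D.LeW w z y}.Finite := by
  by_cases hxy : ∃ z, D.LeW w x z ∧ D.LeW w z y
  · obtain ⟨z₀, h₁, h₂⟩ := hxy
    obtain ⟨K, hK⟩ := h₁.trans h₂
    have hfin : (Set.Iic K).Finite := Set.finite_Iic K
    refine Set.Finite.of_finite_image (f := fun z => D.act w (z - x)) ?_ ?_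
    · refine (hfin.image fun k : I → ℕ => ∑ i, (k i : ℤ) • D.root i).subset ?_
      rintro _ ⟨z, ⟨⟨k, hk⟩, ⟨l, hl⟩⟩, rfl⟩
      refine ⟨k, ?_, hk.symm⟩
      have h0 : ∑ i, ((k i : ℤ) + l i - K i) • D.root i = 0 := by
        simp only [sub_smul, add_smul, Finset.sum_add_distrib, Finset.sum_sub_distrib]
        rw [← hk, ← hl, ← hK, ← map_add, ← map_sub]
        simp
      refine Set.mem_Iic.2 fun i => ?_
      have : (k i : ℤ) + l i - K i = 0 := congrFun (D.root_indep _ h0) i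
      show k i ≤ K i
      omega
    · intro z _ z' _ h
      simpa using D.act_injective w h
  · convert Set.finite_empty
    exact Set.eq_empty_iff_forall_notMem.2 fun z hz => hxy ⟨z, hz⟩

end CartanDatum

/-- Laurent monomials in the variables `Ψ_{i,a}` and `y_i`, written additively: the pair `(u, x)`
is `∏ Ψ_{i,a} ^ u(i,a) · [x]` with `[x] = ∏ y_i ^ x_i`, and `x` is the weight of the monomial. -/
abbrev Mono (I : Type*) : Type _ := ((I × ℂˣ) →₀ ℤ) × (I → ℤ)

namespace CartanDatum

variable {I : Type*} [Fintype I] (D : CartanDatum I)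

/-- The group of monomials, endowed with the (reversed) partial ordering `≺_w`. -/
def OrdMono (_w : D.W) : Type _ := Mono I

instance (w : D.W) : AddCommGroup (D.OrdMono w) := inferInstanceAs (AddCommGroup (Mono I))

/-- The underlying monomial. -/
def toMono (w : D.W) : D.OrdMono w ≃+ Mono I := AddEquiv.refl _

/-- The weight of a monomial. -/
def wt (w : D.W) (m : D.OrdMono w) : I → ℤ := (D.toMono w m).2

lemma wt_add (w : D.W) (m n : D.OrdMono w) : D.wt w (m + n) = D.wt w m + D.wt w n := by
  simp [wt]

/-- `m < n` means that the weight of `n` is strictly smaller than the weight of `m` for `<_w`. -/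
instance (w : D.W) : PartialOrder (D.OrdMono w) where
  le m n := m = n ∨ (D.LeW w (D.wt w n) (D.wt w m) ∧ D.wt w n ≠ D.wt w m)
  le_refl m := Or.inl rfl
  le_trans m n p := by
    rintro (rfl | ⟨h1, h2⟩)
    · exact id
    · rintro (rfl | ⟨h3, h4⟩)
      · exact Or.inr ⟨h1, h2⟩
      · refine Or.inr ⟨h3.trans h1, fun h => ?_⟩
        rw [h] at h3
        exact h2 (h1.antisymm h3)
  le_antisymm m n := by
    rintro (rfl | ⟨h1, h2⟩)
    · exact fun _ => rfl
    · rintro (rfl | ⟨h3, h4⟩)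
      · rfl
      · exact absurd (h1.antisymm h3) h2

instance (w : D.W) : IsOrderedAddMonoid (D.OrdMono w) where
  add_le_add_left m n h p := by
    rcases h with rfl | ⟨h1, h2⟩
    · exact le_rfl
    · refine Or.inr ⟨?_, ?_⟩
      · rw [wt_add, wt_add]
        exact h1.add (LeW.refl' D w _)
      · rw [wt_add, wt_add]
        simpa using h2

/-- An ambient ring of formal integral combinations of monomials, in which the completions
attached to `w` are realized as subrings. -/
abbrev Series (w : D.W) : Type _ := HahnSeries (D.OrdMono w) ℤ

/-- A monomial, viewed as an element of `Series w`. -/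
def mono (w : D.W) (m : Mono I) : D.Series w := HahnSeries.single ((D.toMono w).symm m) 1

/-- The coefficient of a monomial. -/
def coef (w : D.W) (x : D.Series w) (m : Mono I) : ℤ := x.coeff ((D.toMono w).symm m)

/-- The support condition defining the completion with respect to `≺_w`: the weights that occur lie
in a finite union of cones `{y | y ≤_w x}`, and each weight occurs finitely many times. -/
def ConeFinite (w : D.W) (S : Set (D.OrdMono w)) : Prop :=
  (∃ B : Set (I → ℤ), B.Finite ∧ ∀ m ∈ S, ∃ x ∈ B, D.LeW w (D.wt w m) x) ∧
    ∀ y, {m ∈ S | D.wt w m = y}.Finite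

variable {D} in
lemma ConeFinite.mono {w : D.W} {S T : Set (D.OrdMono w)} (h : D.ConeFinite w T) (hS : S ⊆ T) :
    D.ConeFinite w S := by
  obtain ⟨⟨B, hB, h1⟩, h2⟩ := h
  exact ⟨⟨B, hB, fun m hm => h1 m (hS hm)⟩, fun y => (h2 y).subset fun m hm => ⟨hS hm.1, hm.2⟩⟩

variable {D} in
lemma ConeFinite.union {w : D.W} {S T : Set (D.OrdMono w)} (h : D.ConeFinite w S)
    (h' : D.ConeFinite w T) : D.ConeFinite w (S ∪ T) := by
  obtain ⟨⟨B, hB, h1⟩, h2⟩ := h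
  obtain ⟨⟨B', hB', h1'⟩, h2'⟩ := h'
  refine ⟨⟨B ∪ B', hB.union hB', ?_⟩, fun y => ((h2 y).union (h2' y)).subset ?_⟩
  · rintro m (hm | hm)
    · obtain ⟨x, hx, h⟩ := h1 m hm
      exact ⟨x, Or.inl hx, h⟩
    · obtain ⟨x, hx, h⟩ := h1' m hm
      exact ⟨x, Or.inr hx, h⟩
  · rintro m ⟨hm | hm, e⟩
    · exact Or.inl ⟨hm, e⟩
    · exact Or.inr ⟨hm, e⟩

open scoped Pointwise in
variable {D} in
lemma ConeFinite.add {w : D.W} {S T : Set (D.OrdMono w)} (h : D.ConeFinite w S)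
    (h' : D.ConeFinite w T) : D.ConeFinite w (S + T) := by
  obtain ⟨⟨B, hB, h1⟩, h2⟩ := h
  obtain ⟨⟨B', hB', h1'⟩, h2'⟩ := h'
  refine ⟨⟨B + B', hB.add hB', ?_⟩, fun y => ?_⟩
  · rintro _ ⟨m, hm, n, hn, rfl⟩
    obtain ⟨x, hx, h⟩ := h1 m hm
    obtain ⟨x', hx', h'⟩ := h1' n hn
    exact ⟨x + x', Set.add_mem_add hx hx', by simpa only [wt_add] using h.add h'⟩
  · -- the possible weights of the first factor lie in finitely many finite intervals
    let Z : Set (I → ℤ) := ⋃ x ∈ B, ⋃ x' ∈ B', {z | D.LeW w (y - x') z ∧ D.LeW w z x}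
    have hZ : Z.Finite :=
      hB.biUnion fun x _ => hB'.biUnion fun x' _ => D.finite_interval w (y - x') x
    have hF : (⋃ z ∈ Z, ({m ∈ S | D.wt w m = z} + {n ∈ T | D.wt w n = y - z})).Finite :=
      hZ.biUnion fun z _ => (h2 z).add (h2' (y - z))
    refine hF.subset ?_
    rintro _ ⟨⟨m, hm, n, hn, rfl⟩, e⟩
    simp only [wt_add] at e
    obtain ⟨x, hx, h⟩ := h1 m hm
    obtain ⟨x', hx', h'⟩ := h1' n hn
    have e' : D.wt w n = y - D.wt w m := by rw [← e]; abel
    refine Set.mem_biUnion (x := D.wt w m) ?_ (Set.add_mem_add ⟨hm, rfl⟩ ⟨hn, e'⟩)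
    refine Set.mem_biUnion hx (Set.mem_biUnion hx' ⟨?_, h⟩)
    have e2 : D.wt w m - (y - x') = x' - D.wt w n := by rw [← e]; abel
    rw [LeW, e2]
    exact h'

lemma ConeFinite.of_finite (w : D.W) {S : Set (D.OrdMono w)} (h : S.Finite) :
    D.ConeFinite w S :=
  ⟨⟨D.wt w '' S, h.image _, fun m hm => ⟨_, ⟨m, hm, rfl⟩, LeW.refl' D w _⟩⟩,
    fun _ => h.subset fun _ hm => hm.1⟩

/-- The Laurent polynomials (finite sums) all of whose monomials belong to `N`. -/
def poly (w : D.W) (N : AddSubgroup (Mono I)) : Subring (D.Series w) where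
  carrier := {x | x.support.Finite ∧ ∀ m ∈ x.support, D.toMono w m ∈ N}
  zero_mem' := by simp
  one_mem' := by
    have : (1 : D.Series w).support ⊆ {0} := HahnSeries.support_single_subset
    refine ⟨(Set.finite_singleton _).subset this, fun m hm => ?_⟩
    rw [Set.mem_singleton_iff.1 (this hm), map_zero]
    exact N.zero_mem
  add_mem' := by
    rintro x y ⟨h1, h2⟩ ⟨h3, h4⟩
    have hs : (x + y).support ⊆ x.support ∪ y.support := HahnSeries.support_add_subset _ _
    refine ⟨(h1.union h3).subset hs, fun m hm => ?_⟩
    rcases hs hm with h | h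
    · exact h2 m h
    · exact h4 m h
  neg_mem' := by
    rintro x ⟨h1, h2⟩
    have : (-x).support = x.support := HahnSeries.support_neg
    exact ⟨this ▸ h1, fun m hm => h2 m (this ▸ hm)⟩
  mul_mem' := by
    rintro x y ⟨h1, h2⟩ ⟨h3, h4⟩
    have hs := HahnSeries.support_mul_subset (x := x) (y := y)
    refine ⟨(h1.add h3).subset hs, fun m hm => ?_⟩
    obtain ⟨a, ha, b, hb, rfl⟩ := hs hm
    rw [map_add]
    exact N.add_mem (h2 a ha) (h4 b hb)

/-- The completion with respect to `≺_w` of the ring of Laurent polynomials all of whose monomials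
belong to `N`. -/
def compl (w : D.W) (N : AddSubgroup (Mono I)) : Subring (D.Series w) where
  carrier := {x | D.ConeFinite w x.support ∧ ∀ m ∈ x.support, D.toMono w m ∈ N}
  zero_mem' := by simpa using ConeFinite.of_finite D w Set.finite_empty
  one_mem' :=
    have h := (D.poly w N).one_mem
    ⟨ConeFinite.of_finite D w h.1, h.2⟩
  add_mem' := by
    rintro x y ⟨h1, h2⟩ ⟨h3, h4⟩
    have hs : (x + y).support ⊆ x.support ∪ y.support := HahnSeries.support_add_subset _ _
    refine ⟨(h1.union h3).mono hs, fun m hm => ?_⟩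
    rcases hs hm with h | h
    · exact h2 m h
    · exact h4 m h
  neg_mem' := by
    rintro x ⟨h1, h2⟩
    have : (-x).support = x.support := HahnSeries.support_neg
    exact ⟨this ▸ h1, fun m hm => h2 m (this ▸ hm)⟩
  mul_mem' := by
    rintro x y ⟨h1, h2⟩ ⟨h3, h4⟩
    have hs := HahnSeries.support_mul_subset (x := x) (y := y)
    refine ⟨(h1.add h3).mono hs, fun m hm => ?_⟩
    obtain ⟨a, ha, b, hb, rfl⟩ := hs hm
    rw [map_add]
    exact N.add_mem (h2 a ha) (h4 b hb)

/-- Every family of coefficients satisfying the support condition is a series: the ambient ring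
`Series w` imposes no further restriction. -/
lemma ConeFinite.isPWO {w : D.W} {S : Set (D.OrdMono w)} (h : D.ConeFinite w S) : S.IsPWO := by
  obtain ⟨⟨B, hB, h1⟩, h2⟩ := h
  have key : S ⊆ ⋃ x ∈ B, {m ∈ S | D.LeW w (D.wt w m) x} := fun m hm => by
    obtain ⟨x, hx, h⟩ := h1 m hm
    exact Set.mem_biUnion hx ⟨hm, h⟩
  refine Set.IsPWO.mono ?_ key
  rw [← hB.coe_toFinset]
  simp only [Finset.mem_coe]
  refine (Finset.isPWO_bUnion _).2 fun x _ => ?_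
  intro F
  let f : ℕ → D.OrdMono w := fun n => (F n).1
  have hf : ∀ n, f n ∈ {m ∈ S | D.LeW w (D.wt w m) x} := fun n => (F n).2
  choose k hk using fun n => (hf n).2
  obtain ⟨g, hg⟩ := (Set.isPWO_of_wellQuasiOrderedLE (Set.univ : Set (I → ℕ))).exists_monotone_subseq
    (f := k) (fun _ => Set.mem_univ _)
  have hle : ∀ a b, a ≤ b → D.LeW w (D.wt w (f (g b))) (D.wt w (f (g a))) := fun a b hab => by
    refine ⟨k (g b) - k (g a), ?_⟩
    have e : D.wt w (f (g a)) - D.wt w (f (g b)) =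
      (x - D.wt w (f (g b))) - (x - D.wt w (f (g a))) := by abel
    rw [e, map_sub, hk, hk, ← Finset.sum_sub_distrib]
    refine Finset.sum_congr rfl fun i _ => ?_
    have : k (g a) i ≤ k (g b) i := hg hab i
    rw [← sub_smul, Pi.sub_apply, Nat.cast_sub this]
  by_contra hcon
  push Not at hcon
  have hno : ∀ a b, a < b → ¬ f (g a) ≤ f (g b) := fun a b hab => hcon _ _ (g.strictMono hab)
  have hinj : Function.Injective fun n => f (g n) := fun a b e => by
    rcases lt_trichotomy a b with h | h | h
    · exact absurd (le_of_eq e) (hno _ _ h)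
    · exact h
    · exact absurd (le_of_eq e.symm) (hno _ _ h)
  have hwt : ∀ n, D.wt w (f (g n)) = D.wt w (f (g 0)) := fun n => by
    rcases Nat.eq_zero_or_pos n with rfl | hn
    · rfl
    · by_contra hne
      exact hno 0 n hn (Or.inr ⟨hle 0 n hn.le, hne⟩)
  have hmem : ∀ n, f (g n) ∈ {m | m ∈ S ∧ D.wt w m = D.wt w (f (g 0))} :=
    fun n => ⟨(hf (g n)).1, hwt n⟩
  exact Set.infinite_of_injective_forall_mem hinj hmem (h2 _)

/-! ### The rings `𝒴`, `𝒴'` and their completions -/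

variable (q : ℂˣ)

/-- `q_i = q ^ d_i`. -/
def qi (i : I) : ℂˣ := q ^ D.d i

/-- The monomial `Ψ_{i,a}`. -/
def psi (i : I) (a : ℂˣ) : Mono I := (Finsupp.single (i, a) 1, 0)

/-- The monomial `[x]`, for a weight `x`. -/
def wtMono (x : I → ℤ) : Mono I := (0, x)

/-- The monomial `Y_{i,a} = [ω_i] Ψ_{i,a q_i⁻¹} Ψ_{i,a q_i}⁻¹`. -/
def Y (i : I) (a : ℂˣ) : Mono I :=
  wtMono (Pi.single i 1) + psi i (a * (D.qi q i)⁻¹) - psi i (a * D.qi q i)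

/-- The monomial `∏ Y_{i,a} ^ u(i,a)`. -/
def yMono : ((I × ℂˣ) →₀ ℤ) →+ Mono I :=
  Finsupp.liftAddHom fun p => (zmultiplesHom (Mono I)) (D.Y q p.1 p.2)

/-- The monomial `A_{i,a}`. -/
def A (i : I) (a : ℂˣ) : Mono I :=
  D.Y q i (a * (D.qi q i)⁻¹) + D.Y q i (a * D.qi q i)
    - ((∑ j with D.C j i = -1, D.Y q j a)
      + (∑ j with D.C j i = -2, (D.Y q j (a * q⁻¹) + D.Y q j (a * q)))
      + ∑ j with D.C j i = -3, (D.Y q j (a * q⁻¹ ^ 2) + D.Y q j a + D.Y q j (a * q ^ 2)))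

/-- The monomial `Ψ̃_{i,a}`. -/
def psiTilde (i : I) (a : ℂˣ) : Mono I :=
  -psi i a
    + (∑ j with D.C i j = -1, psi j (a * D.qi q i))
    + (∑ j with D.C i j = -2, (psi j a + psi j (a * q ^ 2)))
    + ∑ j with D.C i j = -3, (psi j (a * q⁻¹) + psi j (a * q) + psi j (a * q ^ 3))

/-- The group `ℳ` of monomials in the `Y_{i,a}`. -/
def monoY : AddSubgroup (Mono I) := (D.yMono q).range

/-- The group of monomials in the `Y_{i,a}` and the `y_j`. -/
def monoYy : AddSubgroup (Mono I) :=
  D.monoY q ⊔ (AddMonoidHom.inr ((I × ℂˣ) →₀ ℤ) (I → ℤ)).range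

/-- The group of monomials in the `Ψ_{i,a}`. -/
def monoPsi (I : Type*) : AddSubgroup (Mono I) := (AddMonoidHom.inl ((I × ℂˣ) →₀ ℤ) (I → ℤ)).range

/-- The ring `𝒴`. -/
abbrev ringY (w : D.W) : Subring (D.Series w) := D.poly w (D.monoY q)

/-- The ring `𝒴' = ℤ[Ψ_{i,a}^{±1}, y_j^{±1}]`. -/
abbrev ringY' (w : D.W) : Subring (D.Series w) := D.poly w ⊤

/-- The completion of `𝒴` with respect to `≺_w`. -/
abbrev complY (w : D.W) : Subring (D.Series w) := D.compl w (D.monoY q)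

/-- The summand of `Π'` attached to `w`: finite sums of products of an element of `𝒴'` and an
element of the completion of `𝒴`. -/
def complY' (w : D.W) : Subring (D.Series w) := D.ringY' w ⊔ D.complY q w

/-- The summand of `Π̄'` attached to `w`: finite sums of products of a Laurent polynomial in the
`Ψ_{i,a}` and an element of the completion of the ring of Laurent polynomials in the `Y_{i,a}`
and the `y_j`, with respect to the ordering of their monomials by weight. -/
def complYbar (w : D.W) : Subring (D.Series w) :=
  D.poly w (monoPsi I) ⊔ D.compl w (D.monoYy q)

variable {D} in
lemma poly_mono {w : D.W} {N N' : AddSubgroup (Mono I)} (h : N ≤ N') : D.poly w N ≤ D.poly w N' :=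
  fun _ hx => ⟨hx.1, fun m hm => h (hx.2 m hm)⟩

lemma poly_le_compl (w : D.W) (N : AddSubgroup (Mono I)) : D.poly w N ≤ D.compl w N :=
  fun _ hx => ⟨ConeFinite.of_finite D w hx.1, hx.2⟩

/-- `𝒴'` as an algebra over `𝒴`. -/
def algY' (w : D.W) : Subalgebra (D.ringY q w) (D.Series w) :=
  { D.ringY' w with algebraMap_mem' := fun r => poly_mono le_top r.2 }

/-- The completion of `𝒴` as an algebra over `𝒴`. -/
def algComplY (w : D.W) : Subalgebra (D.ringY q w) (D.Series w) :=
  { D.complY q w with algebraMap_mem' := fun r => D.poly_le_compl w _ r.2 }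

lemma mono_mem_poly (w : D.W) {N : AddSubgroup (Mono I)} {m : Mono I} (hm : m ∈ N) :
    D.mono w m ∈ D.poly w N := by
  have : (D.mono w m).support ⊆ {(D.toMono w).symm m} := HahnSeries.support_single_subset
  refine ⟨(Set.finite_singleton _).subset this, fun n hn => ?_⟩
  rw [Set.mem_singleton_iff.1 (this hn), AddEquiv.apply_symm_apply]
  exact hm

lemma yMono_mem_complY (w : D.W) (u : (I × ℂˣ) →₀ ℤ) : D.mono w (D.yMono q u) ∈ D.complY q w :=
  D.poly_le_compl w _ (D.mono_mem_poly w ⟨u, rfl⟩)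

lemma mono_mem_complY' (w : D.W) (m : Mono I) : D.mono w m ∈ D.complY' q w :=
  (le_sup_left : D.ringY' w ≤ D.complY' q w) (D.mono_mem_poly w (AddSubgroup.mem_top m))

lemma mono_mem_complYbar (w : D.W) (m : Mono I) : D.mono w m ∈ D.complYbar q w := by
  have e : D.mono w m = D.mono w (m.1, 0) * D.mono w (0, m.2) := by
    simp only [mono, HahnSeries.single_mul_single, ← map_add, mul_one]
    simp
  rw [e]
  refine Subring.mul_mem _ (le_sup_left (a := D.poly w (monoPsi I)) (D.mono_mem_poly w ⟨m.1, rfl⟩))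
    (le_sup_right (a := D.poly w (monoPsi I)) (b := D.compl w (D.monoYy q))
      (D.poly_le_compl w _ (D.mono_mem_poly w ?_)))
  exact (le_sup_right : _ ≤ D.monoYy q) ⟨m.2, rfl⟩

/-! ### The solutions `Σ_{i,a}` of the difference equation -/

/-- The monomial `∏_{0 < j ≤ k} A_{i, a q_i^{-2j+2}}⁻¹`. -/
def termE (i : I) (a : ℂˣ) (k : ℕ) : Mono I :=
  -∑ j ∈ Finset.range k, D.A q i (a * (D.qi q i)⁻¹ ^ (2 * j))

/-- The monomial `∏_{0 < j ≤ k} A_{i, a q_i^{2j}}`. -/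
def termS (i : I) (a : ℂˣ) (k : ℕ) : Mono I :=
  ∑ j ∈ Finset.range k, D.A q i (a * D.qi q i ^ (2 * (j + 1)))

/-- Coefficients of `Σ^e_{i,a} = ∑_{k ≥ 0} ∏_{0 < j ≤ k} A_{i, a q_i^{-2j+2}}⁻¹`. -/
def coefE (i : I) (a : ℂˣ) (m : Mono I) : ℤ := if ∃ k, m = D.termE q i a k then 1 else 0

/-- Coefficients of `Σ^{s_i}_{i,a} = -∑_{k ≥ 1} ∏_{0 < j ≤ k} A_{i, a q_i^{2j}}`. -/
def coefS (i : I) (a : ℂˣ) (m : Mono I) : ℤ :=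
  if ∃ k, 1 ≤ k ∧ m = D.termS q i a k then -1 else 0

/-- Coefficients of the component of `Σ_{i,a}` attached to `w`: it is `Σ^e_{i,a}` if
`l(w) < l(w s_i)` and `Σ^{s_i}_{i,a}` if `l(w s_i) < l(w)`. -/
def sigmaCoef (w : D.W) (i : I) (a : ℂˣ) : Mono I → ℤ :=
  if D.len w < D.len (w * D.s i) then D.coefE q i a else D.coefS q i a

/-- The component of `Σ_{i,a}` attached to `w`, as a series.  (The value `0` in the second case is a
default; the second case does not occur.) -/
def sigma (w : D.W) (i : I) (a : ℂˣ) : D.Series w :=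
  if h : (Function.support fun m : D.OrdMono w => D.sigmaCoef q w i a (D.toMono w m)).IsPWO then
    ⟨fun m => D.sigmaCoef q w i a (D.toMono w m), h⟩
  else 0

/-! ### The operators -/

/-- For a family `R w` of rings of series containing the monomials `κ t`, `t ∈ T`, the element of
`⨁ R w` (the Weyl group is finite, so this is `∏ R w`) that is `κ t` in every component. -/
def diagMono {R : ∀ w, Subring (D.Series w)} {T : Type*} {κ : T → Mono I}
    (hκ : ∀ w t, D.mono w (κ t) ∈ R w) (t : T) : ∀ w, R w :=
  fun w => ⟨D.mono w (κ t), hκ w t⟩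

/-- `F` maps the component attached to `v` to the one attached to `v s_i` and is compatible with
infinite sums: the component attached to `v s_i` of `F x` is `∑ c_t F(κ t)` if the component
attached to `v` of `x` is `∑ c_t κ t`, where for every monomial only finitely many terms
contribute to its coefficient. -/
def IsContinuousAt {R : ∀ w, Subring (D.Series w)} {T : Type*} {κ : T → Mono I}
    (hκ : ∀ w t, D.mono w (κ t) ∈ R w) (i : I) (F : (∀ w, R w) →+* (∀ w, R w)) : Prop :=
  ∀ (v : D.W) (x : ∀ w, R w) (n : Mono I),
    {t | D.coef v (x v) (κ t) ≠ 0 ∧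
      D.coef (v * D.s i) (F (D.diagMono hκ t) (v * D.s i)) n ≠ 0}.Finite ∧
    D.coef (v * D.s i) (F x (v * D.s i)) n =
      ∑ᶠ t, D.coef v (x v) (κ t) * D.coef (v * D.s i) (F (D.diagMono hκ t) (v * D.s i)) n

/-- The defining properties of the operator `Θ_i` on `Π`: `Y_{j,a} ↦ Y_{j,a}` for `j ≠ i` and
`Y_{i,a} ↦ Y_{i,a} A_{i,a q_i⁻¹}⁻¹ Σ_{i,a q_i⁻³} / Σ_{i,a q_i⁻¹}`. -/
structure IsTheta (i : I) (F : (∀ w, D.complY q w) →+* (∀ w, D.complY q w)) : Prop where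
  continuous : D.IsContinuousAt (D.yMono_mem_complY q) i F
  map_Y_of_ne : ∀ j a, j ≠ i →
    F (D.diagMono (D.yMono_mem_complY q) (Finsupp.single (j, a) 1)) =
      D.diagMono (D.yMono_mem_complY q) (Finsupp.single (j, a) 1)
  map_Y : ∀ a w,
    (F (D.diagMono (D.yMono_mem_complY q) (Finsupp.single (i, a) 1)) w : D.Series w)
        * D.sigma q w i (a * (D.qi q i)⁻¹) =
      D.mono w (D.Y q i a - D.A q i (a * (D.qi q i)⁻¹))
        * D.sigma q w i (a * (D.qi q i)⁻¹ ^ 3)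

/-- The defining properties of the operator `Θ'_i` on `⨁ R w`: `[x] ↦ [s_i x]`,
`Ψ_{j,a} ↦ Ψ_{j,a}` for `j ≠ i` and `Ψ_{i,a} ↦ Ψ̃_{i,a q_i⁻²} Σ_{i,a q_i⁻²}`. -/
structure IsThetaPrime {R : ∀ w, Subring (D.Series w)} (hR : ∀ w m, D.mono w m ∈ R w) (i : I)
    (F : (∀ w, R w) →+* (∀ w, R w)) : Prop where
  continuous : D.IsContinuousAt (κ := id) hR i F
  map_wt : ∀ x, F (D.diagMono (κ := id) hR (wtMono x)) = D.diagMono (κ := id) hR (wtMono (D.refl i x))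
  map_psi_of_ne : ∀ j a, j ≠ i →
    F (D.diagMono (κ := id) hR (psi j a)) = D.diagMono (κ := id) hR (psi j a)
  map_psi : ∀ a w, (F (D.diagMono (κ := id) hR (psi i a)) w : D.Series w) =
    D.mono w (D.psiTilde q i (a * (D.qi q i)⁻¹ ^ 2)) * D.sigma q w i (a * (D.qi q i)⁻¹ ^ 2)

end CartanDatum

end

noncomputable section

open scoped Classical

namespace CartanDatum

variable {I : Type*} [Fintype I] (D : CartanDatum I)

/-! ### Positivity of `w α_i` and the length function -/

/-! The operator attached to s_i sends a monomial to a monomial times a product of powers of the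
series Σ_{i,b}. These products are controlled inside one ambient ring `Om`, the product over w of
the rings of series with cone-finite support and finitely many Ψ-degrees. In the component w the
image of a monomial m has a leading term of weight s_i(wt m), corrected by deg_i(m) α_i when w α_i
is negative. Since this bound depends only on the weight and the degree of m, the multiplicative map
on monomials extends to `Om` compatibly with infinite sums (`exists_extension`), and an operator of
this kind (`Good`) is determined by its values on monomials (`Good.ext`). This gives the operators
`theta`; what remains are the relations between them.

Relations on Π. The difference equation Σ_{i,a} = 1 + A_{i,a}⁻¹ Σ_{i,aq_i⁻²} shows that Y_{i,b} +
Y_{i,b} A_{i,bq_i}⁻¹ is invariant under Θ_i (`string_mem_fixRing`), and so is every Y_{j,b} with j ≠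
i. In rank two these invariants generate, for each Y_{t,a}, a common invariant of Θ_i and Θ_j with
leading term Y_{t,a}: the sum of monomials known from the q-character of a fundamental
representation of type A₁×A₁, A₂, B₂ or G₂ (`hasInvariant`). An operator that lowers weights and
fixes elements of the form "generator plus lower terms" is the identity (`eq_of_unitriangular`).
This proves Θ_i² = 1, and (Θ_i Θ_j)^{m_ij} = 1 on the components v that are minimal in their coset v
W_{ij}; the other components follow by conjugation with the involutions Θ_i, Θ_j.

Braid relations on Π' and its variant. The Y_{i,a} determine the Ψ_{i,a} only up to a factor that is
periodic in the spectral parameter. Operators commuting with all shifts of that parameter are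
therefore determined by their values on the Y_{i,a} and on the weights, together with the weights
and signs of the leading terms of the images of the Ψ_{i,a} (`rigidity`). For a word in the
operators these leading terms are sums over the roots attached to the word (`exists_lead_word`), and
the two sides of a braid relation have the same roots up to order. The same argument identifies the
square of Θ'_i with Ψ_{i,a} ↦ -[-α_i] Ψ_{i,a}, which is invertible, so that Θ'_i is an automorphism
although not an involution.

Finally, the summands of Π' and of its variant are rewritten as rings of cone-finite series meeting
finitely many classes modulo a group of monomials (`poly_sup_compl`); in this form they are visibly
stable under the operators. -/

lemma act_s (i : I) : D.act (D.s i) = D.refl i :=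
  D.cox.toCoxeterSystem.lift_apply_simple D.refl_liftable i

lemma s_mul_s_cancel (w : D.W) (i : I) : w * D.s i * D.s i = w :=
  D.cox.toCoxeterSystem.simple_mul_simple_cancel_right i

lemma refl_comb_left (i j : I) (a b : ℤ) : D.refl i (a • D.root i + b • D.root j) =
    (-a - D.C i j * b) • D.root i + b • D.root j := by
  rw [refl_apply]
  ext k
  simp only [Pi.sub_apply, Pi.add_apply, Pi.smul_apply, smul_eq_mul, root_self]
  simp only [root]
  ring

lemma refl_comb_right (i j : I) (a b : ℤ) : D.refl j (a • D.root i + b • D.root j) =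
    a • D.root i + (-b - D.C j i * a) • D.root j := by
  rw [add_comm, refl_comb_left, add_comm]

lemma cox_apply_of_ne {i j : I} (h : i ≠ j) : D.cox i j =
    if D.C i j * D.C j i = 0 then 2 else if D.C i j * D.C j i = 1 then 3
    else if D.C i j * D.C j i = 2 then 4 else 6 := by
  show D.cox.M i j = _
  simp only [cox, Matrix.of_apply, if_neg h]

/-- A finite check in the rank two root systems: no alternating word shorter than m_ij and ending in
s_j can make α_i negative. It is the rank two input of `act_root_pos`. -/
lemma alternating_root_nonneg {i j : I} (h : i ≠ j) (k : ℕ) (hk : k + 1 ≤ D.cox i j) :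
    ∃ a b : ℤ, D.act (D.cox.toCoxeterSystem.wordProd
        (CoxeterSystem.alternatingWord i j k)) (D.root i) = a • D.root i + b • D.root j ∧
      0 ≤ a ∧ 0 ≤ b := by
  have base : D.root i = (1 : ℤ) • D.root i + (0 : ℤ) • D.root j := by simp
  have hs : ∀ l, D.cox.toCoxeterSystem.simple l = D.s l := fun _ => rfl
  rw [cox_apply_of_ne D h] at hk
  rcases D.cartan_cases i j h with c | c | c | c | c | c <;>
  · obtain ⟨c1, c2⟩ := c
    simp only [c1, c2] at hk
    norm_num at hk
    interval_cases k <;>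
    · simp only [CoxeterSystem.alternatingWord, List.concat_eq_append, List.nil_append,
        List.cons_append, CoxeterSystem.wordProd_cons, CoxeterSystem.wordProd_nil, mul_one, hs,
        map_mul, map_one, act_s, Module.End.mul_apply, Module.End.one_apply]
      nth_rewrite 1 [base]
      try simp only [refl_comb_left, refl_comb_right, c1, c2]
      exact ⟨_, _, rfl, by norm_num, by norm_num⟩

/-- The longest alternating suffix of w that ends in s_j and keeps lengths additive is stripped off.
The rest v then has neither s_i nor s_j as a right descent: a descent at the first letter of the
suffix would make w too short, and a descent at the other letter would allow a longer suffix. -/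
lemma exists_dihedral_strip {i j : I} (w : D.W) (hj : D.len (w * D.s j) < D.len w) :
    ∃ k v, 1 ≤ k ∧ D.len w = D.len v + k ∧
      w = v * D.cox.toCoxeterSystem.wordProd (CoxeterSystem.alternatingWord i j k) ∧
      D.len v < D.len (v * D.s i) ∧ D.len v < D.len (v * D.s j) := by
  let cs := D.cox.toCoxeterSystem
  let Q : ℕ → Prop := fun k => ∃ v, D.len w = D.len v + k ∧
    w = v * cs.wordProd (CoxeterSystem.alternatingWord i j k)
  have hQ1 : Q 1 := by
    refine ⟨w * D.s j, ?_, ?_⟩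
    · have := cs.length_mul_simple w j
      change cs.length w = cs.length (w * cs.simple j) + 1
      change cs.length (w * cs.simple j) < cs.length w at hj
      omega
    · simp only [CoxeterSystem.alternatingWord, List.concat_eq_append, List.nil_append,
        CoxeterSystem.wordProd_singleton]
      exact (cs.simple_mul_simple_cancel_right j).symm
  have hbound : ∀ k, Q k → k ≤ D.len w := fun k ⟨v, hv, _⟩ => by omega
  let k := Nat.findGreatest Q (D.len w)
  have hk1 : 1 ≤ k := Nat.le_findGreatest (hbound 1 hQ1) hQ1
  obtain ⟨v, hv1, hv2⟩ : Q k := Nat.findGreatest_spec (hbound 1 hQ1) hQ1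
  have hmax : ¬ Q (k + 1) := fun hq => by
    have := Nat.le_findGreatest (hbound _ hq) hq
    change k + 1 ≤ k at this
    omega
  refine ⟨k, v, hk1, hv1, hv2, ?_⟩
  obtain ⟨k', hk'⟩ : ∃ k', k = k' + 1 := ⟨k - 1, by omega⟩
  have hlen : ∀ l, cs.length (cs.wordProd (CoxeterSystem.alternatingWord i j l)) ≤ l := fun l => by
    simpa using cs.length_wordProd_le (CoxeterSystem.alternatingWord i j l)
  have first : ∀ x, (x = if Even k' then j else i) → D.len v < D.len (v * D.s x) := by
    intro x hx
    by_contra hlt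
    have e : w = (v * cs.simple x) *
        cs.wordProd (CoxeterSystem.alternatingWord i j k') := by
      rw [hv2, hk', CoxeterSystem.alternatingWord_succ', ← hx, CoxeterSystem.wordProd_cons,
        mul_assoc]
    have h1 := cs.length_mul_le (v * cs.simple x)
      (cs.wordProd (CoxeterSystem.alternatingWord i j k'))
    rw [← e] at h1
    have h2 := hlen k'
    change ¬ cs.length v < cs.length (v * cs.simple x) at hlt
    change cs.length w = cs.length v + k at hv1
    omega
  have second : ∀ x, (x = if Even k then j else i) → D.len v < D.len (v * D.s x) := by
    intro x hx
    by_contra hlt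
    refine hmax ⟨v * D.s x, ?_, ?_⟩
    · have := cs.length_mul_simple v x
      change ¬ cs.length v < cs.length (v * cs.simple x) at hlt
      change cs.length w = cs.length (v * cs.simple x) + (k + 1)
      change cs.length w = cs.length v + k at hv1
      omega
    · rw [CoxeterSystem.alternatingWord_succ', ← hx, CoxeterSystem.wordProd_cons, ← mul_assoc]
      rw [show D.s x = cs.simple x from rfl, cs.simple_mul_simple_cancel_right]
      exact hv2
  rcases Nat.even_or_odd k' with he | ho
  · have ho : ¬ Even k := by rw [hk']; simpa [Nat.even_add_one] using he
    exact ⟨second i (by simp [ho]), first j (by simp [he])⟩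
  · have he : Even k := by rw [hk']; exact ho.add_one
    exact ⟨first i (by simp [Nat.not_even_iff_odd.2 ho]), second j (by simp [he])⟩

lemma QPos.smul {D : CartanDatum I} {x : I → ℤ} (hx : D.QPos x) {a : ℤ} (ha : 0 ≤ a) :
    D.QPos (a • x) := by
  obtain ⟨k, rfl⟩ := hx
  lift a to ℕ using ha
  exact ⟨fun i => a * k i, by simp [Finset.smul_sum, mul_smul]⟩

/-- If `l(w) < l(w s_i)` then `w α_i` is a positive root. -/
lemma act_root_pos (w : D.W) (i : I) (h : D.len w < D.len (w * D.s i)) :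
    D.QPos (D.act w (D.root i)) := by
  induction hn : D.len w using Nat.strong_induction_on generalizing w i with
  | _ n ih =>
  subst hn
  let cs := D.cox.toCoxeterSystem
  by_cases hw : w = 1
  · subst hw
    exact ⟨Pi.single i 1, by simp [Pi.single_apply, ite_smul]⟩
  · obtain ⟨j, hj⟩ := cs.exists_rightDescent_of_ne_one hw
    have hij : i ≠ j := by
      rintro rfl
      exact absurd h (not_lt.2 (le_of_lt hj))
    obtain ⟨k, v, hk, hl, hwv, hi, hj'⟩ := D.exists_dihedral_strip w hj
    -- Otherwise appending s_i to the suffix yields an alternating word with more than m_ij letters.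
    -- It is not reduced, so w s_i would not be longer than w.
    have hkm : k + 1 ≤ D.cox i j := by
      by_contra hcon
      have hne : D.cox j i ≠ 0 := by
        rw [cox_apply_of_ne D hij.symm]; split_ifs <;> norm_num
      have h1 : ¬ cs.IsReduced (CoxeterSystem.alternatingWord j i (k + 1)) :=
        cs.not_isReduced_alternatingWord j i hne (by rw [D.cox.symmetric]; omega)
      have h2 := cs.length_wordProd_le (CoxeterSystem.alternatingWord j i (k + 1))
      simp only [CoxeterSystem.IsReduced, CoxeterSystem.length_alternatingWord] at h1 h2
      have h3 : w * D.s i = v * cs.wordProd (CoxeterSystem.alternatingWord j i (k + 1)) := by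
        rw [hwv, CoxeterSystem.alternatingWord_succ, CoxeterSystem.wordProd_concat, mul_assoc]
        rfl
      have h4 := cs.length_mul_le v (cs.wordProd (CoxeterSystem.alternatingWord j i (k + 1)))
      rw [← h3] at h4
      have h5 : cs.length w < cs.length (w * D.s i) := h
      have h6 : cs.length w = cs.length v + k := hl
      omega
    -- As k ≥ 1, v is shorter than w, and neither s_i nor s_j is a descent of v; the induction thus
    -- applies to both v α_i and v α_j.
    obtain ⟨a, b, e, ha, hb⟩ := D.alternating_root_nonneg hij k hkm
    rw [hwv, map_mul, Module.End.mul_apply, e, map_add, map_smul, map_smul]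
    exact ((ih _ (by omega) v i hi rfl).smul ha).add ((ih _ (by omega) v j hj' rfl).smul hb)

lemma act_root_neg (w : D.W) (i : I) (h : D.len (w * D.s i) < D.len w) :
    D.QPos (-D.act w (D.root i)) := by
  have h1 := D.act_root_pos (w * D.s i) i (by
    rwa [s_mul_s_cancel])
  rw [map_mul, Module.End.mul_apply, act_s] at h1
  have : D.refl i (D.root i) = -D.root i := by
    rw [refl_apply, root_self]; ext k; simp; ring
  rwa [this, map_neg] at h1

end CartanDatum
end

noncomputable section

open scoped Classical

namespace CartanDatum

variable {I : Type*} [Fintype I] (D : CartanDatum I)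

/-! ### The symmetrizers of a multiple bond -/

/-- The symmetrized Cartan form on the root lattice. -/
def form : LinearMap.BilinForm ℤ (I → ℤ) :=
  Matrix.toBilin' (Matrix.of fun k l => (D.d k : ℤ) * D.C k l)

lemma form_pos {x : I → ℤ} (hx : x ≠ 0) : 0 < D.form x x := by
  rw [form, Matrix.toBilin'_apply]
  exact D.posDef x hx

lemma form_single (k l : I) :
    D.form (Pi.single k 1) (Pi.single l 1) = (D.d k : ℤ) * D.C k l := by
  simp [form, Matrix.toBilin'_single]

lemma form_comm (x y : I → ℤ) : D.form x y = D.form y x := by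
  rw [form, Matrix.toBilin'_apply, Matrix.toBilin'_apply, Finset.sum_comm]
  refine Finset.sum_congr rfl fun k _ => Finset.sum_congr rfl fun l _ => ?_
  simp only [Matrix.of_apply, D.symm l k]
  ring

/-- The sum of the simple roots in `X`. -/
def rootSum {I : Type*} (X : Finset I) : I → ℤ := ∑ k ∈ X, Pi.single k 1

lemma form_single_rootSum (k : I) (X : Finset I) :
    D.form (Pi.single k 1) (rootSum X) = ∑ l ∈ X, (D.d k : ℤ) * D.C k l := by
  simp only [rootSum, map_sum, form_single]

lemma rootSum_apply {I : Type*} (X : Finset I) (k : I) : rootSum X k = if k ∈ X then 1 else 0 := by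
  simp [rootSum, Finset.sum_apply, Pi.single_apply]

/-- Off-diagonal Cartan entries are nonpositive, so discarding all elements of X but one can only
increase the form. -/
lemma form_single_rootSum_le {k l : I} {X : Finset I} (hk : k ∉ X) (hl : l ∈ X) :
    D.form (Pi.single k 1) (rootSum X) ≤ (D.d k : ℤ) * D.C k l := by
  rw [form_single_rootSum, ← Finset.add_sum_erase X _ hl]
  have : ∑ x ∈ X.erase l, (D.d k : ℤ) * D.C k x ≤ 0 := by
    refine Finset.sum_nonpos fun x hx => ?_
    refine mul_nonpos_of_nonneg_of_nonpos (by positivity) (D.nonpos k x ?_)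
    rintro rfl
    exact hk (Finset.mem_of_mem_erase hx)
  linarith

/-- A set of simple roots of one length that no other simple root of this length is joined to. -/
structure IsBlock (e : ℕ) (X : Finset I) : Prop where
  d_eq : ∀ k ∈ X, D.d k = e
  form_le : D.form (rootSum X) (rootSum X) ≤ 2 * e
  max : ∀ k ∉ X, D.d k = e → ∀ l ∈ X, D.C k l = 0

/-- A maximal set works: when a neighbour of the same length e is adjoined, its square 2e is
absorbed by twice its product with the sum of X, which is at most -2e. The bound thus survives, and
maximality excludes such neighbours. -/
lemma exists_isBlock (i : I) : ∃ X, i ∈ X ∧ D.IsBlock (D.d i) X := by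
  let F : Set (Finset I) := {X | i ∈ X ∧ (∀ k ∈ X, D.d k = D.d i) ∧
    D.form (rootSum X) (rootSum X) ≤ 2 * D.d i}
  have hF : F.Nonempty := ⟨{i}, by simp, by simp, by
    simp only [rootSum, Finset.sum_singleton, form_single, D.diag_eq_two]; linarith⟩
  obtain ⟨X, hX⟩ := (Set.toFinite F).exists_maximal hF
  obtain ⟨⟨h1, h2, h3⟩, h4⟩ := hX
  refine ⟨X, h1, h2, h3, fun k hk hd l hl => ?_⟩
  by_contra hC
  refine hk (h4 (y := insert k X) ⟨by simp [h1], ?_, ?_⟩ (Finset.subset_insert _ _)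
    (Finset.mem_insert_self k X))
  · intro x hx
    rcases Finset.mem_insert.1 hx with rfl | hx
    · exact hd
    · exact h2 x hx
  · have e : rootSum (insert k X) = Pi.single k 1 + rootSum X := by
      rw [rootSum, Finset.sum_insert hk]; rfl
    rw [e]
    simp only [map_add, LinearMap.add_apply, form_single, D.diag_eq_two,
      D.form_comm (rootSum X) (Pi.single k 1)]
    have h5 := D.form_single_rootSum_le hk hl
    have h6 : D.C k l ≤ -1 := by
      have := D.nonpos k l (by rintro rfl; exact hk hl)
      omega
    have h7 : (0 : ℤ) < D.d i := by exact_mod_cast D.d_pos i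
    rw [hd] at h5 ⊢
    nlinarith

variable {D} in
-- Maximality forces k to have a length different from that of the block, so the bond is multiple.
-- The coefficient is 1 if α_k is longer and 2 if it is shorter. With it, α_k consumes half of the
-- bound 8e for the square of twice the sum of X.
lemma IsBlock.exists_coeff {e : ℕ} {X : Finset I} (hX : D.IsBlock e X) {k l : I} (hk : k ∉ X)
    (hl : l ∈ X) (hC : D.C k l ≠ 0) :
    ∃ a : ℤ, 0 < a ∧ 2 * a ^ 2 * D.d k + 4 * a * D.form (Pi.single k 1) (rootSum X) ≤ -4 * e := by
  have h1 := D.form_single_rootSum_le hk hl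
  have hdl := hX.d_eq l hl
  have hne : D.d k ≠ e := fun h => hC (hX.max k hk h l hl)
  have hs := D.symm k l
  rw [hdl] at hs
  have hkl : k ≠ l := by rintro rfl; exact hk hl
  have hp : (0 : ℤ) < e := by rw [← hdl]; exact_mod_cast D.d_pos l
  rcases D.cartan_cases k l hkl with c | c | c | c | c | c <;> obtain ⟨c1, c2⟩ := c <;>
    rw [c1] at h1 hs <;> rw [c2] at hs
  · exact absurd c1 hC
  · exact absurd (by exact_mod_cast (by linarith : (D.d k : ℤ) = e)) hne
  · exact ⟨1, by norm_num, by nlinarith⟩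
  · exact ⟨2, by norm_num, by nlinarith⟩
  · exact ⟨1, by norm_num, by nlinarith⟩
  · exact ⟨2, by norm_num, by nlinarith⟩

variable {D} in
/-- A block is joined to at most one simple root outside. -/
lemma IsBlock.neighbor_unique {e : ℕ} {X : Finset I} (hX : D.IsBlock e X) {k k' l l' : I}
    (hk : k ∉ X) (hk' : k' ∉ X) (hl : l ∈ X) (hl' : l' ∈ X) (hC : D.C k l ≠ 0)
    (hC' : D.C k' l' ≠ 0) : k = k' := by
  by_contra hne
  obtain ⟨a, ha, h1⟩ := hX.exists_coeff hk hl hC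
  obtain ⟨a', ha', h2⟩ := hX.exists_coeff hk' hl' hC'
  -- Two distinct attached roots would give x a square of at most 8e - 4e - 4e = 0, against positive
  -- definiteness.
  let x : I → ℤ := (2 : ℤ) • rootSum X + (a • Pi.single k 1 + a' • Pi.single k' 1)
  have hx : x ≠ 0 := by
    intro h0
    have := congrFun h0 l
    have e1 : l ≠ k := by rintro rfl; exact hk hl
    have e2 : l ≠ k' := by rintro rfl; exact hk' hl
    simp [x, rootSum_apply, hl, e1, e2] at this
  have h3 := D.form_pos hx
  simp only [x, map_add, map_smul, LinearMap.add_apply, LinearMap.smul_apply, smul_eq_mul,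
    D.form_comm (rootSum X) (Pi.single _ 1), form_single, D.diag_eq_two] at h3
  have h4 := hX.form_le
  have h5 : (D.d k : ℤ) * D.C k k' ≤ 0 :=
    mul_nonpos_of_nonneg_of_nonpos (by positivity) (D.nonpos k k' hne)
  have h6 : (D.d k' : ℤ) * D.C k' k ≤ 0 :=
    mul_nonpos_of_nonneg_of_nonpos (by positivity) (D.nonpos k' k (Ne.symm hne))
  have h7 : a * a' * ((D.d k : ℤ) * D.C k k') ≤ 0 :=
    mul_nonpos_of_nonneg_of_nonpos (by positivity) h5
  have h8 : a * a' * ((D.d k' : ℤ) * D.C k' k) ≤ 0 :=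
    mul_nonpos_of_nonneg_of_nonpos (by positivity) h6
  nlinarith

lemma C_eq_zero_symm {k l : I} (h : D.C k l = 0) : D.C l k = 0 := by
  have h1 := D.symm k l
  rw [h, mul_zero] at h1
  have : (D.d l : ℤ) ≠ 0 := by exact_mod_cast (D.d_pos l).ne'
  exact (mul_eq_zero.1 h1.symm).resolve_left this

/-- The short root of a multiple bond has symmetrizer `1`. -/
lemma d_eq_one {i j : I} (hij : i ≠ j) (h : D.C i j ≤ -2) : D.d i = 1 := by
  have hs := D.symm i j
  have hmul : D.C j i = -1 ∧ (D.d j : ℤ) = -D.C i j * D.d i := by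
    rcases D.cartan_cases i j hij with c | c | c | c | c | c <;> obtain ⟨c1, c2⟩ := c <;>
      rw [c1, c2] at hs <;> first | omega | exact ⟨c2, by rw [c1]; linarith⟩
  obtain ⟨hji, hd⟩ := hmul
  have hdi : (0 : ℤ) < D.d i := by exact_mod_cast D.d_pos i
  have hlt : D.d i ≠ D.d j := by
    intro he
    rw [← he] at hd
    nlinarith
  obtain ⟨X, hiX, hX⟩ := D.exists_isBlock i
  obtain ⟨Z, hjZ, hZ⟩ := D.exists_isBlock j
  have hjX : j ∉ X := fun h' => hlt (hX.d_eq j h').symm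
  have hiZ : i ∉ Z := fun h' => hlt (hZ.d_eq i h')
  -- The bond between i and j uses up the only outside neighbour of either block, so the two blocks
  -- together are closed under adjacency and exhaust the diagram.
  have huniv : ((X : Set I) ∪ Z) = Set.univ := by
    refine D.indecomposable _ ⟨i, Or.inl hiX⟩ ?_
    rintro k hk l hl
    have hlX : l ∉ X := fun h' => hl (Or.inl h')
    have hlZ : l ∉ Z := fun h' => hl (Or.inr h')
    refine D.C_eq_zero_symm ?_
    by_contra hC
    rcases hk with hk | hk
    · exact hlZ (hX.neighbor_unique hjX hlX hiX hk (by omega) hC ▸ hjZ)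
    · exact hlX (hZ.neighbor_unique hiZ hlZ hjZ hk (by omega) hC ▸ hiX)
  -- Only the values d_i and d_j = -C_ij d_i occur as symmetrizers, so d_i divides their greatest
  -- common divisor, which is 1.
  have hdvd : ∀ k, D.d i ∣ D.d k := by
    intro k
    have hk : k ∈ ((X : Set I) ∪ Z) := by rw [huniv]; trivial
    rcases hk with hk | hk
    · rw [hX.d_eq k hk]
    · rw [hZ.d_eq k hk]
      have : (D.d i : ℤ) ∣ D.d j := ⟨-D.C i j, by rw [hd]; ring⟩
      exact_mod_cast this
  have := Finset.dvd_gcd fun k (_ : k ∈ Finset.univ) => hdvd k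
  rw [D.d_coprime] at this
  exact Nat.dvd_one.1 this

end CartanDatum
end

noncomputable section

open scoped Classical

namespace CartanDatum

/-! ### Degrees, weights and substitutions of monomials -/

/-- The degree of a monomial in the variables `Ψ_{i,a}`, for each `i`. -/
def deg (I : Type*) : Mono I →+ (I → ℤ) :=
  (Finsupp.liftAddHom fun p : I × ℂˣ =>
    (zmultiplesHom (I → ℤ)) (Pi.single p.1 1)).comp (AddMonoidHom.fst _ _)

/-- The substitution `Ψ_{i,a} ↦ Ψ_{i,ab}`. -/
def shiftM {I : Type*} (b : ℂˣ) : Mono I →+ Mono I :=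
  (Finsupp.mapDomain.addMonoidHom fun p : I × ℂˣ => (p.1, p.2 * b)).prodMap (AddMonoidHom.id _)

section General

variable {I : Type*}

@[simp] lemma deg_psi (i : I) (a : ℂˣ) : deg I (psi i a) = Pi.single i 1 := by
  simp [deg, psi]

@[simp] lemma deg_wtMono (x : I → ℤ) : deg I (wtMono x) = 0 := by
  simp [deg, wtMono]

@[simp] lemma psi_snd (i : I) (a : ℂˣ) : (psi i a).2 = 0 := rfl

@[simp] lemma wtMono_snd (x : I → ℤ) : (wtMono x).2 = x := rfl

@[simp] lemma wtMono_fst (x : I → ℤ) : (wtMono x).1 = 0 := rfl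

@[simp] lemma shiftM_psi (b : ℂˣ) (i : I) (a : ℂˣ) : shiftM b (psi i a) = psi i (a * b) := by
  simp [shiftM, psi, Finsupp.mapDomain_single]

@[simp] lemma shiftM_wtMono (b : ℂˣ) (x : I → ℤ) : shiftM b (wtMono x) = wtMono x := by
  simp [shiftM, wtMono]

@[simp] lemma shiftM_snd (b : ℂˣ) (m : Mono I) : (shiftM b m).2 = m.2 := rfl

lemma shiftM_fst_apply (b : ℂˣ) (m : Mono I) (i : I) (a : ℂˣ) :
    (shiftM b m).1 (i, a * b) = m.1 (i, a) := by
  have hinj : Function.Injective fun p : I × ℂˣ => (p.1, p.2 * b) := by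
    rintro ⟨i, a⟩ ⟨j, c⟩ h
    simpa using h
  exact Finsupp.mapDomain_apply hinj m.1 (i, a)

lemma mono_hom_ext {M : Type*} [AddCommGroup M] {f g : Mono I →+ M}
    (h1 : ∀ i a, f (psi i a) = g (psi i a)) (h2 : ∀ x, f (wtMono x) = g (wtMono x)) : f = g := by
  have e1 : f.comp (AddMonoidHom.inl _ _) = g.comp (AddMonoidHom.inl _ _) := by
    refine Finsupp.addHom_ext' fun p => AddMonoidHom.ext_int ?_
    exact h1 p.1 p.2
  have e2 : f.comp (AddMonoidHom.inr _ _) = g.comp (AddMonoidHom.inr _ _) :=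
    AddMonoidHom.ext h2
  ext m
  have h3 : m = AddMonoidHom.inl _ _ m.1 + AddMonoidHom.inr _ _ m.2 := by simp
  rw [h3, map_add, map_add]
  exact congrArg₂ (· + ·) (DFunLike.congr_fun e1 m.1) (DFunLike.congr_fun e2 m.2)

lemma shiftM_shiftM (b c : ℂˣ) (m : Mono I) : shiftM c (shiftM b m) = shiftM (b * c) m := by
  have : (shiftM c).comp (shiftM b) = (shiftM (b * c) : Mono I →+ Mono I) :=
    mono_hom_ext (fun i a => by simp [mul_assoc]) (fun x => by simp)
  exact DFunLike.congr_fun this m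

lemma shiftM_one (m : Mono I) : shiftM 1 m = m := by
  have : shiftM 1 = AddMonoidHom.id (Mono I) :=
    mono_hom_ext (fun i a => by simp) (fun x => by simp)
  exact DFunLike.congr_fun this m

@[simp] lemma deg_shiftM (b : ℂˣ) (m : Mono I) : deg I (shiftM b m) = deg I m := by
  have : (deg I).comp (shiftM b) = deg I :=
    mono_hom_ext (fun i a => by simp) (fun x => by simp)
  exact DFunLike.congr_fun this m

/-- A finitely supported function that is periodic of infinite order vanishes. -/
lemma eq_zero_of_periodic (u : (I × ℂˣ) →₀ ℤ) (i : I) (c : ℂˣ) (hc : ∀ n : ℕ, 0 < n → c ^ n ≠ 1)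
    (h : ∀ a, u (i, a * c) = u (i, a)) (a : ℂˣ) : u (i, a) = 0 := by
  by_contra hne
  have h1 : ∀ n : ℕ, u (i, a * c ^ n) = u (i, a) := by
    intro n
    induction n with
    | zero => simp
    | succ n ih => rw [pow_succ, ← mul_assoc, h, ih]
  refine Set.infinite_of_injective_forall_mem (f := fun n : ℕ => (i, a * c ^ n)) ?_
    (s := u.support) (fun n => by simp [h1, hne]) (Finset.finite_toSet _)
  intro m n hmn
  simp only [Prod.mk.injEq, mul_right_inj, true_and] at hmn
  rcases lt_trichotomy m n with hl | hl | hl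
  · refine absurd ?_ (hc (n - m) (by omega))
    have : c ^ n = c ^ m * c ^ (n - m) := by rw [← pow_add]; congr 1; omega
    rw [this] at hmn
    simpa using hmn.symm
  · exact hl
  · refine absurd ?_ (hc (m - n) (by omega))
    have : c ^ m = c ^ n * c ^ (m - n) := by rw [← pow_add]; congr 1; omega
    rw [this] at hmn
    simpa using hmn

end General

variable {I : Type*} [Fintype I] (D : CartanDatum I) (q : ℂˣ)

@[simp] lemma Y_snd (i : I) (a : ℂˣ) : (D.Y q i a).2 = Pi.single i 1 := by
  simp [Y]

@[simp] lemma deg_Y (i : I) (a : ℂˣ) : deg I (D.Y q i a) = 0 := by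
  simp [Y]

@[simp] lemma shiftM_Y (b : ℂˣ) (i : I) (a : ℂˣ) : shiftM b (D.Y q i a) = D.Y q i (a * b) := by
  simp [Y, mul_right_comm]

@[simp] lemma yMono_single (i : I) (a : ℂˣ) (n : ℤ) :
    D.yMono q (Finsupp.single (i, a) n) = n • D.Y q i a := by
  simp [yMono]

lemma Y_mem (i : I) (a : ℂˣ) : D.Y q i a ∈ D.monoY q :=
  ⟨Finsupp.single (i, a) 1, by simp⟩

/-- The contribution of `j` to the denominator of `A_{i,a}`. -/
def bondY (i j : I) (a : ℂˣ) : Mono I :=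
  if D.C j i = -1 then D.Y q j a
  else if D.C j i = -2 then D.Y q j (a * q⁻¹) + D.Y q j (a * q)
  else if D.C j i = -3 then D.Y q j (a * q⁻¹ ^ 2) + D.Y q j a + D.Y q j (a * q ^ 2)
  else 0

/-- The contribution of `j` to `Ψ̃_{i,a}`. -/
def bondPsi (i j : I) (a : ℂˣ) : Mono I :=
  if D.C i j = -1 then psi j (a * D.qi q i)
  else if D.C i j = -2 then psi j a + psi j (a * q ^ 2)
  else if D.C i j = -3 then psi j (a * q⁻¹) + psi j (a * q) + psi j (a * q ^ 3)
  else 0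

lemma A_eq (i : I) (a : ℂˣ) : D.A q i a =
    D.Y q i (a * (D.qi q i)⁻¹) + D.Y q i (a * D.qi q i) - ∑ j, D.bondY q i j a := by
  rw [A]
  congr 1
  simp only [Finset.sum_filter, ← Finset.sum_add_distrib]
  refine Finset.sum_congr rfl fun j _ => ?_
  rw [bondY]
  split_ifs <;> first | omega | simp

lemma psiTilde_eq (i : I) (a : ℂˣ) : D.psiTilde q i a = -psi i a + ∑ j, D.bondPsi q i j a := by
  rw [psiTilde, add_assoc, add_assoc]
  congr 1
  simp only [Finset.sum_filter, ← Finset.sum_add_distrib]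
  refine Finset.sum_congr rfl fun j _ => ?_
  rw [bondPsi]
  split_ifs <;> first | omega | simp

lemma bondY_self (i : I) (a : ℂˣ) : D.bondY q i i a = 0 := by
  simp [bondY, D.diag_eq_two]

lemma bondPsi_self (i : I) (a : ℂˣ) : D.bondPsi q i i a = 0 := by
  simp [bondPsi, D.diag_eq_two]

lemma bondY_mem (i j : I) (a : ℂˣ) : D.bondY q i j a ∈ D.monoY q := by
  rw [bondY]
  split_ifs
  · exact D.Y_mem q _ _
  · exact add_mem (D.Y_mem q _ _) (D.Y_mem q _ _)
  · exact add_mem (add_mem (D.Y_mem q _ _) (D.Y_mem q _ _)) (D.Y_mem q _ _)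
  · exact zero_mem _

lemma A_mem (i : I) (a : ℂˣ) : D.A q i a ∈ D.monoY q := by
  rw [A_eq]
  exact sub_mem (add_mem (D.Y_mem q _ _) (D.Y_mem q _ _))
    (sum_mem fun j _ => D.bondY_mem q i j a)

lemma C_cases (i j : I) : D.C i j = 2 ∧ i = j ∨ i ≠ j ∧
    (D.C i j = 0 ∨ D.C i j = -1 ∨ D.C i j = -2 ∨ D.C i j = -3) := by
  by_cases h : i = j
  · subst h; exact Or.inl ⟨D.diag_eq_two i, rfl⟩
  · refine Or.inr ⟨h, ?_⟩
    rcases D.cartan_cases i j h with c | c | c | c | c | c <;> omega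

lemma bondY_snd {i j : I} (h : j ≠ i) (a : ℂˣ) :
    (D.bondY q i j a).2 = -D.C j i • (Pi.single j 1 : I → ℤ) := by
  rw [bondY]
  rcases D.C_cases j i with c | ⟨_, c | c | c | c⟩
  · exact absurd c.2 h
  all_goals
    simp only [c]
    norm_num
  · ring
  · ring

@[simp] lemma A_snd (i : I) (a : ℂˣ) : (D.A q i a).2 = D.root i := by
  rw [A_eq, Prod.snd_sub, Prod.snd_add, Prod.snd_sum, Y_snd, Y_snd]
  ext k
  rw [Pi.sub_apply, Finset.sum_apply, Finset.sum_eq_single k]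
  · by_cases h : k = i
    · subst h; simp [bondY_self, root, D.diag_eq_two]
    · rw [bondY_snd D q h]; simp [h, root]
  · intro j _ hj
    by_cases h : j = i
    · subst h; simp [bondY_self]
    · rw [bondY_snd D q h]; simp [hj.symm]
  · simp

@[simp] lemma shiftM_bondY (b : ℂˣ) (i j : I) (a : ℂˣ) :
    shiftM b (D.bondY q i j a) = D.bondY q i j (a * b) := by
  rw [bondY, bondY]
  split_ifs <;> simp [mul_right_comm]

@[simp] lemma shiftM_A (b : ℂˣ) (i : I) (a : ℂˣ) : shiftM b (D.A q i a) = D.A q i (a * b) := by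
  simp [A_eq, mul_right_comm]

@[simp] lemma shiftM_bondPsi (b : ℂˣ) (i j : I) (a : ℂˣ) :
    shiftM b (D.bondPsi q i j a) = D.bondPsi q i j (a * b) := by
  rw [bondPsi, bondPsi]
  split_ifs <;> simp [mul_right_comm]

@[simp] lemma shiftM_psiTilde (b : ℂˣ) (i : I) (a : ℂˣ) :
    shiftM b (D.psiTilde q i a) = D.psiTilde q i (a * b) := by
  simp [psiTilde_eq]

lemma deg_eq_zero_of_mem {m : Mono I} (hm : m ∈ D.monoY q) : deg I m = 0 := by
  obtain ⟨u, rfl⟩ := hm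
  have : (deg I).comp (D.yMono q) = 0 := by
    refine Finsupp.addHom_ext' fun p => AddMonoidHom.ext_int ?_
    simp [yMono]
  exact DFunLike.congr_fun this u

lemma monoY_le {S : AddSubgroup (Mono I)} (h : ∀ i a, D.Y q i a ∈ S) : D.monoY q ≤ S := by
  rintro _ ⟨u, rfl⟩
  induction u using Finsupp.induction_linear with
  | zero => simp
  | add u v hu hv => rw [map_add]; exact S.add_mem hu hv
  | single p n => rw [show p = (p.1, p.2) from rfl, yMono_single]; exact S.zsmul_mem (h _ _) n

section RootOfUnity

variable (hq : ∀ n : ℕ, 0 < n → q ^ n ≠ 1)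
include hq

lemma qi_pow_ne_one (i : I) (k : ℕ) (hk : 0 < k) (n : ℕ) (hn : 0 < n) :
    ((D.qi q i) ^ k) ^ n ≠ 1 := by
  rw [qi, ← pow_mul, ← pow_mul]
  have := D.d_pos i
  exact hq _ (by positivity)

/-- A monomial in the `Y_{i,a}` is determined by its `Ψ`-part. -/
lemma yMono_fst_eq_zero {u : (I × ℂˣ) →₀ ℤ} (h : (D.yMono q u).1 = 0) : u = 0 := by
  have key : (AddMonoidHom.fst _ _).comp (D.yMono q) =
      Finsupp.mapDomain.addMonoidHom (fun p : I × ℂˣ => (p.1, p.2 * (D.qi q p.1)⁻¹)) -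
      Finsupp.mapDomain.addMonoidHom (fun p : I × ℂˣ => (p.1, p.2 * D.qi q p.1)) := by
    refine Finsupp.addHom_ext' fun p => AddMonoidHom.ext_int ?_
    simp [yMono, Y, psi, Finsupp.mapDomain_single]
  have h1 := DFunLike.congr_fun key u
  simp only [AddMonoidHom.coe_comp, Function.comp_apply, AddMonoidHom.coe_fst, h,
    AddMonoidHom.sub_apply, Finsupp.mapDomain.addMonoidHom, AddMonoidHom.coe_mk,
    ZeroHom.coe_mk] at h1
  have h2 := sub_eq_zero.1 h1.symm
  have i1 : Function.Injective fun p : I × ℂˣ => (p.1, p.2 * (D.qi q p.1)⁻¹) := by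
    rintro ⟨i, a⟩ ⟨j, c⟩ h
    simp only [Prod.mk.injEq] at h
    obtain ⟨rfl, h⟩ := h
    simpa using h
  have i2 : Function.Injective fun p : I × ℂˣ => (p.1, p.2 * (D.qi q p.1)) := by
    rintro ⟨i, a⟩ ⟨j, c⟩ h
    simp only [Prod.mk.injEq] at h
    obtain ⟨rfl, h⟩ := h
    simpa using h
  ext ⟨j, a⟩
  -- The Ψ-part is the difference of two translates of u, by q_j⁻¹ and by q_j. If it vanishes, u is
  -- invariant under translation by q_j², which has infinite order.
  refine eq_zero_of_periodic u j (D.qi q j ^ 2) (D.qi_pow_ne_one q hq j 2 two_pos) ?_ a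
  intro a
  have e1 := Finsupp.mapDomain_apply i1 u (j, a * D.qi q j ^ 2)
  have e2 := Finsupp.mapDomain_apply i2 u (j, a)
  have e3 : a * D.qi q j ^ 2 * (D.qi q j)⁻¹ = a * D.qi q j := by
    rw [sq, ← mul_assoc, mul_inv_cancel_right]
  simp only [e3] at e1
  rw [← e1, ← e2, h2]

lemma yMono_injective : Function.Injective (D.yMono q) :=
  (injective_iff_map_eq_zero _).2 fun u hu => D.yMono_fst_eq_zero q hq (by rw [hu]; rfl)

lemma eq_zero_of_mem_of_fst {m : Mono I} (hm : m ∈ D.monoY q) (h : m.1 = 0) : m = 0 := by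
  obtain ⟨u, rfl⟩ := hm
  rw [D.yMono_fst_eq_zero q hq h, map_zero]

end RootOfUnity

/-! ### The monomial part of the operators -/

/-- The substitution `Ψ_{i,a} ↦ Ψ̃_{i,a q_i⁻²}`, `[x] ↦ [s_i x]`, fixing `Ψ_{j,a}` for `j ≠ i`. -/
def sigmaM (i : I) : Mono I →+ Mono I :=
  AddMonoidHom.coprod
    (Finsupp.liftAddHom fun p : I × ℂˣ => (zmultiplesHom (Mono I))
      (if p.1 = i then D.psiTilde q i (p.2 * (D.qi q i)⁻¹ ^ 2) else psi p.1 p.2))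
    ((AddMonoidHom.inr _ _).comp (D.refl i).toAddMonoidHom)

@[simp] lemma sigmaM_psi_self (i : I) (a : ℂˣ) :
    D.sigmaM q i (psi i a) = D.psiTilde q i (a * (D.qi q i)⁻¹ ^ 2) := by
  simp [sigmaM, psi]

lemma sigmaM_psi_ne {i j : I} (h : j ≠ i) (a : ℂˣ) : D.sigmaM q i (psi j a) = psi j a := by
  simp [sigmaM, psi, h]

@[simp] lemma sigmaM_wtMono (i : I) (x : I → ℤ) :
    D.sigmaM q i (wtMono x) = wtMono (D.refl i x) := by
  simp [sigmaM, wtMono]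

lemma refl_single_ne {i j : I} (h : j ≠ i) : D.refl i (Pi.single j 1) = Pi.single j 1 := by
  rw [refl_apply]; simp [h.symm]

lemma refl_single_self (i : I) : D.refl i (Pi.single i 1) = Pi.single i 1 - D.root i := by
  rw [refl_apply]; simp

lemma sigmaM_Y_ne {i j : I} (h : j ≠ i) (a : ℂˣ) : D.sigmaM q i (D.Y q j a) = D.Y q j a := by
  simp [Y, sigmaM_psi_ne D q h, refl_single_ne D h]

/-- The bond contributions to `Ψ̃` and to `A` are compatible. -/
lemma bondPsi_sub {i j : I} (h : j ≠ i) (a : ℂˣ) :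
    D.bondPsi q i j (a * (D.qi q i)⁻¹ ^ 2) - D.bondPsi q i j a +
      wtMono (-D.C j i • Pi.single j 1) = D.bondY q i j a := by
  have hs := D.symm i j
  have r : ∀ x (n : ℤ), x = a * q ^ n → psi j x = psi j (a * q ^ n) := fun x n hx => by rw [hx]
  have hw : ∀ n : ℤ, wtMono (n • Pi.single j 1 : I → ℤ) = n • wtMono (Pi.single j 1) :=
    fun n => by simp [wtMono]
  rcases D.cartan_cases i j h.symm with c | c | c | c | c | c <;> obtain ⟨c1, c2⟩ := c <;>
    simp only [bondPsi, bondY, c1, c2, hw] <;> norm_num [-zsmul_eq_mul]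
  · have hd : D.d i = D.d j := by rw [c1, c2] at hs; omega
    have hqq : D.qi q i = D.qi q j := by rw [qi, qi, hd]
    rw [Y, hqq, show a * (D.qi q j ^ 2)⁻¹ * D.qi q j = a * (D.qi q j)⁻¹ by group]
    abel
  -- The factors for multiple bonds in A and in Ψ̃ are written with powers of q, not of q_i. They
  -- match because the short root of a multiple bond has symmetrizer 1, which turns both sides into
  -- explicit powers of q.
  · have hj := D.d_eq_one h (by omega)
    have hi : D.d i = 2 := by rw [c1, c2, hj] at hs; omega
    simp only [Y, qi, hj, hi]
    rw [r (a * ((q ^ 2) ^ 2)⁻¹ * q ^ 2) (-2) (by group), r (a * q ^ 2) 2 (by group),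
      r (a * q⁻¹ * (q ^ 1)⁻¹) (-2) (by group), r (a * q⁻¹ * q ^ 1) 0 (by group),
      r (a * q * (q ^ 1)⁻¹) 0 (by group), r (a * q * q ^ 1) 2 (by group)]
    abel
  · have hi := D.d_eq_one h.symm (by omega)
    have hj : D.d j = 2 := by rw [c1, c2, hi] at hs; omega
    simp only [Y, qi, hj, hi]
    rw [r (a * ((q ^ 1) ^ 2)⁻¹) (-2) (by group), r (a * ((q ^ 1) ^ 2)⁻¹ * q ^ 2) 0 (by group),
      r a 0 (by group), r (a * q ^ 2) 2 (by group), r (a * (q ^ 2)⁻¹) (-2) (by group)]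
    abel
  · have hj := D.d_eq_one h (by omega)
    have hi : D.d i = 3 := by rw [c1, c2, hj] at hs; omega
    simp only [Y, qi, hj, hi]
    rw [r (a * ((q ^ 3) ^ 2)⁻¹ * q ^ 3) (-3) (by group), r (a * q ^ 3) 3 (by group),
      r (a * (q ^ 2)⁻¹ * (q ^ 1)⁻¹) (-3) (by group), r (a * (q ^ 2)⁻¹ * q ^ 1) (-1) (by group),
      r (a * (q ^ 1)⁻¹) (-1) (by group), r (a * q ^ 1) 1 (by group),
      r (a * q ^ 2 * (q ^ 1)⁻¹) 1 (by group), r (a * q ^ 2 * q ^ 1) 3 (by group)]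
    abel
  · have hi := D.d_eq_one h.symm (by omega)
    have hj : D.d j = 3 := by rw [c1, c2, hi] at hs; omega
    simp only [Y, qi, hj, hi]
    rw [r (a * ((q ^ 1) ^ 2)⁻¹ * q⁻¹) (-3) (by group), r (a * ((q ^ 1) ^ 2)⁻¹ * q) (-1) (by group),
      r (a * ((q ^ 1) ^ 2)⁻¹ * q ^ 3) 1 (by group), r (a * q⁻¹) (-1) (by group),
      r (a * q) 1 (by group), r (a * q ^ 3) 3 (by group), r (a * (q ^ 3)⁻¹) (-3) (by group)]
    abel

/-- This is why the operator on Π' restricts to the one on Π: it computes the monomial part of the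
image of Y_{i,aq_i}. The identity splits into one identity for each bond (`bondPsi_sub`) and the
expansion of α_i in fundamental weights. -/
lemma psiTilde_sub (i : I) (a : ℂˣ) :
    wtMono (Pi.single i 1 - D.root i) + D.psiTilde q i (a * (D.qi q i)⁻¹ ^ 2) -
      D.psiTilde q i a = D.Y q i (a * D.qi q i) - D.A q i a := by
  have hw : wtMono (Pi.single i 1 - D.root i) =
      -wtMono (Pi.single i 1) + ∑ j, if j = i then 0 else
        wtMono (-D.C j i • (Pi.single j 1 : I → ℤ)) := by
    refine Prod.ext ?_ ?_
    · simp only [wtMono_fst, Prod.fst_add, Prod.fst_neg, Prod.fst_sum, neg_zero, zero_add]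
      refine (Finset.sum_eq_zero fun j _ => ?_).symm
      split_ifs <;> rfl
    · simp only [wtMono_snd, Prod.snd_add, Prod.snd_neg, Prod.snd_sum]
      ext k
      simp only [Pi.sub_apply, Pi.add_apply, Pi.neg_apply, Finset.sum_apply]
      rw [Finset.sum_eq_single k]
      · by_cases hk : k = i
        · subst hk; simp [root, D.diag_eq_two]
        · simp [hk, root]
      · intro j _ hj
        split_ifs
        · rfl
        · simp [hj.symm]
      · simp
  have hsum : ∑ j, D.bondY q i j a = ∑ j, D.bondPsi q i j (a * (D.qi q i)⁻¹ ^ 2)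
      - ∑ j, D.bondPsi q i j a + ∑ j, if j = i then 0 else
        wtMono (-D.C j i • (Pi.single j 1 : I → ℤ)) := by
    rw [← Finset.sum_sub_distrib, ← Finset.sum_add_distrib]
    refine Finset.sum_congr rfl fun j _ => ?_
    by_cases h : j = i
    · subst h; simp [bondY_self, bondPsi_self]
    · rw [if_neg h, bondPsi_sub D q h]
  have hY : D.Y q i (a * (D.qi q i)⁻¹) =
      wtMono (Pi.single i 1) + psi i (a * (D.qi q i)⁻¹ ^ 2) - psi i a := by
    rw [Y, inv_mul_cancel_right, show a * (D.qi q i)⁻¹ * (D.qi q i)⁻¹ = a * (D.qi q i)⁻¹ ^ 2 by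
      group]
  rw [A_eq, hsum, hw, psiTilde_eq, psiTilde_eq, hY]
  abel

lemma sigmaM_Y_self (i : I) (a : ℂˣ) :
    D.sigmaM q i (D.Y q i a) = D.Y q i a - D.A q i (a * (D.qi q i)⁻¹) := by
  have h := D.psiTilde_sub q i (a * (D.qi q i)⁻¹)
  rw [inv_mul_cancel_right] at h
  rw [← h, Y, map_sub, map_add, sigmaM_wtMono, refl_single_self, sigmaM_psi_self,
    sigmaM_psi_self]
  congr 2
  group

lemma sigmaM_mem {i : I} {m : Mono I} (hm : m ∈ D.monoY q) : D.sigmaM q i m ∈ D.monoY q := by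
  refine D.monoY_le q (S := (D.monoY q).comap (D.sigmaM q i)) (fun j a => ?_) hm
  rw [AddSubgroup.mem_comap]
  by_cases h : j = i
  · subst h
    rw [sigmaM_Y_self]
    exact sub_mem (D.Y_mem q _ _) (D.A_mem q _ _)
  · rw [sigmaM_Y_ne D q h]
    exact D.Y_mem q _ _

/-- The reflection on degrees dual to `s_i`. -/
def degRefl (i : I) : (I → ℤ) →+ (I → ℤ) where
  toFun l j := l j - l i * D.C i j
  map_zero' := by ext; simp
  map_add' l l' := by ext; simp; ring

lemma degRefl_apply (i : I) (l : I → ℤ) (j : I) : D.degRefl i l j = l j - l i * D.C i j := rfl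

lemma deg_bondPsi {i j : I} (h : i ≠ j) (a : ℂˣ) :
    deg I (D.bondPsi q i j a) = -D.C i j • (Pi.single j 1 : I → ℤ) := by
  rw [bondPsi]
  rcases D.C_cases i j with c | ⟨_, c | c | c | c⟩
  · exact absurd c.2 h
  all_goals
    simp only [c]
    norm_num
  · ring
  · ring

/-- Degrees forget the spectral parameters and transform by the dual reflection, so the bounds on
images can be expressed through degrees alone. -/
lemma deg_sigmaM (i : I) (m : Mono I) : deg I (D.sigmaM q i m) = D.degRefl i (deg I m) := by
  have : (deg I).comp (D.sigmaM q i) = (D.degRefl i).comp (deg I) := by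
    refine mono_hom_ext (fun j a => ?_) (fun x => by simp)
    by_cases h : j = i
    · subst h
      simp only [AddMonoidHom.comp_apply, sigmaM_psi_self, deg_psi, psiTilde_eq, map_add, map_neg,
        map_sum]
      ext k
      rw [degRefl_apply, Pi.add_apply, Finset.sum_apply, Finset.sum_eq_single k]
      · by_cases hk : k = j
        · subst hk; simp [bondPsi_self, D.diag_eq_two]
        · rw [deg_bondPsi D q (Ne.symm hk)]; simp [hk]
      · intro l _ hl
        by_cases hk : l = j
        · subst hk; simp [bondPsi_self]
        · rw [deg_bondPsi D q (Ne.symm hk)]; simp [hl.symm]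
      · simp
    · simp only [AddMonoidHom.comp_apply, sigmaM_psi_ne D q h, deg_psi]
      ext k
      simp [degRefl_apply, Ne.symm h]
  exact DFunLike.congr_fun this m

lemma sigmaM_snd (i : I) (m : Mono I) : (D.sigmaM q i m).2 = D.refl i m.2 := by
  have : (AddMonoidHom.snd _ _).comp (D.sigmaM q i) =
      (D.refl i).toAddMonoidHom.comp (AddMonoidHom.snd _ _) := by
    refine mono_hom_ext (fun j a => ?_) (fun x => by simp)
    by_cases h : j = i
    · subst h
      have hb : ∀ l b, (D.bondPsi q j l b).2 = 0 := fun l b => by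
        rw [bondPsi]; split_ifs <;> simp
      simp [psiTilde_eq, hb, Prod.snd_sum]
    · simp [sigmaM_psi_ne D q h]
  exact DFunLike.congr_fun this m

end CartanDatum
end

noncomputable section

open scoped Classical

namespace CartanDatum

variable {I : Type*} [Fintype I] (D : CartanDatum I)

/-! ### An ambient ring for the operators -/

/-- The series of cone-finite support whose monomials have finitely many images under `f`. -/
def finIm {Q : Type*} [AddCommGroup Q] (f : Mono I →+ Q) (w : D.W) : Subring (D.Series w) where
  carrier := {x | D.ConeFinite w x.support ∧ ((fun m => f (D.toMono w m)) '' x.support).Finite}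
  zero_mem' := by simpa using ConeFinite.of_finite D w Set.finite_empty
  one_mem' :=
    have h := (D.poly w ⊤).one_mem
    ⟨ConeFinite.of_finite D w h.1, h.1.image _⟩
  add_mem' := by
    rintro x y ⟨h1, h2⟩ ⟨h3, h4⟩
    have hs : (x + y).support ⊆ x.support ∪ y.support := HahnSeries.support_add_subset _ _
    refine ⟨(h1.union h3).mono hs, (h2.union h4).subset ?_⟩
    rw [← Set.image_union]
    exact Set.image_mono hs
  neg_mem' := by
    rintro x ⟨h1, h2⟩
    have : (-x).support = x.support := HahnSeries.support_neg
    simp only [Set.mem_ofPred_eq, this]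
    exact ⟨h1, h2⟩
  mul_mem' := by
    rintro x y ⟨h1, h2⟩ ⟨h3, h4⟩
    have hs := HahnSeries.support_mul_subset (x := x) (y := y)
    refine ⟨(h1.add h3).mono hs, (h2.add h4).subset ?_⟩
    rintro _ ⟨m, hm, rfl⟩
    obtain ⟨a, ha, b, hb, rfl⟩ := hs hm
    exact ⟨_, ⟨a, ha, rfl⟩, _, ⟨b, hb, rfl⟩, by simp⟩

/-- The series of cone-finite support that involve finitely many degrees only. -/
abbrev big (w : D.W) : Subring (D.Series w) := D.finIm (deg I) w

/-- The product of the rings `big w`. -/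
abbrev Om : Type _ := ∀ w : D.W, D.big w

variable {D}

/-- The coefficient of `m` in the component attached to `w`. -/
def cf (x : D.Om) (w : D.W) (m : Mono I) : ℤ := D.coef w (x w) m

lemma cf_ext {x y : D.Om} (h : ∀ w m, cf x w m = cf y w m) : x = y := by
  funext w
  refine Subtype.ext (HahnSeries.ext (funext fun m => ?_))
  exact h w (D.toMono w m)

@[simp] lemma cf_zero (w : D.W) (m : Mono I) : cf (0 : D.Om) w m = 0 := rfl

@[simp] lemma cf_add (x y : D.Om) (w : D.W) (m : Mono I) :
    cf (x + y) w m = cf x w m + cf y w m := rfl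

@[simp] lemma cf_neg (x : D.Om) (w : D.W) (m : Mono I) : cf (-x) w m = -cf x w m := rfl

@[simp] lemma cf_sub (x y : D.Om) (w : D.W) (m : Mono I) :
    cf (x - y) w m = cf x w m - cf y w m := rfl

/-- The coefficient as an additive map. -/
def cfHom (w : D.W) (m : Mono I) : D.Om →+ ℤ where
  toFun x := cf x w m
  map_zero' := rfl
  map_add' _ _ := rfl

lemma cf_zsmul (n : ℤ) (x : D.Om) (w : D.W) (m : Mono I) :
    cf (n • x) w m = n * cf x w m := by
  rw [← smul_eq_mul]
  exact map_zsmul (cfHom w m) n x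

lemma cf_sum {α : Type*} (s : Finset α) (f : α → D.Om) (w : D.W) (m : Mono I) :
    cf (∑ a ∈ s, f a) w m = ∑ a ∈ s, cf (f a) w m :=
  map_sum (cfHom w m) f s

lemma cf_mul_ne {x y : D.Om} {w : D.W} {n : Mono I} (h : cf (x * y) w n ≠ 0) :
    ∃ a b, a + b = n ∧ cf x w a ≠ 0 ∧ cf y w b ≠ 0 := by
  obtain ⟨a, ha, b, hb, e⟩ := HahnSeries.support_mul_subset
    (x := (x w : D.Series w)) (y := (y w : D.Series w)) h
  exact ⟨D.toMono w a, D.toMono w b, by rw [← map_add]; exact congrArg (D.toMono w) e, ha, hb⟩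

lemma cf_bound (x : D.Om) (w : D.W) : ∃ B : Set (I → ℤ), B.Finite ∧
    ∀ m, cf x w m ≠ 0 → ∃ b ∈ B, D.LeW w m.2 b := by
  obtain ⟨B, hB, h⟩ := (x w).2.1.1
  exact ⟨B, hB, fun m hm => h ((D.toMono w).symm m) hm⟩

lemma cf_fiber (x : D.Om) (w : D.W) (y : I → ℤ) : {m | cf x w m ≠ 0 ∧ m.2 = y}.Finite :=
  (x w).2.1.2 y

lemma cf_deg (x : D.Om) (w : D.W) : (deg I '' {m | cf x w m ≠ 0}).Finite := (x w).2.2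

lemma cf_interval (x : D.Om) (w : D.W) (y : I → ℤ) :
    {m | cf x w m ≠ 0 ∧ D.LeW w y m.2}.Finite := by
  obtain ⟨B, hB, h⟩ := cf_bound x w
  refine (hB.biUnion fun b _ => (D.finite_interval w y b).biUnion fun z _ =>
    cf_fiber x w z).subset ?_
  rintro m ⟨h1, h2⟩
  obtain ⟨b, hb, h3⟩ := h m h1
  exact Set.mem_biUnion hb (Set.mem_biUnion (show m.2 ∈ _ from ⟨h2, h3⟩) ⟨h1, rfl⟩)

/-- Elements of the ambient ring are constructed from their coefficients. -/
lemma exists_cf (c : D.W → Mono I → ℤ)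
    (h1 : ∀ w, ∃ B : Set (I → ℤ), B.Finite ∧ ∀ m, c w m ≠ 0 → ∃ b ∈ B, D.LeW w m.2 b)
    (h2 : ∀ w y, {m | c w m ≠ 0 ∧ m.2 = y}.Finite)
    (h3 : ∀ w, (deg I '' {m | c w m ≠ 0}).Finite) : ∃ x : D.Om, ∀ w m, cf x w m = c w m := by
  have hc : ∀ w, D.ConeFinite w (Function.support fun m : D.OrdMono w => c w (D.toMono w m)) :=
    fun w => ⟨h1 w, h2 w⟩
  exact ⟨fun w => ⟨⟨fun m => c w (D.toMono w m), ConeFinite.isPWO D (hc w)⟩, hc w, h3 w⟩,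
    fun _ _ => rfl⟩

variable (D) in
/-- A monomial, embedded diagonally. -/
def E (m : Mono I) : D.Om := fun w => ⟨D.mono w m,
  have h := D.mono_mem_poly w (AddSubgroup.mem_top m)
  ⟨ConeFinite.of_finite D w h.1, h.1.image _⟩⟩

lemma E_add (m n : Mono I) : D.E (m + n) = D.E m * D.E n := by
  funext w
  refine Subtype.ext ?_
  show D.mono w (m + n) = D.mono w m * D.mono w n
  simp only [mono, HahnSeries.single_mul_single, ← map_add, mul_one]

lemma E_zero : D.E 0 = 1 := rfl

lemma E_mul_neg (m : Mono I) : D.E m * D.E (-m) = 1 := by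
  rw [← E_add, add_neg_cancel, E_zero]

lemma E_sub (m n : Mono I) : D.E (m - n) = D.E m * D.E (-n) := by
  rw [sub_eq_add_neg, E_add]

lemma cf_E (m : Mono I) (w : D.W) (n : Mono I) : cf (D.E m) w n = if n = m then 1 else 0 := by
  show (HahnSeries.single ((D.toMono w).symm m) (1 : ℤ)).coeff ((D.toMono w).symm n) = _
  rw [HahnSeries.coeff_single]
  simp

lemma cf_one (w : D.W) (n : Mono I) : cf (1 : D.Om) w n = if n = 0 then 1 else 0 := cf_E 0 w n

lemma cf_E_mul (m : Mono I) (x : D.Om) (w : D.W) (n : Mono I) :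
    cf (D.E m * x) w n = cf x w (n - m) := by
  have := HahnSeries.coeff_single_mul_add (r := (1 : ℤ)) (x := (x w : D.Series w))
    (a := (D.toMono w).symm (n - m)) (b := (D.toMono w).symm m)
  rw [← map_add, sub_add_cancel, one_mul] at this
  exact this

variable (D) in
/-- A monomial as a unit. -/
def Eu : Mono I →+ Additive D.Omˣ where
  toFun m := Additive.ofMul ⟨D.E m, D.E (-m), E_mul_neg m, by rw [mul_comm, E_mul_neg]⟩
  map_zero' := rfl
  map_add' m n := by
    refine Additive.toMul.injective (Units.ext ?_)
    exact E_add m n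

/-! ### Operators compatible with infinite sums -/

lemma LeW_mul_iff (w u : D.W) (x y : I → ℤ) :
    D.LeW (w * u) x y ↔ D.LeW w (D.act u x) (D.act u y) := by
  rw [LeW, LeW, map_mul, Module.End.mul_apply, map_sub (D.act u)]

lemma act_inv_act (u : D.W) (x : I → ℤ) : D.act u (D.act u⁻¹ x) = x := by
  rw [← Module.End.mul_apply, ← map_mul, mul_inv_cancel, map_one, Module.End.one_apply]

lemma LeW.add_right_iff {w : D.W} {x y : I → ℤ} (c : I → ℤ) :
    D.LeW w (x + c) (y + c) ↔ D.LeW w x y := by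
  rw [LeW, LeW, add_sub_add_right_eq_sub]

/-- A bound on the weights and degrees of the images of monomials. -/
abbrev Bound (D : CartanDatum I) : Type _ := D.W → (I → ℤ) → Set ((I → ℤ) × (I → ℤ))

/-- The monomial `n` respects the bound `H` for the image of `m` under an operator mapping the
component attached to `w u` to the one attached to `w`. -/
def Dominated (H : D.Bound) (u w : D.W) (m n : Mono I) : Prop :=
  ∃ c ∈ H w (deg I m), deg I n = c.2 ∧ D.LeW w n.2 (D.act u m.2 + c.1)

/-- The operator maps the component attached to `w u` to the one attached to `w`, and the images of
monomials satisfy a uniform bound depending only on the degree. -/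
def Good (u : D.W) (Φ : D.Om →+ D.Om) : Prop :=
  ∃ H : D.Bound, (∀ w l, (H w l).Finite) ∧
    ∀ x w n, cf (Φ x) w n ≠ 0 → ∃ m, cf x (w * u) m ≠ 0 ∧ Dominated H u w m n

/-- Finitely many degrees occur in x, each admits finitely many bounds c, and for each c the weight
of m is squeezed between a fixed weight and the finitely many cones that contain the support of x.
-/
lemma finite_dominating {H : D.Bound} (hH : ∀ w l, (H w l).Finite) (x : D.Om) (u w : D.W)
    (y : I → ℤ) : {m | cf x (w * u) m ≠ 0 ∧
      ∃ c ∈ H w (deg I m), D.LeW w y (D.act u m.2 + c.1)}.Finite := by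
  refine ((cf_deg x (w * u)).biUnion fun l _ => (hH w l).biUnion fun c _ =>
    cf_interval x (w * u) (D.act u⁻¹ (y - c.1))).subset ?_
  rintro m ⟨h1, c, hc, h2⟩
  refine Set.mem_biUnion ⟨m, h1, rfl⟩ (Set.mem_biUnion hc ⟨h1, ?_⟩)
  rw [LeW_mul_iff, act_inv_act, ← LeW.add_right_iff c.1, sub_add_cancel]
  exact h2

/-- For a given n, only the finitely many monomials of x whose bound reaches n matter. The element x
is truncated to them: the remainder contributes nothing to the coefficient of n, and on the
truncation additivity suffices. -/
lemma Good.formula {u : D.W} {Φ : D.Om →+ D.Om} (h : Good u Φ) (x : D.Om) (w : D.W)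
    (n : Mono I) :
    {m | cf x (w * u) m ≠ 0 ∧ cf (Φ (D.E m)) w n ≠ 0}.Finite ∧
    cf (Φ x) w n = ∑ᶠ m, cf x (w * u) m * cf (Φ (D.E m)) w n := by
  obtain ⟨H, hH, h⟩ := h
  have hT := finite_dominating hH x u w n.2
  set T := {m | cf x (w * u) m ≠ 0 ∧ ∃ c ∈ H w (deg I m), D.LeW w n.2 (D.act u m.2 + c.1)}
  have hsub : {m | cf x (w * u) m ≠ 0 ∧ cf (Φ (D.E m)) w n ≠ 0} ⊆ T := by
    rintro m ⟨h1, h2⟩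
    obtain ⟨m', h3, c, hc, -, h4⟩ := h _ _ _ h2
    rw [cf_E] at h3
    obtain rfl : m' = m := by by_contra hne; exact h3 (if_neg hne)
    exact ⟨h1, c, hc, h4⟩
  refine ⟨hT.subset hsub, ?_⟩
  let x' : D.Om := ∑ m ∈ hT.toFinset, cf x (w * u) m • D.E m
  have hx' : ∀ m, cf x' (w * u) m = if m ∈ T then cf x (w * u) m else 0 := by
    intro m
    simp [x', cf_sum, cf_zsmul, cf_E, -zsmul_eq_mul]
  have h0 : cf (Φ (x - x')) w n = 0 := by
    by_contra hne
    obtain ⟨m, h3, c, hc, -, h4⟩ := h _ _ _ hne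
    rw [cf_sub, hx'] at h3
    by_cases hm : m ∈ T
    · simp [hm] at h3
    · rw [if_neg hm, sub_zero] at h3
      exact hm ⟨h3, c, hc, h4⟩
  rw [map_sub, cf_sub, sub_eq_zero] at h0
  rw [h0, map_sum, cf_sum, finsum_eq_sum_of_support_subset (s := hT.toFinset)]
  · refine Finset.sum_congr rfl fun m _ => ?_
    rw [map_zsmul, cf_zsmul]
  · intro m hm
    rw [Set.Finite.coe_toFinset]
    rw [Function.mem_support, mul_ne_zero_iff] at hm
    exact hsub hm

lemma Good.ext {u : D.W} {Φ Φ' : D.Om →+ D.Om} (h : Good u Φ) (h' : Good u Φ')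
    (e : ∀ m, Φ (D.E m) = Φ' (D.E m)) : Φ = Φ' := by
  refine AddMonoidHom.ext fun x => cf_ext fun w n => ?_
  rw [(h.formula x w n).2, (h'.formula x w n).2]
  simp only [e]

lemma Good.component_congr {u : D.W} {Φ : D.Om →+ D.Om} (h : Good u Φ) {x y : D.Om} {w : D.W}
    (e : ∀ m, cf x (w * u) m = cf y (w * u) m) (n : Mono I) : cf (Φ x) w n = cf (Φ y) w n := by
  rw [(h.formula x w n).2, (h.formula y w n).2]
  simp only [e]

/-- A bound records the degree of the image next to its weight, because the bound of the outer
operator has to be read off at that degree. -/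
lemma Good.comp {u u' : D.W} {Φ Φ' : D.Om →+ D.Om} (h : Good u Φ) (h' : Good u' Φ') :
    Good (u * u') (Φ.comp Φ') := by
  obtain ⟨H, hH, h⟩ := h
  obtain ⟨H', hH', h'⟩ := h'
  refine ⟨fun w l => ⋃ c' ∈ H' (w * u) l, (fun c => (c.1 + D.act u c'.1, c.2)) '' H w c'.2,
    fun w l => (hH' _ _).biUnion fun c' _ => (hH _ _).image _, fun x w n hn => ?_⟩
  obtain ⟨m, hm, c, hc, e1, e2⟩ := h _ _ _ hn
  obtain ⟨m', hm', c', hc', e1', e2'⟩ := h' _ _ _ hm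
  refine ⟨m', by rwa [← mul_assoc], (c.1 + D.act u c'.1, c.2), ?_, e1, ?_⟩
  · exact Set.mem_biUnion hc' ⟨c, e1' ▸ hc, rfl⟩
  · rw [LeW_mul_iff, ← LeW.add_right_iff c.1] at e2'
    refine e2.trans ?_
    rw [map_mul, Module.End.mul_apply]
    rw [map_add, add_assoc, add_comm (D.act u c'.1)] at e2'
    exact e2'

lemma Good.id : Good (1 : D.W) (AddMonoidHom.id D.Om) :=
  ⟨fun _ l => {(0, l)}, fun _ _ => Set.finite_singleton _, fun x w n hn =>
    ⟨n, by simpa using hn, _, rfl, rfl, by simpa using LeW.refl' D w _⟩⟩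

lemma Good.mulRight (y : D.Om) : Good (1 : D.W) (AddMonoidHom.mulRight y) := by
  choose B hB hb using cf_bound y
  refine ⟨fun w l => (B w) ×ˢ ((fun l' => l + l') '' (deg I '' {m | cf y w m ≠ 0})),
    fun w l => (hB w).prod ((cf_deg y w).image _), fun x w n hn => ?_⟩
  obtain ⟨a, b, rfl, ha, hb'⟩ := cf_mul_ne (x := x) (y := y) hn
  obtain ⟨c, hc, hle⟩ := hb w b hb'
  refine ⟨a, by simpa using ha, (c, deg I a + deg I b), ⟨hc, _, ⟨b, hb', rfl⟩, rfl⟩, by simp, ?_⟩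
  rw [map_one, Module.End.one_apply]
  exact (LeW.refl' D w _).add hle

/-- Multiplicative maps on monomials with a uniform bound extend to ring homomorphisms that are
compatible with infinite sums. -/
theorem exists_extension (u : D.W) (G : Mono I → D.Om) (h0 : G 0 = 1)
    (hadd : ∀ m n, G (m + n) = G m * G n) (H : D.Bound) (hH : ∀ w l, (H w l).Finite)
    (hG : ∀ w m n, cf (G m) w n ≠ 0 → Dominated H u w m n) :
    ∃ Φ : D.Om →+* D.Om, (∀ m, Φ (D.E m) = G m) ∧ Good u (Φ : D.Om →+ D.Om) ∧
      ∀ x w n, cf (Φ x) w n ≠ 0 → ∃ m, cf x (w * u) m ≠ 0 ∧ cf (G m) w n ≠ 0 := by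
  have hfin : ∀ (x : D.Om) w n, (Function.support fun m =>
      cf x (w * u) m * cf (G m) w n).Finite := by
    intro x w n
    refine (finite_dominating hH x u w n.2).subset fun m hm => ?_
    rw [Function.mem_support, mul_ne_zero_iff] at hm
    obtain ⟨c, hc, -, h⟩ := hG _ _ _ hm.2
    exact ⟨hm.1, c, hc, h⟩
  have hex : ∀ (x : D.Om) w n, ∑ᶠ m, cf x (w * u) m * cf (G m) w n ≠ 0 →
      ∃ m, cf x (w * u) m ≠ 0 ∧ cf (G m) w n ≠ 0 := by
    intro x w n hn
    by_contra hcon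
    refine hn (finsum_eq_zero_of_forall_eq_zero fun m => ?_)
    by_contra hm
    exact hcon ⟨m, mul_ne_zero_iff.1 hm⟩
  have hΦ : ∀ x : D.Om, ∃ z : D.Om, ∀ w n,
      cf z w n = ∑ᶠ m, cf x (w * u) m * cf (G m) w n := by
    intro x
    refine exists_cf _ (fun w => ?_) (fun w y => ?_) (fun w => ?_)
    · obtain ⟨B, hB, hb⟩ := cf_bound x (w * u)
      refine ⟨⋃ l ∈ deg I '' {m | cf x (w * u) m ≠ 0},
        Set.image2 (fun b (c : (I → ℤ) × (I → ℤ)) => D.act u b + c.1) B (H w l),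
        (cf_deg x (w * u)).biUnion fun l _ => hB.image2 _ (hH w l), fun n hn => ?_⟩
      obtain ⟨m, hm, hmn⟩ := hex _ _ _ hn
      obtain ⟨c, hc, -, h⟩ := hG _ _ _ hmn
      obtain ⟨b, hb', hle⟩ := hb m hm
      refine ⟨_, Set.mem_biUnion ⟨m, hm, rfl⟩ ⟨b, hb', c, hc, rfl⟩, h.trans ?_⟩
      rw [LeW.add_right_iff, ← LeW_mul_iff]
      exact hle
    · refine ((finite_dominating hH x u w y).biUnion fun m _ => cf_fiber (G m) w y).subset ?_
      rintro n ⟨hn, rfl⟩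
      obtain ⟨m, hm, hmn⟩ := hex _ _ _ hn
      obtain ⟨c, hc, -, h⟩ := hG _ _ _ hmn
      exact Set.mem_biUnion (show m ∈ _ from ⟨hm, c, hc, h⟩) ⟨hmn, rfl⟩
    · refine ((cf_deg x (w * u)).biUnion fun l _ => (hH w l).image Prod.snd).subset ?_
      rintro _ ⟨n, hn, rfl⟩
      obtain ⟨m, hm, hmn⟩ := hex _ _ _ hn
      obtain ⟨c, hc, e, -⟩ := hG _ _ _ hmn
      exact Set.mem_biUnion ⟨m, hm, rfl⟩ ⟨c, hc, e.symm⟩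
  choose φ hφ using hΦ
  let Φ : D.Om →+ D.Om :=
    { toFun := φ
      map_zero' := cf_ext fun w n => by simp [hφ]
      map_add' := fun x y => cf_ext fun w n => by
        rw [cf_add, hφ, hφ, hφ, ← finsum_add_distrib (hfin x w n) (hfin y w n)]
        simp only [cf_add, add_mul] }
  have hΦx : ∀ x w n, cf (Φ x) w n = ∑ᶠ m, cf x (w * u) m * cf (G m) w n := hφ
  have hΦE : ∀ m, Φ (D.E m) = G m := fun m => cf_ext fun w n => by
    rw [hΦx, finsum_eq_single _ m]
    · simp [cf_E]
    · intro m' hm'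
      simp [cf_E, hm']
  have hgood : Good u Φ := ⟨H, hH, fun x w n hn => by
    rw [hΦx] at hn
    obtain ⟨m, hm, hmn⟩ := hex _ _ _ hn
    exact ⟨m, hm, hG _ _ _ hmn⟩⟩
  -- Multiplicativity holds on monomials. Both sides are compatible with infinite sums in each
  -- factor separately, so it extends to one factor and then to the other.
  have hmul1 : ∀ m y, Φ (D.E m * y) = Φ (D.E m) * Φ y := by
    intro m
    have e1 : Good u (Φ.comp (AddMonoidHom.mulRight (D.E m))) := by
      simpa using hgood.comp (Good.mulRight (D.E m))
    have e2 : Good u ((AddMonoidHom.mulRight (Φ (D.E m))).comp Φ) := by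
      simpa using (Good.mulRight (Φ (D.E m))).comp hgood
    have := e1.ext e2 (fun n => by
      show Φ (D.E n * D.E m) = Φ (D.E n) * Φ (D.E m)
      rw [← E_add, hΦE, hΦE, hΦE, hadd])
    intro y
    have h := DFunLike.congr_fun this y
    rw [mul_comm (D.E m), mul_comm (Φ (D.E m))]
    exact h
  have hmul : ∀ x y, Φ (x * y) = Φ x * Φ y := by
    intro x y
    have e1 : Good u (Φ.comp (AddMonoidHom.mulRight y)) := by
      simpa using hgood.comp (Good.mulRight y)
    have e2 : Good u ((AddMonoidHom.mulRight (Φ y)).comp Φ) := by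
      simpa using (Good.mulRight (Φ y)).comp hgood
    exact DFunLike.congr_fun (e1.ext e2 fun n => hmul1 n y) x
  refine ⟨{ Φ with map_one' := ?_, map_mul' := hmul }, hΦE, hgood, fun x w n hn => ?_⟩
  · show Φ 1 = 1
    rw [← E_zero, hΦE, h0, E_zero]
  · exact hex x w n (by rw [← hΦx]; exact hn)

end CartanDatum
end

noncomputable section

open scoped Classical

namespace CartanDatum

variable {I : Type*} [Fintype I] {D : CartanDatum I} (q : ℂˣ)

/-! ### Leading terms -/

lemma LeW.eq_of_add_eq {w : D.W} {x y x' y' : I → ℤ} (h : D.LeW w x y) (h' : D.LeW w x' y')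
    (e : x + x' = y + y') : x = y := by
  refine h.antisymm ?_
  have : y - x = x' - y' := by
    rw [sub_eq_sub_iff_add_eq_add, add_comm x' x, e]
  rw [LeW] at h' ⊢
  rwa [← neg_sub y x, this, neg_sub]

/-- The component of `x` attached to `w` is `c w • ℓ w` plus terms of strictly smaller weight, and
all its monomials differ from `ℓ w` by monomials in the `Y_{i,a}`. -/
structure Lead (x : D.Om) (l : D.W → Mono I) (c : D.W → ℤˣ) : Prop where
  coeff : ∀ w, cf x w (l w) = c w
  le : ∀ w n, cf x w n ≠ 0 → D.LeW w n.2 (l w).2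
  eq_of_wt : ∀ w n, cf x w n ≠ 0 → n.2 = (l w).2 → n = l w
  mem : ∀ w n, cf x w n ≠ 0 → n - l w ∈ D.monoY q

variable {q}

/-- A product of two monomials reaches the top weight only if both factors do (`LeW.eq_of_add_eq`),
and each factor has a single monomial of top weight. The coefficient is computed by splitting both
factors into leading term and rest. -/
lemma Lead.mul {x y : D.Om} {l l' : D.W → Mono I} {c c' : D.W → ℤˣ} (h : Lead q x l c)
    (h' : Lead q y l' c') : Lead q (x * y) (l + l') (c * c') where
  coeff w := by
    set x0 := x - (c w : ℤ) • D.E (l w) with hx0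
    set y0 := y - (c' w : ℤ) • D.E (l' w) with hy0
    have hx : x = (c w : ℤ) • D.E (l w) + x0 := by rw [hx0]; abel
    have hy : y = (c' w : ℤ) • D.E (l' w) + y0 := by rw [hy0]; abel
    have zx : cf x0 w (l w) = 0 := by simp [hx0, cf_zsmul, cf_E, h.coeff, -zsmul_eq_mul]
    have zy : cf y0 w (l' w) = 0 := by simp [hy0, cf_zsmul, cf_E, h'.coeff, -zsmul_eq_mul]
    have nx : ∀ n, cf x0 w n ≠ 0 → cf x w n ≠ 0 ∧ n ≠ l w := by
      intro n hn
      have hne : n ≠ l w := by rintro rfl; exact hn zx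
      refine ⟨?_, hne⟩
      simpa [hx0, cf_zsmul, cf_E, hne, -zsmul_eq_mul] using hn
    have ny : ∀ n, cf y0 w n ≠ 0 → cf y w n ≠ 0 := by
      intro n hn
      have hne : n ≠ l' w := by rintro rfl; exact hn zy
      simpa [hy0, cf_zsmul, cf_E, hne, -zsmul_eq_mul] using hn
    have e : x * y = ((c w : ℤ) * c' w) • D.E (l w + l' w) + (c w : ℤ) • (D.E (l w) * y0)
        + (c' w : ℤ) • (D.E (l' w) * x0) + x0 * y0 := by
      rw [E_add]
      conv_lhs => rw [hx, hy]
      simp only [zsmul_eq_mul]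
      push_cast
      ring
    have e4 : cf (x0 * y0) w (l w + l' w) = 0 := by
      by_contra hne
      obtain ⟨a, b, hab, ha, hb⟩ := cf_mul_ne hne
      obtain ⟨ha1, ha2⟩ := nx a ha
      refine ha2 (h.eq_of_wt w a ha1 ?_)
      exact (h.le w a ha1).eq_of_add_eq (h'.le w b (ny b hb)) (congrArg Prod.snd hab)
    rw [e]
    simp only [cf_add, cf_zsmul, cf_E_mul, cf_E, Pi.add_apply, Pi.mul_apply, add_sub_cancel_left,
      add_sub_cancel_right, zx, zy, e4]
    simp
  le w n hn := by
    obtain ⟨a, b, rfl, ha, hb⟩ := cf_mul_ne hn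
    exact (h.le w a ha).add (h'.le w b hb)
  eq_of_wt w n hn e := by
    obtain ⟨a, b, rfl, ha, hb⟩ := cf_mul_ne hn
    have e1 := (h.le w a ha).eq_of_add_eq (h'.le w b hb) e
    have e2 := (h'.le w b hb).eq_of_add_eq (h.le w a ha)
      (by rw [add_comm]; exact e.trans (add_comm _ _))
    rw [h.eq_of_wt w a ha e1, h'.eq_of_wt w b hb e2]
    rfl
  mem w n hn := by
    obtain ⟨a, b, rfl, ha, hb⟩ := cf_mul_ne hn
    have := add_mem (h.mem w a ha) (h'.mem w b hb)
    rwa [← add_sub_add_comm] at this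

/-- A signed monomial depending on the component. -/
def Em (l : D.W → Mono I) (c : D.W → ℤˣ) : D.Om := fun w => ((c w : ℤ) • D.E (l w)) w

lemma cf_Em (l : D.W → Mono I) (c : D.W → ℤˣ) (w : D.W) (n : Mono I) :
    cf (Em l c) w n = if n = l w then (c w : ℤ) else 0 := by
  have : cf (Em l c) w n = cf ((c w : ℤ) • D.E (l w)) w n := rfl
  rw [this, cf_zsmul, cf_E]
  simp

lemma Lead.Em (l : D.W → Mono I) (c : D.W → ℤˣ) : Lead q (Em l c) l c where
  coeff w := by rw [cf_Em, if_pos rfl]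
  le w n hn := by
    rw [cf_Em] at hn
    obtain rfl : n = l w := by by_contra h; exact hn (if_neg h)
    exact LeW.refl' D w _
  eq_of_wt w n hn _ := by
    rw [cf_Em] at hn
    by_contra h; exact hn (if_neg h)
  mem w n hn := by
    rw [cf_Em] at hn
    obtain rfl : n = l w := by by_contra h; exact hn (if_neg h)
    rw [sub_self]
    exact zero_mem _

lemma Lead.E (m : Mono I) : Lead q (D.E m) (fun _ => m) 1 := by
  have : D.E m = CartanDatum.Em (fun _ => m) 1 := cf_ext fun w n => by rw [cf_E, cf_Em]; rfl
  rw [this]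
  exact Lead.Em _ _

/-! ### Depth of weights and inversion by geometric series -/

/-- The height of an element of `Q⁺`. -/
def ht (D : CartanDatum I) (x : I → ℤ) : ℕ := if h : D.QPos x then ∑ i, h.choose i else 0

lemma ht_sum (k : I → ℕ) : ht D (∑ i, (k i : ℤ) • D.root i) = ∑ i, k i := by
  have h : D.QPos (∑ i, (k i : ℤ) • D.root i) := ⟨k, rfl⟩
  rw [ht, dif_pos h]
  have e := h.choose_spec
  have h0 : ∑ i, ((k i : ℤ) - h.choose i) • D.root i = 0 := by
    simp only [sub_smul, Finset.sum_sub_distrib]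
    rw [← e, sub_self]
  refine Finset.sum_congr rfl fun i _ => ?_
  have := congrFun (D.root_indep _ h0) i
  simp only [Pi.zero_apply] at this
  omega

lemma ht_add {x y : I → ℤ} (hx : D.QPos x) (hy : D.QPos y) : ht D (x + y) = ht D x + ht D y := by
  obtain ⟨k, rfl⟩ := hx
  obtain ⟨l, rfl⟩ := hy
  have : ∑ i, (k i : ℤ) • D.root i + ∑ i, (l i : ℤ) • D.root i =
      ∑ i, (((k + l) i : ℕ) : ℤ) • D.root i := by
    simp [add_smul, Finset.sum_add_distrib]
  rw [this, ht_sum, ht_sum, ht_sum, ← Finset.sum_add_distrib]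
  rfl

lemma ht_zero : ht D 0 = 0 := by
  simpa using ht_sum (D := D) 0

lemma eq_zero_of_ht {x : I → ℤ} (hx : D.QPos x) (h : ht D x = 0) : x = 0 := by
  obtain ⟨k, rfl⟩ := hx
  rw [ht_sum] at h
  refine Finset.sum_eq_zero fun i hi => ?_
  rw [(Finset.sum_eq_zero_iff.1 h) i hi]
  simp

/-- The depth of a weight `y ≤_w x` below `x`. -/
def depth (w : D.W) (y x : I → ℤ) : ℕ := ht D (D.act w (x - y))

lemma depth_add {w : D.W} {x y x' y' : I → ℤ} (h : D.LeW w y x) (h' : D.LeW w y' x') :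
    depth w (y + y') (x + x') = depth w y x + depth w y' x' := by
  rw [depth, depth, depth, ← ht_add h h', ← map_add, add_sub_add_comm]

lemma depth_self (w : D.W) (x : I → ℤ) : depth w x x = 0 := by
  rw [depth, sub_self, map_zero, ht_zero]

lemma depth_pos {w : D.W} {x y : I → ℤ} (h : D.LeW w y x) (hne : y ≠ x) : 0 < depth w y x := by
  refine Nat.pos_of_ne_zero fun h0 => hne ?_
  have := eq_zero_of_ht h h0
  rw [← map_zero (D.act w)] at this
  exact (sub_eq_zero.1 (D.act_injective w this)).symm

lemma depth_trans {w : D.W} {x y z : I → ℤ} (h : D.LeW w x y) (h' : D.LeW w y z) :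
    depth w x z = depth w x y + depth w y z := by
  rw [depth, depth, depth, ← ht_add h h', ← map_add]
  congr 2
  abel

/-- Series with leading term `1` are invertible. -/
lemma Lead.exists_inv {x : D.Om} (h : Lead q x 0 1) : ∃ y, x * y = 1 ∧ Lead q y 0 1 := by
  -- The inverse is the geometric series in z. The monomials of z have weights strictly below 0, so
  -- those of z ^ k have depth at least k, and every coefficient of the series is a finite sum.
  set z := 1 - x with hz
  have hx : x = 1 - z := by rw [hz]; abel
  have z1 : ∀ w n, cf z w n ≠ 0 → D.LeW w n.2 0 ∧ n.2 ≠ 0 ∧ n ∈ D.monoY q := by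
    intro w n hn
    have hn0 : n ≠ 0 := by
      rintro rfl
      refine hn ?_
      have := h.coeff w
      rw [hz, cf_sub, cf_one, if_pos rfl]
      simp only [Pi.zero_apply, Pi.one_apply, Units.val_one] at this
      omega
    have hxn : cf x w n ≠ 0 := by
      rw [hz, cf_sub, cf_one, if_neg hn0] at hn
      simpa using hn
    refine ⟨h.le w n hxn, fun e => hn0 (h.eq_of_wt w n hxn e), ?_⟩
    simpa using h.mem w n hxn
  have zk : ∀ k w n, cf (z ^ k) w n ≠ 0 →
      D.LeW w n.2 0 ∧ k ≤ depth w n.2 0 ∧ n ∈ D.monoY q := by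
    intro k
    induction k with
    | zero =>
      intro w n hn
      rw [pow_zero, cf_one] at hn
      obtain rfl : n = 0 := by by_contra h; exact hn (if_neg h)
      exact ⟨LeW.refl' D w _, Nat.zero_le _, zero_mem _⟩
    | succ k ih =>
      intro w n hn
      rw [pow_succ] at hn
      obtain ⟨a, b, rfl, ha, hb⟩ := cf_mul_ne hn
      obtain ⟨a1, a2, a3⟩ := ih w a ha
      obtain ⟨b1, b2, b3⟩ := z1 w b hb
      have e : depth w (a + b).2 0 = depth w a.2 0 + depth w b.2 0 := by
        simpa using depth_add a1 b1
      refine ⟨by simpa using a1.add b1, ?_, add_mem a3 b3⟩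
      have := depth_pos b1 b2
      omega
  obtain ⟨y, hy⟩ := exists_cf (D := D)
    (fun w n => ∑ k ∈ Finset.range (depth w n.2 0 + 1), cf (z ^ k) w n)
    (fun w => ⟨{0}, Set.finite_singleton _, fun n hn => by
      obtain ⟨k, -, hk⟩ := Finset.exists_ne_zero_of_sum_ne_zero hn
      exact ⟨0, rfl, (zk k w n hk).1⟩⟩)
    (fun w y => by
      refine ((Finset.finite_toSet (Finset.range (depth w y 0 + 1))).biUnion fun k _ =>
        cf_fiber (z ^ k) w y).subset ?_
      rintro n ⟨hn, rfl⟩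
      obtain ⟨k, hk, hk'⟩ := Finset.exists_ne_zero_of_sum_ne_zero hn
      exact Set.mem_biUnion hk ⟨hk', rfl⟩)
    (fun w => (Set.finite_singleton (0 : I → ℤ)).subset (by
      rintro _ ⟨n, hn, rfl⟩
      obtain ⟨k, -, hk⟩ := Finset.exists_ne_zero_of_sum_ne_zero hn
      exact D.deg_eq_zero_of_mem q (zk k w n hk).2.2))
  have hyne : ∀ w n, cf y w n ≠ 0 → ∃ k, k ≤ depth w n.2 0 ∧ cf (z ^ k) w n ≠ 0 := by
    intro w n hn
    rw [hy] at hn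
    obtain ⟨k, hk, hk'⟩ := Finset.exists_ne_zero_of_sum_ne_zero hn
    exact ⟨k, Nat.lt_succ_iff.1 (Finset.mem_range.1 hk), hk'⟩
  have yle : ∀ w n, cf y w n ≠ 0 → D.LeW w n.2 0 := fun w n hn => by
    obtain ⟨k, -, hk⟩ := hyne w n hn
    exact (zk k w n hk).1
  refine ⟨y, cf_ext fun w p => ?_, ⟨fun w => ?_, yle, fun w n hn e => ?_, fun w n hn => ?_⟩⟩
  · by_cases hp : D.LeW w p.2 0
    · set K := depth w p.2 0
      -- For a coefficient at depth K the series may be replaced by this partial sum, for which x *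
      -- S = 1 - z ^ (K + 1): both z ^ (K + 1) and y - S have depth greater than K.
      set S := ∑ k ∈ Finset.range (K + 1), z ^ k with hS
      have hsplit : x * y = 1 - z ^ (K + 1) + x * (y - S) := by
        rw [mul_sub, hS, hx, mul_neg_geom_sum]
        ring
      have h1 : cf (z ^ (K + 1)) w p = 0 := by
        by_contra hne
        have := (zk _ w p hne).2.1
        omega
      have h2 : cf (x * (y - S)) w p = 0 := by
        by_contra hne
        obtain ⟨a, b, hab, ha, hb⟩ := cf_mul_ne hne
        have ha1 : D.LeW w a.2 0 := h.le w a ha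
        have hb1 : D.LeW w b.2 0 := by
          by_contra hcon
          refine hb ?_
          have e1 : cf y w b = 0 := by by_contra h'; exact hcon (yle w b h')
          have e2 : cf S w b = 0 := by
            rw [hS, cf_sum]
            refine Finset.sum_eq_zero fun k _ => ?_
            by_contra h'
            exact hcon (zk k w b h').1
          rw [cf_sub, e1, e2, sub_zero]
        have hdep : depth w p.2 0 = depth w a.2 0 + depth w b.2 0 := by
          rw [← hab]; simpa using depth_add ha1 hb1
        refine hb ?_
        rw [cf_sub, hy, hS, cf_sum, sub_eq_zero]
        refine Finset.sum_subset (Finset.range_subset_range.2 (by omega)) fun k _ hk => ?_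
        by_contra h'
        have := (zk k w b h').2.1
        exact hk (Finset.mem_range.2 (by omega))
      rw [hsplit, cf_add, cf_sub, h1, h2, sub_zero, add_zero]
    · have h1 : cf (x * y) w p = 0 := by
        by_contra hne
        obtain ⟨a, b, rfl, ha, hb⟩ := cf_mul_ne hne
        exact hp (by simpa using (h.le w a ha).add (yle w b hb))
      have h2 : p ≠ 0 := by rintro rfl; exact hp (LeW.refl' D w _)
      rw [h1, cf_one, if_neg h2]
  · rw [hy]
    simp [depth_self, cf_one]
  · obtain ⟨k, hk, hk'⟩ := hyne w n hn
    rw [e, Pi.zero_apply, Prod.snd_zero, depth_self] at hk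
    obtain rfl : k = 0 := by omega
    rw [pow_zero, cf_one] at hk'
    by_contra h
    exact hk' (if_neg h)
  · obtain ⟨k, -, hk'⟩ := hyne w n hn
    simpa using (zk k w n hk').2.2

variable (q D) in
/-- The units whose components have leading terms, paired with these leading terms. -/
def leadGroup : AddSubgroup (Additive D.Omˣ × (D.W → Mono I) × Additive (D.W → ℤˣ)) where
  carrier := {t | Lead q ((Additive.toMul t.1 : D.Omˣ) : D.Om) t.2.1 (Additive.toMul t.2.2) ∧
    Lead q (((Additive.toMul t.1)⁻¹ : D.Omˣ) : D.Om) (-t.2.1) (Additive.toMul t.2.2)⁻¹}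
  zero_mem' := by
    have : Lead q (1 : D.Om) 0 1 := Lead.E 0
    refine ⟨this, ?_⟩
    simpa using this
  add_mem' := by
    rintro s t ⟨h1, h2⟩ ⟨h3, h4⟩
    refine ⟨h1.mul h3, ?_⟩
    have := h2.mul h4
    rw [← Units.val_mul, ← mul_inv, ← mul_inv] at this
    rw [← neg_add] at this
    exact this
  neg_mem' := by
    rintro s ⟨h1, h2⟩
    refine ⟨h2, ?_⟩
    simpa using h1

/-- Multiplication by the inverse of the leading term reduces to the leading term 1; the sign is its
own inverse. -/
lemma Lead.exists_unit {x : D.Om} {l : D.W → Mono I} {c : D.W → ℤˣ} (h : Lead q x l c) :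
    ∃ u : D.Omˣ, (u : D.Om) = x ∧ (Additive.ofMul u, l, Additive.ofMul c) ∈ D.leadGroup q := by
  have h1 : Lead q (x * CartanDatum.Em (-l) c) 0 1 := by
    have := h.mul (Lead.Em (q := q) (-l) c)
    have hc : c * c = 1 := funext fun w => Int.units_mul_self _
    rwa [add_neg_cancel, hc] at this
  obtain ⟨y, hy, hy'⟩ := h1.exists_inv
  have h2 := (Lead.Em (q := q) (-l) c).mul hy'
  rw [add_zero, mul_one] at h2
  rw [mul_assoc] at hy
  refine ⟨⟨x, _, hy, by rw [mul_comm]; exact hy⟩, rfl, h, ?_⟩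
  have hc : c⁻¹ = c := funext fun w => Int.units_inv_eq_self _
  show Lead q (CartanDatum.Em (-l) c * y) (-l) c⁻¹
  rw [hc]
  exact h2

end CartanDatum
end

noncomputable section

open scoped Classical

namespace CartanDatum

variable {I : Type*} [Fintype I] (D : CartanDatum I) (q : ℂˣ)

/-! ### The series `Σ_{i,a}` -/

/-- `l(w) < l(w s_i)`. -/
abbrev Up (w : D.W) (i : I) : Prop := D.len w < D.len (w * D.s i)

lemma not_up_iff (w : D.W) (i : I) : ¬ D.Up w i ↔ D.len (w * D.s i) < D.len w := by
  have : D.len (w * D.s i) ≠ D.len w := D.cox.toCoxeterSystem.length_mul_simple_ne w i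
  rw [Up]
  omega

lemma up_mul_s (w : D.W) (i : I) : D.Up (w * D.s i) i ↔ ¬ D.Up w i := by
  rw [not_up_iff, Up, s_mul_s_cancel]

lemma leW_smul_root_of_up {w : D.W} {i : I} (h : D.Up w i) {a b : ℤ} (hab : a ≤ b) :
    D.LeW w (a • D.root i) (b • D.root i) := by
  rw [LeW, ← sub_smul, map_smul]
  exact (D.act_root_pos w i h).smul (by omega)

lemma leW_smul_root_of_not_up {w : D.W} {i : I} (h : ¬ D.Up w i) {a b : ℤ} (hab : b ≤ a) :
    D.LeW w (a • D.root i) (b • D.root i) := by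
  rw [LeW, ← sub_smul, map_smul, ← neg_smul_neg]
  exact (D.act_root_neg w i ((D.not_up_iff w i).1 h)).smul (by omega)

lemma smul_root_injective (i : I) {a b : ℤ} (h : a • D.root i = b • D.root i) : a = b := by
  have := congrFun h i
  simp only [Pi.smul_apply, root_self, smul_eq_mul] at this
  omega

lemma termE_snd (i : I) (a : ℂˣ) (k : ℕ) : (D.termE q i a k).2 = (-(k : ℤ)) • D.root i := by
  simp [termE, Prod.snd_sum]

lemma termS_snd (i : I) (a : ℂˣ) (k : ℕ) : (D.termS q i a k).2 = (k : ℤ) • D.root i := by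
  simp [termS, Prod.snd_sum]

lemma termE_mem (i : I) (a : ℂˣ) (k : ℕ) : D.termE q i a k ∈ D.monoY q :=
  neg_mem (sum_mem fun _ _ => D.A_mem q _ _)

lemma termS_mem (i : I) (a : ℂˣ) (k : ℕ) : D.termS q i a k ∈ D.monoY q :=
  sum_mem fun _ _ => D.A_mem q _ _

lemma sigmaCoef_of_up {w : D.W} {i : I} (h : D.Up w i) (a : ℂˣ) (m : Mono I) :
    D.sigmaCoef q w i a m = if ∃ k, m = D.termE q i a k then 1 else 0 := by
  rw [sigmaCoef, if_pos h, coefE]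

lemma sigmaCoef_of_not_up {w : D.W} {i : I} (h : ¬ D.Up w i) (a : ℂˣ) (m : Mono I) :
    D.sigmaCoef q w i a m = if ∃ k, 1 ≤ k ∧ m = D.termS q i a k then -1 else 0 := by
  rw [sigmaCoef, if_neg h, coefS]

lemma exists_termE {w : D.W} {i : I} (h : D.Up w i) {a : ℂˣ} {m : Mono I}
    (hm : D.sigmaCoef q w i a m ≠ 0) : ∃ k, m = D.termE q i a k := by
  rw [sigmaCoef_of_up D q h] at hm
  by_contra hcon
  exact hm (if_neg hcon)

lemma exists_termS {w : D.W} {i : I} (h : ¬ D.Up w i) {a : ℂˣ} {m : Mono I}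
    (hm : D.sigmaCoef q w i a m ≠ 0) : ∃ k, 1 ≤ k ∧ m = D.termS q i a k := by
  rw [sigmaCoef_of_not_up D q h] at hm
  by_contra hcon
  exact hm (if_neg hcon)

lemma sigmaCoef_mem {w : D.W} {i : I} {a : ℂˣ} {m : Mono I} (hm : D.sigmaCoef q w i a m ≠ 0) :
    m ∈ D.monoY q := by
  by_cases h : D.Up w i
  · obtain ⟨k, rfl⟩ := D.exists_termE q h hm
    exact D.termE_mem q _ _ _
  · obtain ⟨k, -, rfl⟩ := D.exists_termS q h hm
    exact D.termS_mem q _ _ _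

lemma sigmaCoef_eq_of_wt {w : D.W} {i : I} {a : ℂˣ} {m n : Mono I}
    (hm : D.sigmaCoef q w i a m ≠ 0) (hn : D.sigmaCoef q w i a n ≠ 0) (e : m.2 = n.2) :
    m = n := by
  by_cases h : D.Up w i
  · obtain ⟨k, rfl⟩ := D.exists_termE q h hm
    obtain ⟨l, rfl⟩ := D.exists_termE q h hn
    rw [termE_snd, termE_snd] at e
    have := D.smul_root_injective i e
    rw [show k = l by omega]
  · obtain ⟨k, -, rfl⟩ := D.exists_termS q h hm
    obtain ⟨l, -, rfl⟩ := D.exists_termS q h hn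
    rw [termS_snd, termS_snd] at e
    have := D.smul_root_injective i e
    rw [show k = l by omega]

/-- The weight of the leading term of `Σ_{i,a}`. -/
def sigLead (w : D.W) (i : I) (a : ℂˣ) : Mono I :=
  if D.Up w i then 0 else D.A q i (a * D.qi q i ^ 2)

lemma sigmaCoef_sigLead (w : D.W) (i : I) (a : ℂˣ) :
    D.sigmaCoef q w i a (D.sigLead q w i a) = if D.Up w i then 1 else -1 := by
  by_cases h : D.Up w i
  · rw [sigmaCoef_of_up D q h, sigLead, if_pos h, if_pos h, if_pos ⟨0, by simp [termE]⟩]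
  · rw [sigmaCoef_of_not_up D q h, sigLead, if_neg h, if_neg h,
      if_pos ⟨1, le_rfl, by simp [termS]⟩]

lemma sigmaCoef_le {w : D.W} {i : I} {a : ℂˣ} {m : Mono I} (hm : D.sigmaCoef q w i a m ≠ 0) :
    D.LeW w m.2 (D.sigLead q w i a).2 := by
  by_cases h : D.Up w i
  · obtain ⟨k, rfl⟩ := D.exists_termE q h hm
    rw [termE_snd, sigLead, if_pos h]
    simpa using D.leW_smul_root_of_up h (a := -(k : ℤ)) (b := 0) (by omega)
  · obtain ⟨k, hk, rfl⟩ := D.exists_termS q h hm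
    rw [termS_snd, sigLead, if_neg h, A_snd]
    simpa using D.leW_smul_root_of_not_up h (a := (k : ℤ)) (b := 1) (by omega)

lemma exists_sig (i : I) (a : ℂˣ) :
    ∃ x : D.Om, ∀ w m, cf x w m = D.sigmaCoef q w i a m := by
  refine exists_cf _ (fun w => ⟨{(D.sigLead q w i a).2}, Set.finite_singleton _,
    fun m hm => ⟨_, rfl, D.sigmaCoef_le q hm⟩⟩) (fun w y => ?_)
    (fun w => (Set.finite_singleton (0 : I → ℤ)).subset ?_)
  · refine Set.Subsingleton.finite ?_
    rintro m ⟨hm, e⟩ n ⟨hn, e'⟩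
    exact D.sigmaCoef_eq_of_wt q hm hn (e.trans e'.symm)
  · rintro _ ⟨m, hm, rfl⟩
    exact D.deg_eq_zero_of_mem q (D.sigmaCoef_mem q hm)

/-- The element `Σ_{i,a}`. -/
def sig (i : I) (a : ℂˣ) : D.Om := (D.exists_sig q i a).choose

lemma cf_sig (i : I) (a : ℂˣ) (w : D.W) (m : Mono I) :
    cf (D.sig q i a) w m = D.sigmaCoef q w i a m := (D.exists_sig q i a).choose_spec w m

lemma sigma_eq (w : D.W) (i : I) (a : ℂˣ) : D.sigma q w i a = (D.sig q i a w : D.Series w) := by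
  have hc : (fun m : D.OrdMono w => D.sigmaCoef q w i a (D.toMono w m)) =
      (D.sig q i a w : D.Series w).coeff := funext fun m => (D.cf_sig q i a w m).symm
  have hp : (Function.support fun m : D.OrdMono w =>
      D.sigmaCoef q w i a (D.toMono w m)).IsPWO := by
    rw [hc]
    exact (D.sig q i a w : D.Series w).isPWO_support
  rw [sigma, dif_pos hp]
  exact HahnSeries.ext hc

lemma sig_mem_complY (w : D.W) (i : I) (a : ℂˣ) :
    (D.sig q i a w : D.Series w) ∈ D.complY q w :=
  ⟨(D.sig q i a w).2.1, fun m hm => D.sigmaCoef_mem q (w := w) (i := i) (a := a)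
    (by rw [← cf_sig]; exact hm)⟩

/-- In the components with w α_i negative, adding α_i lowers the weight for the ordering attached to
w. The series in positive powers of A then starts from its term k = 1, whose coefficient is -1. -/
lemma lead_sig (i : I) (a : ℂˣ) : Lead q (D.sig q i a) (fun w => D.sigLead q w i a)
    (fun w => if D.Up w i then 1 else -1) where
  coeff w := by
    rw [cf_sig, sigmaCoef_sigLead]
    split_ifs <;> rfl
  le w n hn := D.sigmaCoef_le q (by rwa [cf_sig] at hn)
  eq_of_wt w n hn e := by
    rw [cf_sig] at hn
    refine D.sigmaCoef_eq_of_wt q hn ?_ e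
    rw [sigmaCoef_sigLead]
    split_ifs <;> norm_num
  mem w n hn := by
    rw [cf_sig] at hn
    refine sub_mem (D.sigmaCoef_mem q hn) ?_
    rw [sigLead]
    split_ifs
    · exact zero_mem _
    · exact D.A_mem q _ _

lemma termE_succ (i : I) (a : ℂˣ) (k : ℕ) :
    D.termE q i a (k + 1) = D.termE q i (a * (D.qi q i)⁻¹ ^ 2) k - D.A q i a := by
  rw [termE, termE, Finset.sum_range_succ']
  have : ∀ j, a * (D.qi q i)⁻¹ ^ (2 * (j + 1)) = a * (D.qi q i)⁻¹ ^ 2 * (D.qi q i)⁻¹ ^ (2 * j) :=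
    fun j => by rw [mul_assoc, ← pow_add]; congr 2; ring
  simp only [this, mul_zero, pow_zero, mul_one]
  abel

lemma termS_succ (i : I) (a : ℂˣ) (k : ℕ) :
    D.termS q i (a * (D.qi q i)⁻¹ ^ 2) (k + 1) = D.termS q i a k + D.A q i a := by
  rw [termS, termS, Finset.sum_range_succ']
  have : ∀ j, a * (D.qi q i)⁻¹ ^ 2 * D.qi q i ^ (2 * (j + 1 + 1)) =
      a * D.qi q i ^ (2 * (j + 1)) := fun j => by
    rw [mul_assoc, show 2 * (j + 1 + 1) = 2 + 2 * (j + 1) by ring, pow_add, ← mul_assoc (_ ^ 2),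
      ← mul_pow, inv_mul_cancel, one_pow, one_mul]
  simp only [this]
  congr 2
  rw [mul_assoc, zero_add, mul_one, ← mul_pow, inv_mul_cancel, one_pow, mul_one]

/-- The difference equation of `Σ_{i,a}`. -/
lemma sig_rel (i : I) (a : ℂˣ) :
    D.sig q i a = 1 + D.E (-D.A q i a) * D.sig q i (a * (D.qi q i)⁻¹ ^ 2) := by
  refine cf_ext fun w n => ?_
  rw [cf_add, cf_one, cf_E_mul, sub_neg_eq_add, cf_sig, cf_sig]
  by_cases h : D.Up w i
  · rw [sigmaCoef_of_up D q h, sigmaCoef_of_up D q h]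
    by_cases hn : n = 0
    · have h1 : ∃ k, n = D.termE q i a k := ⟨0, by simp [hn, termE]⟩
      have h2 : ¬ ∃ k, n + D.A q i a = D.termE q i (a * (D.qi q i)⁻¹ ^ 2) k := by
        rintro ⟨k, hk⟩
        have := congrArg Prod.snd hk
        rw [hn, zero_add, A_snd, termE_snd, ← one_smul ℤ (D.root i), smul_smul] at this
        have := D.smul_root_injective i this
        omega
      rw [if_pos h1, if_pos hn, if_neg h2, add_zero]
    · have h1 : (∃ k, n = D.termE q i a k) ↔
          ∃ k, n + D.A q i a = D.termE q i (a * (D.qi q i)⁻¹ ^ 2) k := by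
        constructor
        · rintro ⟨k, rfl⟩
          cases k with
          | zero => exact absurd (by simp [termE]) hn
          | succ k => exact ⟨k, by rw [termE_succ, sub_add_cancel]⟩
        · rintro ⟨k, hk⟩
          exact ⟨k + 1, by rw [termE_succ, ← hk, add_sub_cancel_right]⟩
      rw [if_neg hn, zero_add]
      simp only [h1]
  -- Here the sum starts at k = 1 with coefficient -1. The first term of the shifted sum, divided by
  -- A_{i,a}, is -1 and cancels the constant 1.
  · rw [sigmaCoef_of_not_up D q h, sigmaCoef_of_not_up D q h]
    by_cases hn : n = 0
    · have h1 : ¬ ∃ k, 1 ≤ k ∧ n = D.termS q i a k := by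
        rintro ⟨k, hk, e⟩
        have := congrArg Prod.snd e
        rw [hn, termS_snd, Prod.snd_zero, ← zero_smul ℤ (D.root i)] at this
        have := D.smul_root_injective i this
        omega
      have h2 : ∃ k, 1 ≤ k ∧ n + D.A q i a = D.termS q i (a * (D.qi q i)⁻¹ ^ 2) k :=
        ⟨1, le_rfl, by rw [← zero_add 1, termS_succ, hn]; simp [termS]⟩
      rw [if_neg h1, if_pos hn, if_pos h2]
      norm_num
    · have h1 : (∃ k, 1 ≤ k ∧ n = D.termS q i a k) ↔
          ∃ k, 1 ≤ k ∧ n + D.A q i a = D.termS q i (a * (D.qi q i)⁻¹ ^ 2) k := by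
        constructor
        · rintro ⟨k, -, rfl⟩
          exact ⟨k + 1, by omega, by rw [termS_succ]⟩
        · rintro ⟨k, hk, e⟩
          obtain ⟨k, rfl⟩ : ∃ k', k = k' + 1 := ⟨k - 1, by omega⟩
          rw [termS_succ, add_left_inj] at e
          refine ⟨k, ?_, e⟩
          by_contra hk0
          obtain rfl : k = 0 := by omega
          exact hn (by simp [e, termS])
      rw [if_neg hn, zero_add]
      simp only [h1]

/-- `Σ_{i,a}` as a unit. -/
def sigU (i : I) (a : ℂˣ) : D.Omˣ := (D.lead_sig q i a).exists_unit.choose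

@[simp] lemma val_sigU (i : I) (a : ℂˣ) : (D.sigU q i a : D.Om) = D.sig q i a :=
  (D.lead_sig q i a).exists_unit.choose_spec.1

lemma lead_sigU (i : I) (a : ℂˣ) : (Additive.ofMul (D.sigU q i a), fun w => D.sigLead q w i a,
    Additive.ofMul fun w => if D.Up w i then 1 else -1) ∈ D.leadGroup q :=
  (D.lead_sig q i a).exists_unit.choose_spec.2

/-! ### The operators on the ambient ring -/

lemma mem_of_generators {I : Type*} {S : AddSubgroup (Mono I)} (h1 : ∀ i a, psi i a ∈ S)
    (h2 : ∀ x, wtMono x ∈ S) (m : Mono I) : m ∈ S := by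
  have e : m = (m.1, 0) + (0, m.2) := by simp
  rw [e]
  refine S.add_mem ?_ (h2 m.2)
  induction m.1 using Finsupp.induction_linear with
  | zero => exact S.zero_mem
  | add u v hu hv =>
    have : ((u + v, 0) : Mono I) = (u, 0) + (v, 0) := by simp
    rw [this]
    exact S.add_mem hu hv
  | single p n =>
    have : ((Finsupp.single p n, 0) : Mono I) = n • psi p.1 p.2 := by
      simp [psi]
    rw [this]
    exact S.zsmul_mem (h1 _ _) n

/-- The factor of the image of a monomial that is a product of series `Σ_{i,a}`. -/
def sigPart (i : I) : Mono I →+ Additive D.Omˣ :=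
  (Finsupp.liftAddHom fun p : I × ℂˣ => zmultiplesHom (Additive D.Omˣ)
    (if p.1 = i then Additive.ofMul (D.sigU q i (p.2 * (D.qi q i)⁻¹ ^ 2)) else 0)).comp
    (AddMonoidHom.fst _ _)

/-- The image of a monomial under the operator attached to `s_i`. -/
def thetaM (i : I) : Mono I →+ Additive D.Omˣ := D.Eu.comp (D.sigmaM q i) + D.sigPart q i

lemma sigPart_psi_self (i : I) (a : ℂˣ) :
    D.sigPart q i (psi i a) = Additive.ofMul (D.sigU q i (a * (D.qi q i)⁻¹ ^ 2)) := by
  simp [sigPart, psi]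

lemma sigPart_psi_ne {i j : I} (h : j ≠ i) (a : ℂˣ) : D.sigPart q i (psi j a) = 0 := by
  simp [sigPart, psi, h]

lemma sigPart_wtMono (i : I) (x : I → ℤ) : D.sigPart q i (wtMono x) = 0 := by
  simp [sigPart, wtMono]

/-- The substitution `Ψ_{i,a} ↦ A_{i,a}`, mapping the other variables to `1`. -/
def aPart (i : I) : Mono I →+ Mono I :=
  (Finsupp.liftAddHom fun p : I × ℂˣ => zmultiplesHom (Mono I)
    (if p.1 = i then D.A q i p.2 else 0)).comp (AddMonoidHom.fst _ _)

lemma aPart_psi (i j : I) (a : ℂˣ) :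
    D.aPart q i (psi j a) = if j = i then D.A q i a else 0 := by
  simp [aPart, psi]

lemma aPart_wtMono (i : I) (x : I → ℤ) : D.aPart q i (wtMono x) = 0 := by
  simp [aPart, wtMono]

lemma aPart_mem (i : I) (m : Mono I) : D.aPart q i m ∈ D.monoY q := by
  refine mem_of_generators (S := (D.monoY q).comap (D.aPart q i)) (fun j a => ?_) (fun x => ?_) m
  · rw [AddSubgroup.mem_comap, aPart_psi]
    split_ifs
    · exact D.A_mem q _ _
    · exact zero_mem _
  · rw [AddSubgroup.mem_comap, aPart_wtMono]
    exact zero_mem _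

lemma aPart_snd (i : I) (m : Mono I) : (D.aPart q i m).2 = deg I m i • D.root i := by
  have : (AddMonoidHom.snd _ _).comp (D.aPart q i) =
      ((zmultiplesHom (I → ℤ)) (D.root i)).comp ((Pi.evalAddMonoidHom (fun _ => ℤ) i).comp
        (deg I)) := by
    refine mono_hom_ext (fun j a => ?_) (fun x => by simp [aPart_wtMono])
    by_cases h : j = i
    · subst h; simp [aPart_psi]
    · simp [aPart_psi, h, Ne.symm h]
  exact DFunLike.congr_fun this m

/-- The leading monomials of the images of monomials. -/
def thetaLead (i : I) : Mono I →+ (D.W → Mono I) where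
  toFun m w := D.sigmaM q i m + if D.Up w i then 0 else D.aPart q i m
  map_zero' := by ext1 w; simp
  map_add' m n := by
    funext w
    simp only [map_add, Pi.add_apply]
    split_ifs <;> abel

/-- The leading signs of the images of monomials. -/
def thetaSign (i : I) : Mono I →+ Additive (D.W → ℤˣ) :=
  ((zmultiplesHom (Additive (D.W → ℤˣ)))
    (Additive.ofMul fun w => if D.Up w i then 1 else -1)).comp
      ((Pi.evalAddMonoidHom (fun _ => ℤ) i).comp (deg I))

lemma Eu_mem_leadGroup (m : Mono I) : (D.Eu m, fun _ => m, 0) ∈ D.leadGroup q := by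
  refine ⟨Lead.E m, ?_⟩
  have : Lead q (D.E (-m)) (fun _ => -m) 1 := Lead.E (-m)
  have e : (Additive.toMul (0 : Additive (D.W → ℤˣ)))⁻¹ = 1 := by simp
  show Lead q (D.E (-m)) (-fun _ => m) (Additive.toMul (0 : Additive (D.W → ℤˣ)))⁻¹
  rw [e]
  exact this

/-- Units with known leading terms form a group, so it is enough to look at generators. Only Ψ_{i,a}
brings in a series, namely Σ_{i,aq_i⁻²}; its leading monomial is 1 or A_{i,a}, the shift by q_i⁻²
compensating the q_i² in `sigLead`. -/
lemma thetaM_mem_leadGroup (i : I) (m : Mono I) :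
    (D.thetaM q i m, D.thetaLead q i m, D.thetaSign i m) ∈ D.leadGroup q := by
  have key := mem_of_generators
    (S := (D.leadGroup q).comap ((D.thetaM q i).prod ((D.thetaLead q i).prod (D.thetaSign i))))
    (fun j a => ?_) (fun x => ?_) m
  · exact key
  · show (D.thetaM q i (psi j a), D.thetaLead q i (psi j a), D.thetaSign i (psi j a))
      ∈ D.leadGroup q
    by_cases h : j = i
    · subst h
      have := add_mem (D.Eu_mem_leadGroup q (D.sigmaM q j (psi j a)))
        (D.lead_sigU q j (a * (D.qi q j)⁻¹ ^ 2))
      convert this using 1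
      refine Prod.ext ?_ (Prod.ext ?_ ?_)
      · show _ + D.sigPart q j (psi j a) = _
        rw [sigPart_psi_self]
        rfl
      · funext w
        show D.sigmaM q j (psi j a) + _ = D.sigmaM q j (psi j a) + D.sigLead q w j _
        rw [sigLead, aPart_psi, if_pos rfl, mul_assoc, ← mul_pow, inv_mul_cancel, one_pow, mul_one]
      · simp [thetaSign]
    · have := D.Eu_mem_leadGroup q (D.sigmaM q i (psi j a))
      convert this using 1
      refine Prod.ext ?_ (Prod.ext ?_ ?_)
      · show _ + D.sigPart q i (psi j a) = _
        rw [sigPart_psi_ne D q h, add_zero]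
        rfl
      · funext w
        show D.sigmaM q i (psi j a) + _ = D.sigmaM q i (psi j a)
        rw [aPart_psi, if_neg h]
        simp
      · simp [thetaSign, Ne.symm h]
  · show (D.thetaM q i (wtMono x), D.thetaLead q i (wtMono x), D.thetaSign i (wtMono x))
      ∈ D.leadGroup q
    have := D.Eu_mem_leadGroup q (D.sigmaM q i (wtMono x))
    convert this using 1
    refine Prod.ext ?_ (Prod.ext ?_ ?_)
    · show _ + D.sigPart q i (wtMono x) = _
      rw [sigPart_wtMono, add_zero]
      rfl
    · funext w
      show D.sigmaM q i (wtMono x) + _ = D.sigmaM q i (wtMono x)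
      rw [aPart_wtMono]
      simp
    · simp [thetaSign]

/-- The image of a monomial, as an element of the ambient ring. -/
def thetaV (i : I) (m : Mono I) : D.Om := (Additive.toMul (D.thetaM q i m) : D.Omˣ)

lemma thetaV_add (i : I) (m n : Mono I) :
    D.thetaV q i (m + n) = D.thetaV q i m * D.thetaV q i n := by
  simp [thetaV]

lemma lead_thetaV (i : I) (m : Mono I) : Lead q (D.thetaV q i m) (D.thetaLead q i m)
    (Additive.toMul (D.thetaSign i m)) := (D.thetaM_mem_leadGroup q i m).1

lemma thetaLead_apply (i : I) (m : Mono I) (w : D.W) : D.thetaLead q i m w =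
    D.sigmaM q i m + if D.Up w i then 0 else D.aPart q i m := rfl

lemma thetaLead_snd (i : I) (m : Mono I) (w : D.W) : (D.thetaLead q i m w).2 =
    D.refl i m.2 + if D.Up w i then 0 else deg I m i • D.root i := by
  rw [thetaLead_apply, Prod.snd_add, sigmaM_snd]
  split_ifs
  · rfl
  · rw [aPart_snd]

lemma deg_thetaLead (i : I) (m : Mono I) (w : D.W) :
    deg I (D.thetaLead q i m w) = D.degRefl i (deg I m) := by
  rw [thetaLead_apply, map_add, deg_sigmaM]
  split_ifs
  · simp
  · rw [D.deg_eq_zero_of_mem q (D.aPart_mem q i m), add_zero]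

/-- The bound for the operator attached to `s_i`. -/
def thetaBound (i : I) : D.Bound :=
  fun w l => {(if D.Up w i then 0 else l i • D.root i, D.degRefl i l)}

/-- All monomials of the image differ from its leading one by monomials in the Y_{j,b}, which have
degree 0; so a single weight and a single degree bound the whole image. -/
lemma thetaV_dominated (i : I) (w : D.W) (m n : Mono I) (h : cf (D.thetaV q i m) w n ≠ 0) :
    Dominated (D.thetaBound i) (D.s i) w m n := by
  refine ⟨_, rfl, ?_, ?_⟩
  · have := D.deg_eq_zero_of_mem q ((D.lead_thetaV q i m).mem w n h)
    rw [map_sub, sub_eq_zero, deg_thetaLead] at this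
    exact this
  · have := (D.lead_thetaV q i m).le w n h
    rwa [thetaLead_snd, ← act_s] at this

lemma exists_theta (i : I) : ∃ Φ : D.Om →+* D.Om, (∀ m, Φ (D.E m) = D.thetaV q i m) ∧
    Good (D.s i) (Φ : D.Om →+ D.Om) ∧
      ∀ x w n, cf (Φ x) w n ≠ 0 → ∃ m, cf x (w * D.s i) m ≠ 0 ∧ cf (D.thetaV q i m) w n ≠ 0 :=
  exists_extension (D.s i) (D.thetaV q i) (by simp [thetaV]) (D.thetaV_add q i)
    (D.thetaBound i) (fun _ _ => Set.finite_singleton _) (fun w m n => D.thetaV_dominated q i w m n)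

/-- The operator attached to `s_i` on the ambient ring. -/
def theta (i : I) : D.Om →+* D.Om := (D.exists_theta q i).choose

lemma theta_E (i : I) (m : Mono I) : D.theta q i (D.E m) = D.thetaV q i m :=
  (D.exists_theta q i).choose_spec.1 m

lemma theta_good (i : I) : Good (D.s i) (D.theta q i : D.Om →+ D.Om) :=
  (D.exists_theta q i).choose_spec.2.1

lemma theta_support (i : I) {x : D.Om} {w : D.W} {n : Mono I} (h : cf (D.theta q i x) w n ≠ 0) :
    ∃ m, cf x (w * D.s i) m ≠ 0 ∧ cf (D.thetaV q i m) w n ≠ 0 :=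
  (D.exists_theta q i).choose_spec.2.2 x w n h

end CartanDatum
end

noncomputable section

open scoped Classical

namespace CartanDatum

/-! ### Invariants in rank two -/

section Strings

set_option linter.unusedSimpArgs false

variable {M R : Type*} [AddCommGroup M] [CommRing R]

/-- A subring `F` containing the monomials in a group `Fr` and the elements
`y_k + y_k A_{k+d}⁻¹`, where `A_k = y_{k-d} y_{k+d} N_k⁻¹` with `N_k` in `Fr`. -/
structure StringRing (e : M → R) (y N : ℤ → M) (d : ℤ) (Fr : AddSubgroup M) (F : Subring R) :
    Prop where
  add : ∀ m n, e (m + n) = e m * e n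
  free : ∀ f ∈ Fr, e f ∈ F
  mem_N : ∀ k, N k ∈ Fr
  string : ∀ k, e (y k) + e (y k - (y k + y (k + 2 * d) - N (k + d))) ∈ F

variable {e : M → R} {y N A : ℤ → M} {d : ℤ} {Fr : AddSubgroup M} {F : Subring R}

namespace StringRing

lemma sub (h : StringRing e y N d Fr F) (m n : M) : e (m - n) = e m * e (-n) := by
  rw [sub_eq_add_neg, h.add]

lemma mem_one (h : StringRing e y N d Fr F) (hA : ∀ k, A k = y (k - d) + y (k + d) - N k)
    (m f : M) (k : ℤ) (hf : f ∈ Fr) (hm : m = f + y k) :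
    e m + e (m - A (k + d)) ∈ F := by
  have e1 : e m + e (m - A (k + d)) = e f * (e (y k) + e (y k - A (k + d))) := by
    rw [hm, h.sub, h.sub, h.add]; ring
  have e2 := h.string k
  rw [e1, hA, show k + d - d = k by ring, show k + d + d = k + 2 * d by ring]
  exact F.mul_mem (h.free f hf) e2

/-- The product of two strings based at k and l. -/
lemma mem_pair (h : StringRing e y N d Fr F) (hA : ∀ k, A k = y (k - d) + y (k + d) - N k)
    (m f : M) (k l : ℤ) (hf : f ∈ Fr) (hm : m = f + y k + y l) :
    e m + e (m - A (k + d)) + e (m - A (l + d)) + e (m - A (k + d) - A (l + d)) ∈ F := by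
  have h1 := h.mem_one hA (f + y k) f k hf rfl
  have h2 := h.mem_one hA (0 + y l) 0 l (zero_mem _) rfl
  have := F.mul_mem h1 h2
  convert this using 1
  rw [hm, zero_add]
  simp only [h.sub, h.add]
  ring

/-- In the product of the strings based at k and k + 2d, the term divided by A_{k+d} alone has lost
both y-factors. It lies in the frozen group and may be subtracted. -/
lemma mem_two (h : StringRing e y N d Fr F) (hA : ∀ k, A k = y (k - d) + y (k + d) - N k)
    (m f : M) (k : ℤ) (hf : f ∈ Fr) (hm : m = f + y k + y (k + 2 * d)) :
    e m + e (m - A (k + 3 * d)) + e (m - A (k + 3 * d) - A (k + d)) ∈ F := by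
  have h1 := h.mem_pair hA m f k (k + 2 * d) hf hm
  have h2 : e (m - A (k + d)) ∈ F := by
    have : m - A (k + d) = f + N (k + d) := by
      rw [hm, hA, show k + d - d = k by ring, show k + d + d = k + 2 * d by ring]
      abel
    rw [this]
    exact h.free _ (add_mem hf (h.mem_N _))
  convert F.sub_mem h1 h2 using 1
  rw [show k + 2 * d + d = k + 3 * d by ring]
  simp only [h.sub]
  ring

/-- The product of the string of length two with the string based at k + 4d has two superfluous
terms. They form a string based at k, because dividing m by A_{k+3d} removes y_{k+2d} and y_{k+4d}.
-/
lemma mem_three (h : StringRing e y N d Fr F) (hA : ∀ k, A k = y (k - d) + y (k + d) - N k)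
    (m f : M) (k : ℤ) (hf : f ∈ Fr) (hm : m = f + y k + y (k + 2 * d) + y (k + 4 * d)) :
    e m + e (m - A (k + 5 * d)) + e (m - A (k + 5 * d) - A (k + 3 * d)) +
      e (m - A (k + 5 * d) - A (k + 3 * d) - A (k + d)) ∈ F := by
  have h1 := h.mem_two hA (f + y k + y (k + 2 * d)) f k hf rfl
  have h2 := h.mem_one hA (0 + y (k + 4 * d)) 0 (k + 4 * d) (zero_mem _) rfl
  have h3 := h.mem_one hA (m - A (k + 3 * d)) (f + N (k + 3 * d)) k
    (add_mem hf (h.mem_N _)) (by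
      rw [hm, hA, show k + 3 * d - d = k + 2 * d by ring, show k + 3 * d + d = k + 4 * d by ring]
      abel)
  convert F.sub_mem (F.mul_mem h1 h2) h3 using 1
  rw [show k + 4 * d + d = k + 5 * d by ring, zero_add, hm]
  simp only [h.sub, h.add]
  ring

end StringRing

/-- The sum of `y` and of the monomials obtained from `y` by dividing by the products of the
lists `L`. -/
def chain (e : M → R) (y : M) (L : List (List M)) : R :=
  e y + (L.map fun l => e (y - l.sum)).sum

/-- The three terms are those of a fundamental q-character of type A₂; z₀ and z₁ stand for the
factors coming from the other nodes. For each of the two indices the sum is cut into strings in that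
index, up to frozen factors, and frozen monomials. The same method serves the other types. -/
lemma chain_A2 {y₀ y₁ z₀ z₁ A₀ A₁ : ℤ → M} {F₀ F₁ : Subring R}
    {Fr₀ Fr₁ : AddSubgroup M}
    (hA₀ : ∀ k, A₀ k = y₀ (k - 1) + y₀ (k + 1) - (y₁ k + z₀ k))
    (hA₁ : ∀ k, A₁ k = y₁ (k - 1) + y₁ (k + 1) - (y₀ k + z₁ k))
    (h₀ : StringRing e y₀ (fun k => y₁ k + z₀ k) 1 Fr₀ F₀)
    (h₁ : StringRing e y₁ (fun k => y₀ k + z₁ k) 1 Fr₁ F₁)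
    (hy₁ : ∀ k, y₁ k ∈ Fr₀) (hy₀ : ∀ k, y₀ k ∈ Fr₁)
    (hz₀₀ : ∀ k, z₀ k ∈ Fr₀) (hz₁₀ : ∀ k, z₁ k ∈ Fr₀) (hz₀₁ : ∀ k, z₀ k ∈ Fr₁) :
    chain e (y₀ 0) [[A₀ 1], [A₀ 1, A₁ 2]] ∈ F₀ ⊓ F₁ := by
  refine Subring.mem_inf.2 ⟨?_, ?_⟩
  · have s1 := h₀.mem_one hA₀ (y₀ 0) 0 0 (zero_mem _) (by abel)
    have s2 := h₀.free (y₀ 0 - A₀ 1 - A₁ 2) (by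
      rw [show y₀ 0 - A₀ 1 - A₁ 2 = z₀ 1 + z₁ 2 - y₁ 3 by
        simp only [hA₀, hA₁, Int.reduceSub, Int.reduceAdd, Int.reduceMul]; abel]
      exact sub_mem (add_mem (hz₀₀ _) (hz₁₀ _)) (hy₁ _))
    convert add_mem s1 s2 using 1
    simp only [chain, List.map_cons, List.map_nil, List.sum_cons, List.sum_nil, add_zero,
      h₀.sub, h₀.add, neg_add, Int.reduceAdd, Int.reduceMul]
    ring
  · have s1 := h₁.free (y₀ 0) (hy₀ _)
    have s2 := h₁.mem_one hA₁ (y₀ 0 - A₀ 1) (z₀ 1 - y₀ 2) 1 (sub_mem (hz₀₁ _) (hy₀ _)) (by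
        simp only [hA₀, hA₁, Int.reduceSub, Int.reduceAdd, Int.reduceMul]; abel)
    convert add_mem s1 s2 using 1
    simp only [chain, List.map_cons, List.map_nil, List.sum_cons, List.sum_nil, add_zero,
      h₀.sub, h₀.add, neg_add, Int.reduceAdd, Int.reduceMul]
    ring

/-- Index 0 is the short one. The four terms form two strings for index 0, and one string between
two frozen monomials for index 1. -/
lemma chain_short_B2 {y₀ y₁ z₀ z₁ A₀ A₁ : ℤ → M} {F₀ F₁ : Subring R}
    {Fr₀ Fr₁ : AddSubgroup M}
    (hA₀ : ∀ k, A₀ k = y₀ (k - 1) + y₀ (k + 1) - (y₁ k + z₀ k))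
    (hA₁ : ∀ k, A₁ k = y₁ (k - 2) + y₁ (k + 2) - (y₀ (k - 1) + y₀ (k + 1) + z₁ k))
    (h₀ : StringRing e y₀ (fun k => y₁ k + z₀ k) 1 Fr₀ F₀)
    (h₁ : StringRing e y₁ (fun k => y₀ (k - 1) + y₀ (k + 1) + z₁ k) 2 Fr₁ F₁)
    (hy₁ : ∀ k, y₁ k ∈ Fr₀) (hy₀ : ∀ k, y₀ k ∈ Fr₁) (hz₀₀ : ∀ k, z₀ k ∈ Fr₀)
    (hz₀₁ : ∀ k, z₀ k ∈ Fr₁) (hz₁₀ : ∀ k, z₁ k ∈ Fr₀) (hz₁₁ : ∀ k, z₁ k ∈ Fr₁) :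
    chain e (y₀ 0)
      [[A₀ 1],
        [A₀ 1, A₁ 3],
        [A₀ 1, A₁ 3, A₀ 5]] ∈ F₀ ⊓ F₁ := by
  refine Subring.mem_inf.2 ⟨?_, ?_⟩
  · have t1 := h₀.mem_one hA₀ (y₀ 0) 0 0 (zero_mem _) (by abel)
    have t2 := h₀.mem_one hA₀ (y₀ 0 - A₀ 1 - A₁ 3)
      (z₀ 1 + z₁ 3 - y₁ 5) 4
      (sub_mem (add_mem (hz₀₀ _) (hz₁₀ _)) (hy₁ _))
      (by simp only [hA₀, hA₁, Int.reduceSub, Int.reduceAdd, Int.reduceMul]; abel)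
    convert add_mem t1 t2 using 1
    simp only [chain, List.map_cons, List.map_nil, List.sum_cons, List.sum_nil, add_zero,
      h₀.sub, h₀.add, neg_add, Int.reduceAdd, Int.reduceMul]
    ring
  · have t1 := h₁.free (y₀ 0) (hy₀ _)
    have t2 := h₁.mem_one hA₁ (y₀ 0 - A₀ 1)
      (z₀ 1 - y₀ 2) 1
      (sub_mem (hz₀₁ _) (hy₀ _))
      (by simp only [hA₀, hA₁, Int.reduceSub, Int.reduceAdd, Int.reduceMul]; abel)
    have t3 := h₁.free (y₀ 0 - A₀ 1 - A₁ 3 - A₀ 5) (by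
      rw [show y₀ 0 - A₀ 1 - A₁ 3 - A₀ 5 =
          z₀ 1 + z₀ 5 + z₁ 3 - y₀ 6 by
        simp only [hA₀, hA₁, Int.reduceSub, Int.reduceAdd]; abel]
      exact sub_mem (add_mem (add_mem (hz₀₁ _) (hz₀₁ _)) (hz₁₁ _)) (hy₀ _))
    convert add_mem (add_mem t1 t2) t3 using 1
    simp only [chain, List.map_cons, List.map_nil, List.sum_cons, List.sum_nil, add_zero,
      h₀.sub, h₀.add, neg_add, Int.reduceAdd, Int.reduceMul]
    ring

/-- The five terms form a string of length two between two frozen monomials for index 0, and two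
strings around a frozen monomial for index 1. -/
lemma chain_long_B2 {y₀ y₁ z₀ z₁ A₀ A₁ : ℤ → M} {F₀ F₁ : Subring R}
    {Fr₀ Fr₁ : AddSubgroup M}
    (hA₀ : ∀ k, A₀ k = y₀ (k - 1) + y₀ (k + 1) - (y₁ k + z₀ k))
    (hA₁ : ∀ k, A₁ k = y₁ (k - 2) + y₁ (k + 2) - (y₀ (k - 1) + y₀ (k + 1) + z₁ k))
    (h₀ : StringRing e y₀ (fun k => y₁ k + z₀ k) 1 Fr₀ F₀)
    (h₁ : StringRing e y₁ (fun k => y₀ (k - 1) + y₀ (k + 1) + z₁ k) 2 Fr₁ F₁)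
    (hy₁ : ∀ k, y₁ k ∈ Fr₀) (hy₀ : ∀ k, y₀ k ∈ Fr₁) (hz₀₀ : ∀ k, z₀ k ∈ Fr₀)
    (hz₀₁ : ∀ k, z₀ k ∈ Fr₁) (hz₁₀ : ∀ k, z₁ k ∈ Fr₀) (hz₁₁ : ∀ k, z₁ k ∈ Fr₁) :
    chain e (y₁ 0)
      [[A₁ 2],
        [A₁ 2, A₀ 4],
        [A₁ 2, A₀ 4, A₀ 2],
        [A₁ 2, A₀ 4, A₀ 2, A₁ 4]] ∈ F₀ ⊓ F₁ := by
  refine Subring.mem_inf.2 ⟨?_, ?_⟩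
  · have t1 := h₀.free (y₁ 0) (hy₁ _)
    have t2 := h₀.mem_two hA₀ (y₁ 0 - A₁ 2)
      (z₁ 2 - y₁ 4) 1
      (sub_mem (hz₁₀ _) (hy₁ _))
      (by simp only [hA₀, hA₁, Int.reduceSub, Int.reduceAdd, Int.reduceMul]; abel)
    have t3 := h₀.free (y₁ 0 - A₁ 2 - A₀ 4 - A₀ 2 - A₁ 4) (by
      rw [show y₁ 0 - A₁ 2 - A₀ 4 - A₀ 2 - A₁ 4 =
          z₀ 2 + z₀ 4 + z₁ 2 + z₁ 4 - y₁ 6 by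
        simp only [hA₀, hA₁, Int.reduceSub, Int.reduceAdd]; abel]
      exact sub_mem (add_mem (add_mem (add_mem (hz₀₀ _) (hz₀₀ _)) (hz₁₀ _)) (hz₁₀ _)) (hy₁ _))
    convert add_mem (add_mem t1 t2) t3 using 1
    simp only [chain, List.map_cons, List.map_nil, List.sum_cons, List.sum_nil, add_zero,
      h₀.sub, h₀.add, neg_add, Int.reduceAdd, Int.reduceMul]
    ring
  · have t1 := h₁.mem_one hA₁ (y₁ 0) 0 0 (zero_mem _) (by abel)
    have t2 := h₁.free (y₁ 0 - A₁ 2 - A₀ 4) (by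
      rw [show y₁ 0 - A₁ 2 - A₀ 4 =
          y₀ 1 + z₀ 4 + z₁ 2 - y₀ 5 by
        simp only [hA₀, hA₁, Int.reduceSub, Int.reduceAdd]; abel]
      exact sub_mem (add_mem (add_mem (hy₀ _) (hz₀₁ _)) (hz₁₁ _)) (hy₀ _))
    have t3 := h₁.mem_one hA₁ (y₁ 0 - A₁ 2 - A₀ 4 - A₀ 2)
      (z₀ 2 + z₀ 4 + z₁ 2 - y₀ 3 - y₀ 5) 2
      (sub_mem (sub_mem (add_mem (add_mem (hz₀₁ _) (hz₀₁ _)) (hz₁₁ _)) (hy₀ _)) (hy₀ _))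
      (by simp only [hA₀, hA₁, Int.reduceSub, Int.reduceAdd, Int.reduceMul]; abel)
    convert add_mem (add_mem t1 t2) t3 using 1
    simp only [chain, List.map_cons, List.map_nil, List.sum_cons, List.sum_nil, add_zero,
      h₀.sub, h₀.add, neg_add, Int.reduceAdd, Int.reduceMul]
    ring

/-- The seven terms split as 2 + 3 + 2 for the short index 0 and as 1 + 2 + 1 + 2 + 1 for the long
index 1. -/
lemma chain_short_G2 {y₀ y₁ z₀ z₁ A₀ A₁ : ℤ → M} {F₀ F₁ : Subring R}
    {Fr₀ Fr₁ : AddSubgroup M}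
    (hA₀ : ∀ k, A₀ k = y₀ (k - 1) + y₀ (k + 1) - (y₁ k + z₀ k))
    (hA₁ : ∀ k, A₁ k = y₁ (k - 3) + y₁ (k + 3) - (y₀ (k - 2) + y₀ k + y₀ (k + 2) + z₁ k))
    (h₀ : StringRing e y₀ (fun k => y₁ k + z₀ k) 1 Fr₀ F₀)
    (h₁ : StringRing e y₁ (fun k => y₀ (k - 2) + y₀ k + y₀ (k + 2) + z₁ k) 3 Fr₁ F₁)
    (hy₁ : ∀ k, y₁ k ∈ Fr₀) (hy₀ : ∀ k, y₀ k ∈ Fr₁) (hz₀₀ : ∀ k, z₀ k ∈ Fr₀)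
    (hz₀₁ : ∀ k, z₀ k ∈ Fr₁) (hz₁₀ : ∀ k, z₁ k ∈ Fr₀) (hz₁₁ : ∀ k, z₁ k ∈ Fr₁) :
    chain e (y₀ 0)
      [[A₀ 1],
        [A₀ 1, A₁ 4],
        [A₀ 1, A₁ 4, A₀ 7],
        [A₀ 1, A₁ 4, A₀ 7, A₀ 5],
        [A₀ 1, A₁ 4, A₀ 7, A₀ 5, A₁ 8],
        [A₀ 1, A₁ 4, A₀ 7, A₀ 5, A₁ 8, A₀ 11]] ∈ F₀ ⊓ F₁ := by
  refine Subring.mem_inf.2 ⟨?_, ?_⟩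
  · have t1 := h₀.mem_one hA₀ (y₀ 0) 0 0 (zero_mem _) (by abel)
    have t2 := h₀.mem_two hA₀ (y₀ 0 - A₀ 1 - A₁ 4)
      (z₀ 1 + z₁ 4 - y₁ 7) 4
      (sub_mem (add_mem (hz₀₀ _) (hz₁₀ _)) (hy₁ _))
      (by simp only [hA₀, hA₁, Int.reduceSub, Int.reduceAdd, Int.reduceMul]; abel)
    have t3 := h₀.mem_one hA₀ (y₀ 0 - A₀ 1 - A₁ 4 - A₀ 7 - A₀ 5 - A₁ 8)
      (z₀ 1 + z₀ 5 + z₀ 7 + z₁ 4 + z₁ 8 - y₁ 11) 10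
      (sub_mem (add_mem (add_mem (add_mem (add_mem (hz₀₀ _) (hz₀₀ _)) (hz₀₀ _)) (hz₁₀ _)) (hz₁₀ _))
        (hy₁ _))
      (by simp only [hA₀, hA₁, Int.reduceSub, Int.reduceAdd, Int.reduceMul]; abel)
    convert add_mem (add_mem t1 t2) t3 using 1
    simp only [chain, List.map_cons, List.map_nil, List.sum_cons, List.sum_nil, add_zero,
      h₀.sub, h₀.add, neg_add, Int.reduceAdd, Int.reduceMul]
    ring
  · have t1 := h₁.free (y₀ 0) (hy₀ _)
    have t2 := h₁.mem_one hA₁ (y₀ 0 - A₀ 1)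
      (z₀ 1 - y₀ 2) 1
      (sub_mem (hz₀₁ _) (hy₀ _))
      (by simp only [hA₀, hA₁, Int.reduceSub, Int.reduceAdd, Int.reduceMul]; abel)
    have t3 := h₁.free (y₀ 0 - A₀ 1 - A₁ 4 - A₀ 7) (by
      rw [show y₀ 0 - A₀ 1 - A₁ 4 - A₀ 7 =
          y₀ 4 + z₀ 1 + z₀ 7 + z₁ 4 - y₀ 8 by
        simp only [hA₀, hA₁, Int.reduceSub, Int.reduceAdd]; abel]
      exact sub_mem (add_mem (add_mem (add_mem (hy₀ _) (hz₀₁ _)) (hz₀₁ _)) (hz₁₁ _)) (hy₀ _))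
    have t4 := h₁.mem_one hA₁ (y₀ 0 - A₀ 1 - A₁ 4 - A₀ 7 - A₀ 5)
      (z₀ 1 + z₀ 5 + z₀ 7 + z₁ 4 - y₀ 6 - y₀ 8) 5
      (sub_mem (sub_mem (add_mem (add_mem (add_mem (hz₀₁ _) (hz₀₁ _)) (hz₀₁ _)) (hz₁₁ _)) (hy₀ _))
        (hy₀ _))
      (by simp only [hA₀, hA₁, Int.reduceSub, Int.reduceAdd, Int.reduceMul]; abel)
    have t5 := h₁.free (y₀ 0 - A₀ 1 - A₁ 4 - A₀ 7 - A₀ 5 - A₁ 8 - A₀ 11) (by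
      rw [show y₀ 0 - A₀ 1 - A₁ 4 - A₀ 7 - A₀ 5 - A₁ 8 - A₀ 11 =
          z₀ 1 + z₀ 5 + z₀ 7 + z₀ 11 + z₁ 4 + z₁ 8 - y₀ 12 by
        simp only [hA₀, hA₁, Int.reduceSub, Int.reduceAdd]; abel]
      exact sub_mem (add_mem (add_mem (add_mem (add_mem (add_mem (hz₀₁ _) (hz₀₁ _)) (hz₀₁ _))
          (hz₀₁ _)) (hz₁₁ _)) (hz₁₁ _)) (hy₀ _))
    convert add_mem (add_mem (add_mem (add_mem t1 t2) t3) t4) t5 using 1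
    simp only [chain, List.map_cons, List.map_nil, List.sum_cons, List.sum_nil, add_zero,
      h₀.sub, h₀.add, neg_add, Int.reduceAdd, Int.reduceMul]
    ring

/-- There are fifteen terms, one more than the dimension of the adjoint representation. They split
as 1 + 4 + 4 + 1 + 4 + 1 for index 0 and as 2 + 1 + 2 + 4 + 1 + 2 + 1 + 2 for index 1; unlike in the
other chains, products of two unlinked strings (`mem_pair`) occur. -/
lemma chain_long_G2 {y₀ y₁ z₀ z₁ A₀ A₁ : ℤ → M} {F₀ F₁ : Subring R}
    {Fr₀ Fr₁ : AddSubgroup M}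
    (hA₀ : ∀ k, A₀ k = y₀ (k - 1) + y₀ (k + 1) - (y₁ k + z₀ k))
    (hA₁ : ∀ k, A₁ k = y₁ (k - 3) + y₁ (k + 3) - (y₀ (k - 2) + y₀ k + y₀ (k + 2) + z₁ k))
    (h₀ : StringRing e y₀ (fun k => y₁ k + z₀ k) 1 Fr₀ F₀)
    (h₁ : StringRing e y₁ (fun k => y₀ (k - 2) + y₀ k + y₀ (k + 2) + z₁ k) 3 Fr₁ F₁)
    (hy₁ : ∀ k, y₁ k ∈ Fr₀) (hy₀ : ∀ k, y₀ k ∈ Fr₁) (hz₀₀ : ∀ k, z₀ k ∈ Fr₀)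
    (hz₀₁ : ∀ k, z₀ k ∈ Fr₁) (hz₁₀ : ∀ k, z₁ k ∈ Fr₀) (hz₁₁ : ∀ k, z₁ k ∈ Fr₁) :
    chain e (y₁ 0)
      [[A₁ 3],
        [A₁ 3, A₀ 6],
        [A₁ 3, A₀ 6, A₀ 4],
        [A₁ 3, A₀ 6, A₀ 4, A₀ 2],
        [A₁ 3, A₀ 6, A₀ 4, A₁ 7],
        [A₁ 3, A₀ 6, A₀ 4, A₀ 2, A₁ 5],
        [A₁ 3, A₀ 6, A₀ 4, A₀ 2, A₁ 7],
        [A₁ 3, A₀ 6, A₀ 4, A₁ 7, A₀ 10],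
        [A₁ 3, A₀ 6, A₀ 4, A₀ 2, A₁ 5, A₁ 7],
        [A₁ 3, A₀ 6, A₀ 4, A₀ 2, A₁ 7, A₀ 10],
        [A₁ 3, A₀ 6, A₀ 4, A₀ 2, A₁ 5, A₁ 7, A₀ 10],
        [A₁ 3, A₀ 6, A₀ 4, A₀ 2, A₁ 5, A₁ 7, A₀ 10, A₀ 8],
        [A₁ 3, A₀ 6, A₀ 4, A₀ 2, A₁ 5, A₁ 7, A₀ 10, A₀ 8, A₀ 6],
        [A₁ 3, A₀ 6, A₀ 4, A₀ 2, A₁ 5, A₁ 7, A₀ 10, A₀ 8, A₀ 6, A₁ 9]] ∈ F₀ ⊓ F₁ := by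
  refine Subring.mem_inf.2 ⟨?_, ?_⟩
  · have t1 := h₀.free (y₁ 0) (hy₁ _)
    have t2 := h₀.mem_three hA₀ (y₁ 0 - A₁ 3)
      (z₁ 3 - y₁ 6) 1
      (sub_mem (hz₁₀ _) (hy₁ _))
      (by simp only [hA₀, hA₁, Int.reduceSub, Int.reduceAdd, Int.reduceMul]; abel)
    have t3 := h₀.mem_pair hA₀ (y₁ 0 - A₁ 3 - A₀ 6 - A₀ 4 - A₁ 7)
      (z₀ 4 + z₀ 6 + z₁ 3 + z₁ 7 - y₁ 10) 1 9
      (sub_mem (add_mem (add_mem (add_mem (hz₀₀ _) (hz₀₀ _)) (hz₁₀ _)) (hz₁₀ _)) (hy₁ _))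
      (by simp only [hA₀, hA₁, Int.reduceSub, Int.reduceAdd, Int.reduceMul]; abel)
    have t4 := h₀.free (y₁ 0 - A₁ 3 - A₀ 6 - A₀ 4 - A₀ 2 - A₁ 5) (by
      rw [show y₁ 0 - A₁ 3 - A₀ 6 - A₀ 4 - A₀ 2 - A₁ 5 =
          y₁ 4 + z₀ 2 + z₀ 4 + z₀ 6 + z₁ 3 + z₁ 5 - y₁ 8 by
        simp only [hA₀, hA₁, Int.reduceSub, Int.reduceAdd]; abel]
      exact sub_mem (add_mem (add_mem (add_mem (add_mem (add_mem (hy₁ _) (hz₀₀ _)) (hz₀₀ _))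
          (hz₀₀ _)) (hz₁₀ _)) (hz₁₀ _)) (hy₁ _))
    have t5 := h₀.mem_three hA₀ (y₁ 0 - A₁ 3 - A₀ 6 - A₀ 4 - A₀ 2 - A₁ 5 - A₁ 7)
      (z₀ 2 + z₀ 4 + z₀ 6 + z₁ 3 + z₁ 5 + z₁ 7 - y₁ 8 - y₁ 10) 5
      (sub_mem (sub_mem (add_mem (add_mem (add_mem (add_mem (add_mem (hz₀₀ _) (hz₀₀ _)) (hz₀₀ _))
        (hz₁₀ _)) (hz₁₀ _)) (hz₁₀ _)) (hy₁ _)) (hy₁ _))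
      (by simp only [hA₀, hA₁, Int.reduceSub, Int.reduceAdd, Int.reduceMul]; abel)
    have t6 := h₀.free
        (y₁ 0 - A₁ 3 - A₀ 6 - A₀ 4 - A₀ 2 - A₁ 5 - A₁ 7 - A₀ 10 - A₀ 8 - A₀ 6 - A₁ 9) (by
      rw [show y₁ 0 - A₁ 3 - A₀ 6 - A₀ 4 - A₀ 2 - A₁ 5 - A₁ 7 - A₀ 10 - A₀ 8 - A₀ 6 - A₁ 9 =
          z₀ 2 + z₀ 4 + z₀ 6 + z₀ 6 + z₀ 8 + z₀ 10 + z₁ 3 + z₁ 5 + z₁ 7 + z₁ 9 - y₁ 12 by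
        simp only [hA₀, hA₁, Int.reduceSub, Int.reduceAdd]; abel]
      exact sub_mem (add_mem (add_mem (add_mem (add_mem (add_mem (add_mem (add_mem (add_mem
          (add_mem (hz₀₀ _) (hz₀₀ _)) (hz₀₀ _)) (hz₀₀ _)) (hz₀₀ _)) (hz₀₀ _)) (hz₁₀ _)) (hz₁₀ _))
          (hz₁₀ _)) (hz₁₀ _)) (hy₁ _))
    convert add_mem (add_mem (add_mem (add_mem (add_mem t1 t2) t3) t4) t5) t6 using 1
    simp only [chain, List.map_cons, List.map_nil, List.sum_cons, List.sum_nil, add_zero,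
      h₀.sub, h₀.add, neg_add, Int.reduceAdd, Int.reduceMul]
    ring
  · have t1 := h₁.mem_one hA₁ (y₁ 0) 0 0 (zero_mem _) (by abel)
    have t2 := h₁.free (y₁ 0 - A₁ 3 - A₀ 6) (by
      rw [show y₁ 0 - A₁ 3 - A₀ 6 =
          y₀ 1 + y₀ 3 + z₀ 6 + z₁ 3 - y₀ 7 by
        simp only [hA₀, hA₁, Int.reduceSub, Int.reduceAdd]; abel]
      exact sub_mem (add_mem (add_mem (add_mem (hy₀ _) (hy₀ _)) (hz₀₁ _)) (hz₁₁ _)) (hy₀ _))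
    have t3 := h₁.mem_one hA₁ (y₁ 0 - A₁ 3 - A₀ 6 - A₀ 4)
      (y₀ 1 + z₀ 4 + z₀ 6 + z₁ 3 - y₀ 5 - y₀ 7) 4
      (sub_mem (sub_mem (add_mem (add_mem (add_mem (hy₀ _) (hz₀₁ _)) (hz₀₁ _)) (hz₁₁ _)) (hy₀ _))
        (hy₀ _))
      (by simp only [hA₀, hA₁, Int.reduceSub, Int.reduceAdd, Int.reduceMul]; abel)
    have t4 := h₁.mem_pair hA₁ (y₁ 0 - A₁ 3 - A₀ 6 - A₀ 4 - A₀ 2)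
      (z₀ 2 + z₀ 4 + z₀ 6 + z₁ 3 - y₀ 3 - y₀ 5 - y₀ 7) 2 4
      (sub_mem (sub_mem (sub_mem (add_mem (add_mem (add_mem (hz₀₁ _) (hz₀₁ _)) (hz₀₁ _)) (hz₁₁ _))
        (hy₀ _)) (hy₀ _)) (hy₀ _))
      (by simp only [hA₀, hA₁, Int.reduceSub, Int.reduceAdd, Int.reduceMul]; abel)
    have t5 := h₁.free (y₁ 0 - A₁ 3 - A₀ 6 - A₀ 4 - A₁ 7 - A₀ 10) (by
      rw [show y₁ 0 - A₁ 3 - A₀ 6 - A₀ 4 - A₁ 7 - A₀ 10 =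
          y₀ 1 + z₀ 4 + z₀ 6 + z₀ 10 + z₁ 3 + z₁ 7 - y₀ 11 by
        simp only [hA₀, hA₁, Int.reduceSub, Int.reduceAdd]; abel]
      exact sub_mem (add_mem (add_mem (add_mem (add_mem (add_mem (hy₀ _) (hz₀₁ _)) (hz₀₁ _))
          (hz₀₁ _)) (hz₁₁ _)) (hz₁₁ _)) (hy₀ _))
    have t6 := h₁.mem_one hA₁ (y₁ 0 - A₁ 3 - A₀ 6 - A₀ 4 - A₀ 2 - A₁ 7 - A₀ 10)
      (z₀ 2 + z₀ 4 + z₀ 6 + z₀ 10 + z₁ 3 + z₁ 7 - y₀ 3 - y₀ 11) 2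
      (sub_mem (sub_mem (add_mem (add_mem (add_mem (add_mem (add_mem (hz₀₁ _) (hz₀₁ _)) (hz₀₁ _))
        (hz₀₁ _)) (hz₁₁ _)) (hz₁₁ _)) (hy₀ _)) (hy₀ _))
      (by simp only [hA₀, hA₁, Int.reduceSub, Int.reduceAdd, Int.reduceMul]; abel)
    have t7 := h₁.free (y₁ 0 - A₁ 3 - A₀ 6 - A₀ 4 - A₀ 2 - A₁ 5 - A₁ 7 - A₀ 10 - A₀ 8) (by
      rw [show y₁ 0 - A₁ 3 - A₀ 6 - A₀ 4 - A₀ 2 - A₁ 5 - A₁ 7 - A₀ 10 - A₀ 8 =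
          y₀ 5 + z₀ 2 + z₀ 4 + z₀ 6 + z₀ 8 + z₀ 10 + z₁ 3 + z₁ 5 + z₁ 7 - y₀ 9 - y₀ 11 by
        simp only [hA₀, hA₁, Int.reduceSub, Int.reduceAdd]; abel]
      exact sub_mem (sub_mem (add_mem (add_mem (add_mem (add_mem (add_mem (add_mem (add_mem
          (add_mem (hy₀ _) (hz₀₁ _)) (hz₀₁ _)) (hz₀₁ _)) (hz₀₁ _)) (hz₀₁ _)) (hz₁₁ _)) (hz₁₁ _))
          (hz₁₁ _)) (hy₀ _)) (hy₀ _))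
    have t8 := h₁.mem_one hA₁ (y₁ 0 - A₁ 3 - A₀ 6 - A₀ 4 - A₀ 2 - A₁ 5 - A₁ 7 - A₀ 10 - A₀ 8 - A₀ 6)
      (z₀ 2 + z₀ 4 + z₀ 6 + z₀ 6 + z₀ 8 + z₀ 10 + z₁ 3 + z₁ 5 + z₁ 7 - y₀ 7 - y₀ 9 - y₀ 11) 6
      (sub_mem (sub_mem (sub_mem (add_mem (add_mem (add_mem (add_mem (add_mem (add_mem (add_mem
        (add_mem (hz₀₁ _) (hz₀₁ _)) (hz₀₁ _)) (hz₀₁ _)) (hz₀₁ _)) (hz₀₁ _)) (hz₁₁ _)) (hz₁₁ _))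
        (hz₁₁ _)) (hy₀ _)) (hy₀ _)) (hy₀ _))
      (by simp only [hA₀, hA₁, Int.reduceSub, Int.reduceAdd, Int.reduceMul]; abel)
    convert add_mem (add_mem (add_mem (add_mem (add_mem (add_mem (add_mem t1 t2) t3) t4) t5) t6)
        t7) t8 using 1
    simp only [chain, List.map_cons, List.map_nil, List.sum_cons, List.sum_nil, add_zero,
      h₀.sub, h₀.add, neg_add, Int.reduceAdd, Int.reduceMul]
    ring


end Strings

end CartanDatum
end

noncomputable section

open scoped Classical

namespace CartanDatum

variable {I : Type*} [Fintype I] (D : CartanDatum I) (q : ℂˣ)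

/-! ### The invariants of the operators -/

lemma theta_E_eq (i : I) (m : Mono I) : D.theta q i (D.E m) =
    D.E (D.sigmaM q i m) * ((Additive.toMul (D.sigPart q i m) : D.Omˣ) : D.Om) := by
  rw [theta_E]
  rfl

lemma theta_psi_self (i : I) (a : ℂˣ) : D.theta q i (D.E (psi i a)) =
    D.E (D.psiTilde q i (a * (D.qi q i)⁻¹ ^ 2)) * D.sig q i (a * (D.qi q i)⁻¹ ^ 2) := by
  rw [theta_E_eq, sigmaM_psi_self, sigPart_psi_self, toMul_ofMul, val_sigU]

/-- The monomials that are visibly fixed by the operator attached to `s_i`. -/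
def fixMono (i : I) : AddSubgroup (Mono I) :=
  (D.sigmaM q i).eqLocus (AddMonoidHom.id _) ⊓ (D.sigPart q i).ker

lemma theta_E_of_mem {i : I} {m : Mono I} (h : m ∈ D.fixMono q i) :
    D.theta q i (D.E m) = D.E m := by
  have h1 : D.sigmaM q i m = m := h.1
  have h2 : D.sigPart q i m = 0 := h.2
  rw [theta_E_eq, h1, h2, toMul_zero, Units.val_one, mul_one]

lemma theta_psi_ne {i j : I} (h : j ≠ i) (a : ℂˣ) :
    D.theta q i (D.E (psi j a)) = D.E (psi j a) :=
  D.theta_E_of_mem q ⟨D.sigmaM_psi_ne q h a, D.sigPart_psi_ne q h a⟩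

lemma theta_wtMono (i : I) (x : I → ℤ) :
    D.theta q i (D.E (wtMono x)) = D.E (wtMono (D.refl i x)) := by
  rw [theta_E_eq, sigmaM_wtMono, sigPart_wtMono, toMul_zero, Units.val_one, mul_one]

lemma Y_mem_fixMono {i j : I} (h : j ≠ i) (a : ℂˣ) : D.Y q j a ∈ D.fixMono q i := by
  refine ⟨D.sigmaM_Y_ne q h a, ?_⟩
  show D.sigPart q i (D.Y q j a) = 0
  rw [Y, map_sub, map_add, sigPart_wtMono, sigPart_psi_ne D q h,
    sigPart_psi_ne D q h]
  simp

lemma sigPart_Y_self (i : I) (a : ℂˣ) : D.sigPart q i (D.Y q i a) =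
    Additive.ofMul (D.sigU q i (a * (D.qi q i)⁻¹ ^ 3)) -
      Additive.ofMul (D.sigU q i (a * (D.qi q i)⁻¹)) := by
  rw [Y, map_sub, map_add, sigPart_wtMono, sigPart_psi_self, sigPart_psi_self, zero_add,
    show a * (D.qi q i)⁻¹ * (D.qi q i)⁻¹ ^ 2 = a * (D.qi q i)⁻¹ ^ 3 by group,
    show a * D.qi q i * (D.qi q i)⁻¹ ^ 2 = a * (D.qi q i)⁻¹ by group]

lemma theta_Y_self (i : I) (a : ℂˣ) :
    D.theta q i (D.E (D.Y q i a)) * D.sig q i (a * (D.qi q i)⁻¹) =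
      D.E (D.Y q i a - D.A q i (a * (D.qi q i)⁻¹)) * D.sig q i (a * (D.qi q i)⁻¹ ^ 3) := by
  rw [theta_E_eq, sigmaM_Y_self, sigPart_Y_self, toMul_sub, toMul_ofMul, toMul_ofMul, mul_assoc,
    ← val_sigU D q i (a * (D.qi q i)⁻¹), ← Units.val_mul, div_mul_cancel, val_sigU]

lemma bondY_mem_fixMono {i j l : I} (h : l ≠ i) (a : ℂˣ) : D.bondY q j l a ∈ D.fixMono q i := by
  rw [bondY]
  split_ifs
  · exact D.Y_mem_fixMono q h _
  · exact add_mem (D.Y_mem_fixMono q h _) (D.Y_mem_fixMono q h _)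
  · exact add_mem (add_mem (D.Y_mem_fixMono q h _) (D.Y_mem_fixMono q h _))
      (D.Y_mem_fixMono q h _)
  · exact zero_mem _

lemma sum_bondY_mem_fixMono (i : I) (a : ℂˣ) : ∑ j, D.bondY q i j a ∈ D.fixMono q i := by
  refine sum_mem fun j _ => ?_
  by_cases h : j = i
  · subst h
    rw [bondY_self]
    exact zero_mem _
  · exact D.bondY_mem_fixMono q h a

/-- The invariants of the operator attached to `s_i`. -/
def fixRing (i : I) : Subring D.Om := (D.theta q i).eqLocus (RingHom.id _)

lemma Y_sub_A (i : I) (b : ℂˣ) : D.Y q i b - D.A q i (b * D.qi q i) =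
    ∑ j, D.bondY q i j (b * D.qi q i) - D.Y q i (b * D.qi q i ^ 2) := by
  rw [A_eq, mul_inv_cancel_right, mul_assoc b, ← sq]
  abel

/-- The element `Y_{i,b} + Y_{i,b} A_{i,b q_i}⁻¹` is invariant. -/
lemma string_mem_fixRing (i : I) (b : ℂˣ) :
    D.E (D.Y q i b) + D.E (D.Y q i b - D.A q i (b * D.qi q i)) ∈ D.fixRing q i := by
  show D.theta q i _ = _
  have h1 := D.theta_Y_self q i b
  have h2 : D.theta q i (D.E (D.Y q i b - D.A q i (b * D.qi q i))) *
      D.sig q i (b * (D.qi q i)⁻¹) = D.E (D.Y q i b) * D.sig q i (b * D.qi q i) := by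
    have hN := D.sum_bondY_mem_fixMono q i (b * D.qi q i)
    have e1 : D.sigmaM q i (D.Y q i b - D.A q i (b * D.qi q i)) = D.Y q i b := by
      have : D.sigmaM q i (∑ j, D.bondY q i j (b * D.qi q i)) = _ := hN.1
      rw [Y_sub_A, map_sub, this, sigmaM_Y_self, AddMonoidHom.id_apply, ← sub_add, ← Y_sub_A,
        show b * D.qi q i ^ 2 * (D.qi q i)⁻¹ = b * D.qi q i by group, sub_add_cancel]
    have e2 : D.sigPart q i (D.Y q i b - D.A q i (b * D.qi q i)) =
        Additive.ofMul (D.sigU q i (b * D.qi q i)) -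
          Additive.ofMul (D.sigU q i (b * (D.qi q i)⁻¹)) := by
      have : D.sigPart q i (∑ j, D.bondY q i j (b * D.qi q i)) = 0 := hN.2
      rw [Y_sub_A, map_sub, this, sigPart_Y_self, zero_sub, neg_sub,
        show b * D.qi q i ^ 2 * (D.qi q i)⁻¹ = b * D.qi q i by group,
        show b * D.qi q i ^ 2 * (D.qi q i)⁻¹ ^ 3 = b * (D.qi q i)⁻¹ by group]
    rw [theta_E_eq, e1, e2, toMul_sub, toMul_ofMul, toMul_ofMul, mul_assoc,
      ← val_sigU D q i (b * (D.qi q i)⁻¹), ← Units.val_mul, div_mul_cancel, val_sigU]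
  -- After multiplication by the unit Σ_{i,bq_i⁻¹} the claim follows from the difference equation at
  -- bq_i and at bq_i⁻¹, whose constants 1 cancel.
  have r1 := D.sig_rel q i (b * D.qi q i)
  have r2 := D.sig_rel q i (b * (D.qi q i)⁻¹)
  rw [show b * D.qi q i * (D.qi q i)⁻¹ ^ 2 = b * (D.qi q i)⁻¹ by group] at r1
  rw [show b * (D.qi q i)⁻¹ * (D.qi q i)⁻¹ ^ 2 = b * (D.qi q i)⁻¹ ^ 3 by group] at r2
  have hu : IsUnit (D.sig q i (b * (D.qi q i)⁻¹)) := ⟨D.sigU q i _, val_sigU D q i _⟩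
  refine hu.mul_left_injective ?_
  simp only [map_add, add_mul, RingHom.id_apply]
  rw [h1, h2, E_sub, E_sub, r1]
  linear_combination -D.E (D.Y q i b) * r2

lemma fixMono_le {i : I} {m : Mono I} (h : m ∈ D.fixMono q i) : D.E m ∈ D.fixRing q i :=
  D.theta_E_of_mem q h

/-- The part of the denominator of `A_{i,a}` not involving the index `j`. -/
def restY (i j : I) (a : ℂˣ) : Mono I := ∑ l ∈ Finset.univ.erase j, D.bondY q i l a

lemma bondY_add_restY (i j : I) (a : ℂˣ) :
    D.bondY q i j a + D.restY q i j a = ∑ l, D.bondY q i l a :=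
  Finset.add_sum_erase _ _ (Finset.mem_univ j)

lemma restY_mem_right (i j : I) (a : ℂˣ) : D.restY q i j a ∈ D.fixMono q j :=
  sum_mem fun _ hl => D.bondY_mem_fixMono q (Finset.ne_of_mem_erase hl) a

lemma restY_mem_left (i j : I) (a : ℂˣ) : D.restY q i j a ∈ D.fixMono q i := by
  refine sum_mem fun l _ => ?_
  by_cases h : l = i
  · subst h
    rw [bondY_self]
    exact zero_mem _
  · exact D.bondY_mem_fixMono q h a

lemma A_string (i j : I) (a p : ℂˣ) (d : ℤ) (hd : p ^ d = D.qi q i) (k : ℤ) :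
    D.A q i (a * p ^ k) = D.Y q i (a * p ^ (k - d)) + D.Y q i (a * p ^ (k + d)) -
      (D.bondY q i j (a * p ^ k) + D.restY q i j (a * p ^ k)) := by
  rw [A_eq, bondY_add_restY, zpow_sub, zpow_add, hd, mul_assoc, mul_assoc]

/-- On the lattice a p^ℤ the Y_{i,b} follow the abstract pattern, with the monomials visibly fixed
by the operator as frozen ones. A common p is needed to treat two indices at once: it will be q_i
for a simple bond and q for a multiple bond, where the exponents d are the symmetrizers. -/
lemma stringRing (i j : I) (a p : ℂˣ) (d : ℤ) (hd : p ^ d = D.qi q i) {N : ℤ → Mono I}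
    (hN : ∀ k, D.bondY q i j (a * p ^ k) + D.restY q i j (a * p ^ k) = N k) :
    StringRing D.E (fun k => D.Y q i (a * p ^ k)) N d (D.fixMono q i) (D.fixRing q i) where
  add := E_add
  free f hf := D.fixMono_le q hf
  mem_N k := by
    rw [← hN, bondY_add_restY]
    exact D.sum_bondY_mem_fixMono q i _
  string k := by
    have e := D.A_string q i j a p d hd (k + d)
    rw [hN, add_sub_cancel_right, add_assoc k, ← two_mul] at e
    rw [← e]
    have := D.string_mem_fixRing q i (a * p ^ k)
    rwa [mul_assoc a, ← hd, ← zpow_add] at this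

/-- There is a common invariant of the operators attached to `s_i` and `s_j` that is the sum of
`Y_{t,a}` and of monomials obtained from it by dividing by products of `A_{i,b}` and `A_{j,b}`. -/
def HasInvariant (i j t : I) (a : ℂˣ) : Prop :=
  ∃ L : List (Mono I), (∀ l ∈ L, l ∈ D.monoY q ∧
    ∃ x y : ℕ, 0 < x + y ∧ l.2 = (x : ℤ) • D.root i + (y : ℤ) • D.root j) ∧
    D.E (D.Y q t a) + (L.map fun l => D.E (D.Y q t a - l)).sum ∈ D.fixRing q i ⊓ D.fixRing q j

variable {D q}

lemma HasInvariant.symm {i j t : I} {a : ℂˣ} (h : D.HasInvariant q i j t a) :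
    D.HasInvariant q j i t a := by
  obtain ⟨L, h1, h2⟩ := h
  refine ⟨L, fun l hl => ?_, by rwa [inf_comm]⟩
  obtain ⟨h3, x, y, h4, h5⟩ := h1 l hl
  exact ⟨h3, y, x, by omega, by rw [h5, add_comm]⟩

/-- Each A_{i,b} or A_{j,b} in a list contributes one simple root to the weight, so the coefficients
add up to the length of the list, which is positive. -/
lemma HasInvariant.of_chain {i j t : I} {a : ℂˣ} (L : List (List (Mono I)))
    (hL : ∀ l ∈ L, l ≠ [] ∧ ∀ m ∈ l, m ∈ Set.range (D.A q i) ∪ Set.range (D.A q j))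
    (h : chain D.E (D.Y q t a) L ∈ D.fixRing q i ⊓ D.fixRing q j) :
    D.HasInvariant q i j t a := by
  refine ⟨L.map List.sum, ?_, by rw [List.map_map]; exact h⟩
  intro l hl
  obtain ⟨l, hl', rfl⟩ := List.mem_map.1 hl
  obtain ⟨h1, h2⟩ := hL l hl'
  have key : l.sum ∈ D.monoY q ∧ ∃ x y : ℕ, x + y = l.length ∧
      l.sum.2 = (x : ℤ) • D.root i + (y : ℤ) • D.root j := by
    clear h1 hl hl'
    induction l with
    | nil => exact ⟨zero_mem _, 0, 0, rfl, by simp⟩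
    | cons m l ih =>
      obtain ⟨h3, x, y, h4, h5⟩ := ih fun m hm => h2 m (List.mem_cons_of_mem _ hm)
      obtain ⟨b, rfl⟩ | ⟨b, rfl⟩ := h2 m List.mem_cons_self
      · refine ⟨by rw [List.sum_cons]; exact add_mem (D.A_mem q _ _) h3, x + 1, y,
          by rw [List.length_cons]; omega, ?_⟩
        rw [List.sum_cons, Prod.snd_add, A_snd, h5]
        push_cast
        module
      · refine ⟨by rw [List.sum_cons]; exact add_mem (D.A_mem q _ _) h3, x, y + 1,
          by rw [List.length_cons]; omega, ?_⟩
        rw [List.sum_cons, Prod.snd_add, A_snd, h5]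
        push_cast
        module
  obtain ⟨h3, x, y, h4, h5⟩ := key
  refine ⟨h3, x, y, ?_, h5⟩
  rw [h4]
  exact List.length_pos_iff.2 h1

variable (D q)

lemma hasInvariant_of_ne {i j t : I} (h : t ≠ i) (h' : t ≠ j) (a : ℂˣ) :
    D.HasInvariant q i j t a :=
  ⟨[], by simp, by
    simpa using ⟨D.fixMono_le q (D.Y_mem_fixMono q h a), D.fixMono_le q (D.Y_mem_fixMono q h' a)⟩⟩

/-! ### Common invariants for each type of rank two -/

lemma mem_range_A_left (i j : I) (a : ℂˣ) :
    D.A q i a ∈ Set.range (D.A q i) ∪ Set.range (D.A q j) := Or.inl ⟨a, rfl⟩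

lemma mem_range_A_right (i j : I) (a : ℂˣ) :
    D.A q j a ∈ Set.range (D.A q i) ∪ Set.range (D.A q j) := Or.inr ⟨a, rfl⟩

/-- If the nodes are not joined, A_{i,b} does not involve j, and the string in index i is fixed by
the other operator term by term. -/
lemma hasInvariant_A1A1 {i j : I} (hij : i ≠ j) (c : D.C j i = 0) (a : ℂˣ) :
    D.HasInvariant q i j i a := by
  refine .of_chain [[D.A q i (a * D.qi q i)]] (by simp only [List.forall_mem_cons,
      List.not_mem_nil, false_imp_iff, implies_true, mem_range_A_left, ne_eq, reduceCtorEq,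
      not_false_eq_true, and_self]) ?_
  simp only [chain, List.map_cons, List.map_nil, List.sum_cons, List.sum_nil, add_zero]
  refine ⟨D.string_mem_fixRing q i a, ?_⟩
  rw [Y_sub_A, ← bondY_add_restY D q i j]
  simp only [bondY, c]
  norm_num
  exact add_mem (D.fixMono_le q (D.Y_mem_fixMono q hij a)) (D.fixMono_le q
    (sub_mem (D.restY_mem_right q i j _) (D.Y_mem_fixMono q hij _)))

lemma hasInvariant_A2 {i j : I} (hij : i ≠ j) (c : D.C i j = -1) (c' : D.C j i = -1) (a : ℂˣ) :
    D.HasInvariant q i j i a := by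
  have hd : D.qi q j = D.qi q i := by
    have := D.symm i j
    rw [c, c'] at this
    rw [qi, qi, show D.d j = D.d i by omega]
  have hb : ∀ b, D.bondY q i j b = D.Y q j b := fun b => by simp [bondY, c']
  have hb' : ∀ b, D.bondY q j i b = D.Y q i b := fun b => by simp [bondY, c]
  have h₀ := D.stringRing q i j a (D.qi q i) 1 (zpow_one _) fun k => by rw [hb]
  have h₁ := D.stringRing q j i a (D.qi q i) 1 ((zpow_one _).trans hd.symm) fun k => by rw [hb']
  have := chain_A2 (A₀ := fun k => D.A q i (a * D.qi q i ^ k))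
    (A₁ := fun k => D.A q j (a * D.qi q i ^ k))
    (fun k => by rw [D.A_string q i j a (D.qi q i) 1 (zpow_one _), hb])
    (fun k => by rw [D.A_string q j i a (D.qi q i) 1 ((zpow_one _).trans hd.symm), hb'])
    h₀ h₁ (fun k => D.Y_mem_fixMono q hij.symm _) (fun k => D.Y_mem_fixMono q hij _)
    (fun k => D.restY_mem_left q _ _ _) (fun k => D.restY_mem_right q _ _ _)
    (fun k => D.restY_mem_right q _ _ _)
  simp only [zpow_zero, mul_one] at this
  exact .of_chain _ (by simp only [List.forall_mem_cons, List.not_mem_nil, false_imp_iff,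
      implies_true, mem_range_A_left, mem_range_A_right, ne_eq, reduceCtorEq, not_false_eq_true,
      and_self]) this

lemma hasInvariant_B2 {i j : I} (hij : i ≠ j) (c : D.C i j = -2) (c' : D.C j i = -1) (a : ℂˣ) :
    D.HasInvariant q i j i a ∧ D.HasInvariant q i j j a := by
  have di := D.d_eq_one hij (by omega)
  have dj : D.d j = 2 := by have := D.symm i j; rw [c, c', di] at this; omega
  have hi : q ^ (1 : ℤ) = D.qi q i := by rw [qi, di]; simp
  have hj : q ^ (2 : ℤ) = D.qi q j := by rw [qi, dj]; exact zpow_natCast q _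
  have hb : ∀ b, D.bondY q i j b = D.Y q j b := fun b => by simp [bondY, c']
  have hb' : ∀ k : ℤ, D.bondY q j i (a * q ^ k) =
      D.Y q i (a * q ^ (k - 1)) + D.Y q i (a * q ^ (k + 1)) := fun k => by
    simp [bondY, c, zpow_sub, zpow_add, mul_assoc]
  have h₀ := D.stringRing q i j a q 1 hi fun k => by rw [hb]
  have h₁ := D.stringRing q j i a q 2 hj fun k => by rw [hb']
  have e₀ := D.A_string q i j a q 1 hi
  have e₁ := D.A_string q j i a q 2 hj
  simp only [hb] at e₀
  simp only [hb'] at e₁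
  have m₀ := fun k : ℤ => D.Y_mem_fixMono q hij.symm (a * q ^ k)
  have m₁ := fun k : ℤ => D.Y_mem_fixMono q hij (a * q ^ k)
  have r₀ := fun k : ℤ => D.restY_mem_left q i j (a * q ^ k)
  have r₁ := fun k : ℤ => D.restY_mem_right q i j (a * q ^ k)
  have r₂ := fun k : ℤ => D.restY_mem_right q j i (a * q ^ k)
  have r₃ := fun k : ℤ => D.restY_mem_left q j i (a * q ^ k)
  have t₀ := chain_short_B2 (y₀ := fun k => D.Y q i (a * q ^ k))
    (y₁ := fun k => D.Y q j (a * q ^ k)) (z₀ := fun k => D.restY q i j (a * q ^ k))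
    (z₁ := fun k => D.restY q j i (a * q ^ k)) (A₀ := fun k => D.A q i (a * q ^ k))
    (A₁ := fun k => D.A q j (a * q ^ k)) e₀ e₁ h₀ h₁ m₀ m₁ r₀ r₁ r₂ r₃
  have t₁ := chain_long_B2 (y₀ := fun k => D.Y q i (a * q ^ k))
    (y₁ := fun k => D.Y q j (a * q ^ k)) (z₀ := fun k => D.restY q i j (a * q ^ k))
    (z₁ := fun k => D.restY q j i (a * q ^ k)) (A₀ := fun k => D.A q i (a * q ^ k))
    (A₁ := fun k => D.A q j (a * q ^ k)) e₀ e₁ h₀ h₁ m₀ m₁ r₀ r₁ r₂ r₃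
  simp only [zpow_zero, mul_one] at t₀ t₁
  exact ⟨.of_chain _ (by simp only [List.forall_mem_cons, List.not_mem_nil, false_imp_iff,
      implies_true, mem_range_A_left, mem_range_A_right, ne_eq, reduceCtorEq, not_false_eq_true,
      and_self]) t₀,
    .of_chain _ (by simp only [List.forall_mem_cons, List.not_mem_nil, false_imp_iff, implies_true,
        mem_range_A_left, mem_range_A_right, ne_eq, reduceCtorEq, not_false_eq_true, and_self]) t₁⟩

lemma hasInvariant_G2 {i j : I} (hij : i ≠ j) (c : D.C i j = -3) (c' : D.C j i = -1) (a : ℂˣ) :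
    D.HasInvariant q i j i a ∧ D.HasInvariant q i j j a := by
  have di := D.d_eq_one hij (by omega)
  have dj : D.d j = 3 := by have := D.symm i j; rw [c, c', di] at this; omega
  have hi : q ^ (1 : ℤ) = D.qi q i := by rw [qi, di]; simp
  have hj : q ^ (3 : ℤ) = D.qi q j := by rw [qi, dj]; exact zpow_natCast q _
  have hb : ∀ b, D.bondY q i j b = D.Y q j b := fun b => by simp [bondY, c']
  have hb' : ∀ k : ℤ, D.bondY q j i (a * q ^ k) =
      D.Y q i (a * q ^ (k - 2)) + D.Y q i (a * q ^ k) + D.Y q i (a * q ^ (k + 2)) := fun k => by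
    have e : q ^ (2 : ℤ) = q ^ 2 := zpow_natCast q 2
    simp [e, bondY, c, zpow_sub, zpow_add, mul_assoc]
  have h₀ := D.stringRing q i j a q 1 hi fun k => by rw [hb]
  have h₁ := D.stringRing q j i a q 3 hj fun k => by rw [hb']
  have e₀ := D.A_string q i j a q 1 hi
  have e₁ := D.A_string q j i a q 3 hj
  simp only [hb] at e₀
  simp only [hb'] at e₁
  have m₀ := fun k : ℤ => D.Y_mem_fixMono q hij.symm (a * q ^ k)
  have m₁ := fun k : ℤ => D.Y_mem_fixMono q hij (a * q ^ k)
  have r₀ := fun k : ℤ => D.restY_mem_left q i j (a * q ^ k)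
  have r₁ := fun k : ℤ => D.restY_mem_right q i j (a * q ^ k)
  have r₂ := fun k : ℤ => D.restY_mem_right q j i (a * q ^ k)
  have r₃ := fun k : ℤ => D.restY_mem_left q j i (a * q ^ k)
  have t₀ := chain_short_G2 (y₀ := fun k => D.Y q i (a * q ^ k))
    (y₁ := fun k => D.Y q j (a * q ^ k)) (z₀ := fun k => D.restY q i j (a * q ^ k))
    (z₁ := fun k => D.restY q j i (a * q ^ k)) (A₀ := fun k => D.A q i (a * q ^ k))
    (A₁ := fun k => D.A q j (a * q ^ k)) e₀ e₁ h₀ h₁ m₀ m₁ r₀ r₁ r₂ r₃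
  have t₁ := chain_long_G2 (y₀ := fun k => D.Y q i (a * q ^ k))
    (y₁ := fun k => D.Y q j (a * q ^ k)) (z₀ := fun k => D.restY q i j (a * q ^ k))
    (z₁ := fun k => D.restY q j i (a * q ^ k)) (A₀ := fun k => D.A q i (a * q ^ k))
    (A₁ := fun k => D.A q j (a * q ^ k)) e₀ e₁ h₀ h₁ m₀ m₁ r₀ r₁ r₂ r₃
  simp only [zpow_zero, mul_one] at t₀ t₁
  exact ⟨.of_chain _ (by simp only [List.forall_mem_cons, List.not_mem_nil, false_imp_iff,
      implies_true, mem_range_A_left, mem_range_A_right, ne_eq, reduceCtorEq, not_false_eq_true,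
      and_self]) t₀,
    .of_chain _ (by simp only [List.forall_mem_cons, List.not_mem_nil, false_imp_iff, implies_true,
        mem_range_A_left, mem_range_A_right, ne_eq, reduceCtorEq, not_false_eq_true, and_self]) t₁⟩

/-- Common invariants exist for all pairs of operators. -/
theorem hasInvariant {i j : I} (hij : i ≠ j) (t : I) (a : ℂˣ) : D.HasInvariant q i j t a := by
  by_cases ht : t = i ∨ t = j
  -- For multiple bonds the available invariants have the short root first; the opposite cases are
  -- obtained by exchanging i and j.
  · rcases D.cartan_cases i j hij with c | c | c | c | c | c <;> obtain ⟨c1, c2⟩ := c <;>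
      rcases ht with rfl | rfl
    · exact D.hasInvariant_A1A1 q hij c2 a
    · exact (D.hasInvariant_A1A1 q hij.symm c1 a).symm
    · exact D.hasInvariant_A2 q hij c1 c2 a
    · exact (D.hasInvariant_A2 q hij.symm c2 c1 a).symm
    · exact (D.hasInvariant_B2 q hij.symm c2 c1 a).2.symm
    · exact (D.hasInvariant_B2 q hij.symm c2 c1 a).1.symm
    · exact (D.hasInvariant_B2 q hij c1 c2 a).1
    · exact (D.hasInvariant_B2 q hij c1 c2 a).2
    · exact (D.hasInvariant_G2 q hij.symm c2 c1 a).2.symm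
    · exact (D.hasInvariant_G2 q hij.symm c2 c1 a).1.symm
    · exact (D.hasInvariant_G2 q hij c1 c2 a).1
    · exact (D.hasInvariant_G2 q hij c1 c2 a).2
  · push Not at ht
    exact D.hasInvariant_of_ne q ht.1 ht.2 a

end CartanDatum
end

noncomputable section

open scoped Classical

namespace CartanDatum

variable {I : Type*} [Fintype I] {D : CartanDatum I} {q : ℂˣ}

/-! ### The relations between the operators on `Π` -/

/-- The operator preserves the combinations of monomials in the `Y_{i,a}`, and decreases weights on
them. -/
def Sharp (q : ℂˣ) (u : D.W) (Φ : D.Om →+* D.Om) : Prop :=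
  ∀ x : D.Om, (∀ w m, cf x w m ≠ 0 → m ∈ D.monoY q) → ∀ w n, cf (Φ x) w n ≠ 0 →
    n ∈ D.monoY q ∧ ∃ m, cf x (w * u) m ≠ 0 ∧ D.LeW w n.2 (D.act u m.2)

lemma Sharp.one : Sharp q (1 : D.W) 1 := fun x hx w n hn =>
  ⟨hx w n hn, n, by simpa using hn, by simpa using LeW.refl' D w _⟩

lemma Sharp.mul {u u' : D.W} {Φ Φ' : D.Om →+* D.Om} (h : Sharp q u Φ) (h' : Sharp q u' Φ') :
    Sharp q (u * u') (Φ * Φ') := by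
  intro x hx w n hn
  obtain ⟨h1, m, hm, hle⟩ := h (Φ' x) (fun w m hm => (h' x hx w m hm).1) w n hn
  obtain ⟨-, m', hm', hle'⟩ := h' x hx _ m hm
  refine ⟨h1, m', by rwa [← mul_assoc], hle.trans ?_⟩
  rw [LeW_mul_iff] at hle'
  rwa [map_mul, Module.End.mul_apply]

lemma Sharp.pow {u : D.W} {Φ : D.Om →+* D.Om} (h : Sharp q u Φ) (n : ℕ) :
    Sharp q (u ^ n) (Φ ^ n) := by
  induction n with
  | zero => simpa using Sharp.one
  | succ n ih => rw [pow_succ, pow_succ]; exact ih.mul h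

lemma Good.mul {u u' : D.W} {Φ Φ' : D.Om →+* D.Om} (h : Good u (Φ : D.Om →+ D.Om))
    (h' : Good u' (Φ' : D.Om →+ D.Om)) : Good (u * u') ((Φ * Φ' : D.Om →+* D.Om) : D.Om →+ D.Om) :=
  h.comp h'

lemma Good.one : Good (1 : D.W) ((1 : D.Om →+* D.Om) : D.Om →+ D.Om) := Good.id

lemma Good.pow {u : D.W} {Φ : D.Om →+* D.Om} (h : Good u (Φ : D.Om →+ D.Om)) (n : ℕ) :
    Good (u ^ n) ((Φ ^ n : D.Om →+* D.Om) : D.Om →+ D.Om) := by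
  induction n with
  | zero => simpa using Good.one
  | succ n ih => rw [pow_succ, pow_succ]; exact ih.mul h

variable (D q) in
lemma thetaLead_mem (i : I) {m : Mono I} (hm : m ∈ D.monoY q) (w : D.W) :
    D.thetaLead q i m w ∈ D.monoY q := by
  rw [thetaLead_apply]
  refine add_mem (D.sigmaM_mem q hm) ?_
  split_ifs
  · exact zero_mem _
  · exact D.aPart_mem q i m

variable (D q) in
-- Monomials in the Y_{j,a} have degree 0, so the correction deg_i(m) α_i to the leading weight
-- vanishes and nothing exceeds s_i(wt m).
lemma theta_sharp (i : I) : Sharp q (D.s i) (D.theta q i) := by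
  intro x hx w n hn
  obtain ⟨m, hm, hmn⟩ := D.theta_support q i hn
  have hmY := hx _ _ hm
  have hl := D.thetaLead_mem q i hmY w
  refine ⟨?_, m, hm, ?_⟩
  · have := add_mem ((D.lead_thetaV q i m).mem w n hmn) hl
    rwa [sub_add_cancel] at this
  · have := (D.lead_thetaV q i m).le w n hmn
    rw [thetaLead_snd, D.deg_eq_zero_of_mem q hmY] at this
    rw [act_s]
    simpa using this

/-- An operator that fixes enough elements in unitriangular form is the identity. -/
lemma eq_of_unitriangular (v : D.W) (Φ : D.Om →+* D.Om)
    (hΦ : ∀ m ∈ D.monoY q, ∀ n, cf (Φ (D.E m)) v n ≠ 0 → D.LeW v n.2 m.2)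
    (hgen : D.monoY q ≤ AddSubgroup.closure {M | M ∈ D.monoY q ∧ ∃ L : List (Mono I),
      (∀ n ∈ L, n ∈ D.monoY q ∧ D.LeW v n.2 M.2 ∧ n.2 ≠ M.2) ∧
      Φ (D.E M + (L.map D.E).sum) = D.E M + (L.map D.E).sum})
    {m : Mono I} (hm : m ∈ D.monoY q) (n : Mono I) :
    cf (Φ (D.E m)) v n = cf (D.E m) v n := by
  have hE : ∀ m n, cf (D.E m) v n ≠ 0 → n = m := fun m n h => by
    rw [cf_E] at h
    by_contra hne
    exact h (if_neg hne)
  -- The error Φ(E m) - E m is shown to lie at depth at least d below m, for every d and all m at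
  -- once. A monomial of the error would have finite depth, which is then absurd.
  have key : ∀ d : ℕ, ∀ m ∈ D.monoY q, ∀ n, cf (Φ (D.E m) - D.E m) v n ≠ 0 →
      D.LeW v n.2 m.2 ∧ d ≤ depth v n.2 m.2 := by
    intro d
    induction d with
    | zero =>
      intro m hm n hn
      refine ⟨?_, Nat.zero_le _⟩
      by_cases h : cf (Φ (D.E m)) v n = 0
      · rw [cf_sub, h, zero_sub, neg_ne_zero] at hn
        rw [hE m n hn]
        exact LeW.refl' D v _
      · exact hΦ m hm n h
    | succ d ih =>
      -- The monomials with the improved bound form a group: the errors of m + m' and of -m are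
      -- expressed through those of m and m', with factors that do not raise weights.
      let S : AddSubgroup (Mono I) :=
        { carrier := {m | m ∈ D.monoY q ∧ ∀ n, cf (Φ (D.E m) - D.E m) v n ≠ 0 →
            D.LeW v n.2 m.2 ∧ d + 1 ≤ depth v n.2 m.2}
          zero_mem' := ⟨zero_mem _, fun n hn => by simp [E_zero] at hn⟩
          add_mem' := by
            rintro m m' ⟨h1, h2⟩ ⟨h3, h4⟩
            refine ⟨add_mem h1 h3, fun n hn => ?_⟩
            have e : Φ (D.E (m + m')) - D.E (m + m') =
                (Φ (D.E m) - D.E m) * Φ (D.E m') + D.E m * (Φ (D.E m') - D.E m') := by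
              rw [E_add, map_mul]; ring
            rw [e, cf_add] at hn
            by_cases h : cf ((Φ (D.E m) - D.E m) * Φ (D.E m')) v n = 0
            · rw [h, zero_add] at hn
              obtain ⟨a, b, rfl, ha, hb⟩ := cf_mul_ne hn
              obtain ⟨h5, h6⟩ := h4 b hb
              rw [hE m a ha]
              have := LeW.refl' D v m.2
              refine ⟨this.add h5, ?_⟩
              have := depth_add this h5
              rw [Prod.snd_add, Prod.snd_add]
              omega
            · obtain ⟨a, b, rfl, ha, hb⟩ := cf_mul_ne h
              obtain ⟨h5, h6⟩ := h2 a ha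
              have h7 := hΦ m' h3 b hb
              refine ⟨h5.add h7, ?_⟩
              have := depth_add h5 h7
              rw [Prod.snd_add, Prod.snd_add]
              omega
          neg_mem' := by
            rintro m ⟨h1, h2⟩
            refine ⟨neg_mem h1, fun n hn => ?_⟩
            have e1 := E_mul_neg (D := D) m
            have e2 : Φ (D.E m) * Φ (D.E (-m)) = 1 := by rw [← map_mul, e1, map_one]
            have e : Φ (D.E (-m)) - D.E (-m) =
                -(D.E (-m) * ((Φ (D.E m) - D.E m) * Φ (D.E (-m)))) := by
              linear_combination D.E (-m) * e2 - Φ (D.E (-m)) * e1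
            rw [e, cf_neg, neg_ne_zero] at hn
            obtain ⟨a, b, rfl, ha, hb⟩ := cf_mul_ne hn
            obtain ⟨b, c, rfl, hb, hc⟩ := cf_mul_ne hb
            rw [hE _ a ha]
            obtain ⟨h5, h6⟩ := h2 b hb
            have h7 := hΦ (-m) (neg_mem h1) c hc
            have h8 := LeW.refl' D v (-m).2
            have h9 := h5.add h7
            have h10 := h8.add h9
            have d1 := depth_add h5 h7
            have d2 := depth_add h8 h9
            have d3 := depth_self v (-m).2
            have h11 : (-m).2 + (m.2 + (-m).2) = (-m).2 := by rw [Prod.snd_neg]; abel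
            rw [h11] at h10 d2
            refine ⟨h10, ?_⟩
            rw [Prod.snd_add, Prod.snd_add]
            omega }
      have hS : D.monoY q ≤ S := by
        refine hgen.trans ((AddSubgroup.closure_le S).2 ?_)
        rintro M ⟨hM, L, hL, hfix⟩
        refine ⟨hM, fun n hn => ?_⟩
        -- The error of the generator M is minus the sum of the errors of the n in L. Each of them
        -- has depth at least d below n, and n lies strictly below M, which gains one unit of depth.
        have e : Φ (D.E M) - D.E M + (L.map fun n => Φ (D.E n) - D.E n).sum = 0 := by
          rw [map_add, map_list_sum, List.map_map] at hfix
          have : (L.map fun n => Φ (D.E n) - D.E n).sum =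
              (L.map (Φ ∘ D.E)).sum - (L.map D.E).sum := by
            clear hfix hL
            induction L with
            | nil => simp
            | cons n L ih =>
              simp only [List.map_cons, List.sum_cons, ih, Function.comp_apply]
              ring
          rw [this]
          linear_combination hfix
        have hn' : cf (L.map fun n => Φ (D.E n) - D.E n).sum v n ≠ 0 := by
          intro h
          have := congrArg (fun x => cf x v n) e
          simp only [cf_add, h, add_zero, cf_zero] at this
          exact hn this
        have h1 : ∃ n' ∈ L, cf (Φ (D.E n') - D.E n') v n ≠ 0 := by
          by_contra hcon
          push Not at hcon
          refine hn' ?_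
          have : cf (L.map fun n => Φ (D.E n) - D.E n).sum v n =
              cfHom v n (L.map fun n => Φ (D.E n) - D.E n).sum := rfl
          rw [this, map_list_sum, List.map_map]
          refine List.sum_eq_zero fun z hz => ?_
          obtain ⟨n', h2, rfl⟩ := List.mem_map.1 hz
          exact hcon n' h2
        obtain ⟨n', h2, h3⟩ := h1
        obtain ⟨h4, h5, h6⟩ := hL n' h2
        obtain ⟨h7, h8⟩ := ih n' h4 n h3
        refine ⟨h7.trans h5, ?_⟩
        have := depth_pos h5 h6
        rw [depth_trans h7 h5]
        omega
      exact fun m hm => (hS hm).2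
  by_contra hne
  have h := key (depth v n.2 m.2 + 1) m hm n (by rw [cf_sub]; omega)
  omega

lemma leW_sub_of_qPos {v : D.W} {x y : I → ℤ} (h : D.QPos (D.act v y)) : D.LeW v (x - y) x := by
  rwa [LeW, sub_sub_cancel]

/-- The operators are involutive on monomials in the `Y_{i,a}`. -/
lemma theta_theta_E (i : I) {m : Mono I} (hm : m ∈ D.monoY q) :
    D.theta q i (D.theta q i (D.E m)) = D.E m := by
  refine cf_ext fun v n => ?_
  have hs : Sharp q (1 : D.W) (D.theta q i * D.theta q i) := by
    have := (theta_sharp D q i).mul (theta_sharp D q i)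
    rwa [show D.s i * D.s i = 1 by simpa using D.s_mul_s_cancel 1 i] at this
  refine eq_of_unitriangular v (D.theta q i * D.theta q i) (fun m hm n hn => ?_) ?_ hm n
  · obtain ⟨-, m', h1, h2⟩ := hs (D.E m) (fun w n hn => by
      rw [cf_E] at hn
      by_contra h
      exact hn (if_neg (by rintro rfl; exact h hm))) v n hn
    rw [cf_E] at h1
    obtain rfl : m' = m := by by_contra h; exact h1 (if_neg h)
    simpa using h2
  · have hfree : ∀ j a, j ≠ i → (D.theta q i * D.theta q i) (D.E (D.Y q j a)) = D.E
      (D.Y q j a) := by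
      intro j a h
      have := D.theta_E_of_mem q (D.Y_mem_fixMono q h a)
      show D.theta q i (D.theta q i _) = _
      rw [this, this]
    have hX : ∀ b, (D.theta q i * D.theta q i)
        (D.E (D.Y q i b) + D.E (D.Y q i b - D.A q i (b * D.qi q i))) =
        D.E (D.Y q i b) + D.E (D.Y q i b - D.A q i (b * D.qi q i)) := by
      intro b
      have : D.theta q i _ = _ := D.string_mem_fixRing q i b
      show D.theta q i (D.theta q i _) = _
      rw [this]
      exact this
    have hne : ∀ b, (D.Y q i b - D.A q i b).2 ≠ (D.Y q i b).2 := by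
      intro b h
      rw [Prod.snd_sub, A_snd, sub_eq_self] at h
      have := congrFun h i
      rw [root_self] at this
      norm_num at this
    have hYA : ∀ b, D.Y q i b - D.A q i (b * D.qi q i) ∈ D.monoY q :=
      fun b => sub_mem (D.Y_mem q _ _) (D.A_mem q _ _)
    set G := {M | M ∈ D.monoY q ∧ ∃ L : List (Mono I),
      (∀ n ∈ L, n ∈ D.monoY q ∧ D.LeW v n.2 M.2 ∧ n.2 ≠ M.2) ∧
      (D.theta q i * D.theta q i) (D.E M + (L.map D.E).sum) = D.E M + (L.map D.E).sum} with hG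
    have hGne : ∀ j a, j ≠ i → D.Y q j a ∈ AddSubgroup.closure G := fun j a h =>
      AddSubgroup.subset_closure ⟨D.Y_mem q _ _, [], by simp, by simpa using hfree j a h⟩
    refine D.monoY_le q fun j a => ?_
    by_cases hj : j = i
    · subst hj
      -- The leading term of the invariant Y + Y A⁻¹ for the ordering attached to v is Y if v α_j is
      -- positive, and Y A⁻¹ otherwise.
      by_cases hv : D.Up v j
      · refine AddSubgroup.subset_closure ⟨D.Y_mem q _ _, [D.Y q j a - D.A q j
          (a * D.qi q j)], ?_, ?_⟩
        · simp only [List.mem_singleton, forall_eq]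
          refine ⟨hYA a, ?_, ?_⟩
          · rw [Prod.snd_sub, A_snd]
            exact leW_sub_of_qPos (D.act_root_pos v j hv)
          · simpa using hne a
        · simpa using hX a
      · have h1 : ∀ b, D.Y q j b - D.A q j (b * D.qi q j) ∈ AddSubgroup.closure G := by
          intro b
          refine AddSubgroup.subset_closure ⟨hYA b, [D.Y q j b], ?_, ?_⟩
          · simp only [List.mem_singleton, forall_eq]
            refine ⟨D.Y_mem q _ _, ?_, ?_⟩
            · rw [Prod.snd_sub, A_snd, LeW, sub_sub_cancel_left, map_neg]
              exact D.act_root_neg v j ((D.not_up_iff v j).1 hv)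
            · simpa using (hne b).symm
          · have := hX b
            rw [add_comm] at this
            simpa using this
        -- For b = a q_j⁻² the monomial Y_{j,b} A_{j,bq_j}⁻¹ is a product of Y_{l,c} with l ≠ j
        -- divided by Y_{j,a}; this recovers Y_{j,a}.
        have h2 := h1 (a * (D.qi q j)⁻¹ ^ 2)
        rw [Y_sub_A, show a * (D.qi q j)⁻¹ ^ 2 * D.qi q j ^ 2 = a by group] at h2
        have h3 : ∑ l, D.bondY q j l (a * (D.qi q j)⁻¹ ^ 2 * D.qi q j) ∈ AddSubgroup.closure G := by
          refine sum_mem fun l _ => ?_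
          by_cases hl : l = j
          · subst hl
            rw [bondY_self]
            exact zero_mem _
          · rw [bondY]
            split_ifs
            · exact hGne _ _ hl
            · exact add_mem (hGne _ _ hl) (hGne _ _ hl)
            · exact add_mem (add_mem (hGne _ _ hl) (hGne _ _ hl)) (hGne _ _ hl)
            · exact zero_mem _
        have := sub_mem h3 h2
        rwa [sub_sub_cancel] at this
    · exact hGne j a hj

/-- The relation between two operators, on the components attached to the minimal representatives
of the cosets of a parabolic subgroup of rank two. -/
lemma theta_braid_E {i j : I} (hij : i ≠ j) {v : D.W} (hi : D.Up v i) (hj : D.Up v j)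
    {m : Mono I} (hm : m ∈ D.monoY q) (n : Mono I) :
    cf (((D.theta q i * D.theta q j) ^ D.cox i j) (D.E m)) v n = cf (D.E m) v n := by
  have hs : Sharp q (1 : D.W) ((D.theta q i * D.theta q j) ^ D.cox i j) := by
    have := ((theta_sharp D q i).mul (theta_sharp D q j)).pow (D.cox i j)
    rwa [show (D.s i * D.s j) ^ D.cox i j = 1 from
      D.cox.toCoxeterSystem.simple_mul_simple_pow i j] at this
  refine eq_of_unitriangular v _ (fun m hm n hn => ?_) ?_ hm n
  · obtain ⟨-, m', h1, h2⟩ := hs (D.E m) (fun w n hn => by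
      rw [cf_E] at hn
      by_contra h
      exact hn (if_neg (by rintro rfl; exact h hm))) v n hn
    rw [cf_E] at h1
    obtain rfl : m' = m := by by_contra h; exact h1 (if_neg h)
    simpa using h2
  · refine D.monoY_le q fun t a => AddSubgroup.subset_closure ⟨D.Y_mem q _ _, ?_⟩
    -- Both v α_i and v α_j are positive, so every further monomial of the common invariant lies
    -- strictly below Y_{t,a}.
    obtain ⟨L, hL, hfix⟩ := D.hasInvariant q hij t a
    refine ⟨L.map fun l => D.Y q t a - l, ?_, ?_⟩
    · intro n hn
      obtain ⟨l, hl, rfl⟩ := List.mem_map.1 hn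
      obtain ⟨h1, x, y, h2, h3⟩ := hL l hl
      refine ⟨sub_mem (D.Y_mem q _ _) h1, ?_, fun h => ?_⟩
      · rw [Prod.snd_sub]
        refine leW_sub_of_qPos ?_
        rw [h3, map_add, map_smul, map_smul]
        exact ((D.act_root_pos v i hi).smul (by omega)).add
          ((D.act_root_pos v j hj).smul (by omega))
      · rw [Prod.snd_sub, sub_eq_self, h3] at h
        have h0 : ∑ k, (Pi.single i (x : ℤ) + Pi.single j (y : ℤ) : I → ℤ) k • D.root k = 0 := by
          simp only [Pi.add_apply, add_smul, Finset.sum_add_distrib, Pi.single_apply, ite_smul,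
            zero_smul, Finset.sum_ite_eq', Finset.mem_univ, if_true]
          exact h
        have h4 := D.root_indep _ h0
        have h5 := congrFun h4 i
        have h6 := congrFun h4 j
        simp [hij, hij.symm] at h5 h6
        omega
    · rw [List.map_map]
      set X := D.E (D.Y q t a) + (L.map fun l => D.E (D.Y q t a - l)).sum
      have h1 : D.theta q i X = X := hfix.1
      have h2 : D.theta q j X = X := hfix.2
      show ((D.theta q i * D.theta q j) ^ D.cox i j) X = X
      have h3 : (D.theta q i * D.theta q j) X = X := by
        show D.theta q i (D.theta q j X) = X
        rw [h2, h1]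
      generalize D.cox i j = N
      induction N with
      | zero => rfl
      | succ N ih => 
        rw [pow_succ]
        show ((D.theta q i * D.theta q j) ^ N) ((D.theta q i * D.theta q j) X) = X
        rw [h3, ih]

end CartanDatum
end

noncomputable section

open scoped Classical

namespace CartanDatum

variable {I : Type*} [Fintype I] {D : CartanDatum I} {q : ℂˣ}

/-! ### Restriction of operators to subrings -/

lemma Good.congr_on {u : D.W} {Φ Φ' : D.Om →+ D.Om} (h : Good u Φ) (h' : Good u Φ') (x : D.Om)
    (w : D.W) (n : Mono I)
    (e : ∀ m, cf x (w * u) m ≠ 0 → cf (Φ (D.E m)) w n = cf (Φ' (D.E m)) w n) :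
    cf (Φ x) w n = cf (Φ' x) w n := by
  rw [(h.formula x w n).2, (h'.formula x w n).2]
  refine finsum_congr fun m => ?_
  by_cases hm : cf x (w * u) m = 0
  · rw [hm, zero_mul, zero_mul]
  · rw [e m hm]

section Restrict

variable {R : ∀ w, Subring (D.Series w)} (hR : ∀ w, R w ≤ D.big w)

/-- The embedding of the product of the subrings `R w` into the ambient ring. -/
def toOm : (∀ w, R w) →+* D.Om :=
  RingHom.pi fun w => (Subring.inclusion (hR w)).comp (Pi.evalRingHom _ w)

lemma toOm_injective : Function.Injective (toOm hR) := by
  intro x y h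
  funext w
  exact Subtype.ext (congrArg (fun z : D.Om => (z w : D.Series w)) h)

variable (R) in
/-- The operator preserves the product of the subrings `R w`. -/
def Stable (Φ : D.Om →+* D.Om) : Prop :=
  ∀ x : D.Om, (∀ w, (x w : D.Series w) ∈ R w) → ∀ w, (Φ x w : D.Series w) ∈ R w

/-- The restriction of an operator to the product of the subrings `R w`. -/
def restrict (Φ : D.Om →+* D.Om) (h : Stable R Φ) : (∀ w, R w) →+* ∀ w, R w where
  toFun x w := ⟨Φ (toOm hR x) w, h _ (fun w => (x w).2) w⟩
  map_one' := by
    funext w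
    refine Subtype.ext ?_
    show (Φ (toOm hR 1) w : D.Series w) = 1
    rw [map_one, map_one]
    rfl
  map_zero' := by
    funext w
    refine Subtype.ext ?_
    show (Φ (toOm hR 0) w : D.Series w) = 0
    rw [map_zero, map_zero]
    rfl
  map_mul' x y := by
    funext w
    refine Subtype.ext ?_
    show (Φ (toOm hR (x * y)) w : D.Series w) = Φ (toOm hR x) w * Φ (toOm hR y) w
    rw [map_mul, map_mul]
    rfl
  map_add' x y := by
    funext w
    refine Subtype.ext ?_
    show (Φ (toOm hR (x + y)) w : D.Series w) = Φ (toOm hR x) w + Φ (toOm hR y) w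
    rw [map_add, map_add]
    rfl

lemma cf_toOm (x : ∀ w, R w) (w : D.W) (m : Mono I) : cf (toOm hR x) w m = D.coef w (x w) m := rfl

variable {T : Type*} {κ : T → Mono I} (hκ : ∀ w t, D.mono w (κ t) ∈ R w)

lemma toOm_diagMono (t : T) : toOm hR (D.diagMono hκ t) = D.E (κ t) := rfl

/-- The sum over all monomials is reindexed by κ. This needs κ injective, so that no monomial is
counted twice, and supports inside its range. For the monomials in the Y_{i,a} injectivity rests on
q not being a root of unity. -/
lemma isContinuousAt_restrict (hinj : Function.Injective κ)
    (hsupp : ∀ (x : ∀ w, R w) w m, cf (toOm hR x) w m ≠ 0 → m ∈ Set.range κ) {i : I}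
    {Φ : D.Om →+* D.Om} (hgood : Good (D.s i) (Φ : D.Om →+ D.Om)) (h : Stable R Φ) :
    D.IsContinuousAt hκ i (restrict hR Φ h) := by
  intro v x n
  obtain ⟨h1, h2⟩ := hgood.formula (toOm hR x) (v * D.s i) n
  rw [D.s_mul_s_cancel] at h1 h2
  refine ⟨(h1.preimage hinj.injOn).subset fun t ht => ht, ?_⟩
  refine Eq.trans h2 ?_
  show _ = ∑ᶠ t, cf (toOm hR x) v (κ t) * cf (Φ (D.E (κ t))) (v * D.s i) n
  rw [← finsum_mem_range (f := fun m => cf (toOm hR x) v m * cf (Φ (D.E m)) (v * D.s i) n) hinj]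
  rw [← finsum_mem_univ]
  refine finsum_mem_inter_support_eq _ _ _ (Set.ext fun m => ⟨fun hm => ⟨?_, hm.2⟩,
    fun hm => ⟨Set.mem_univ _, hm.2⟩⟩)
  refine hsupp x v m fun h => hm.2 ?_
  simp only [h, zero_mul]

lemma IsContinuousAt.ext {i : I} {F F' : (∀ w, R w) →+* (∀ w, R w)}
    (h : D.IsContinuousAt hκ i F) (h' : D.IsContinuousAt hκ i F')
    (e : ∀ t, F (D.diagMono hκ t) = F' (D.diagMono hκ t)) : F = F' := by
  refine RingHom.ext fun x => funext fun w => Subtype.ext (HahnSeries.ext (funext fun n => ?_))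
  have key : ∀ v, D.coef (v * D.s i) (F x (v * D.s i)) n = D.coef (v * D.s i) (F' x (v * D.s i))
      n := by
    intro v
    rw [(h v x n).2, (h' v x n).2]
    simp only [e]
  obtain ⟨v, rfl⟩ : ∃ v, w = v * D.s i := ⟨w * D.s i, (D.s_mul_s_cancel w i).symm⟩
  exact key v

end Restrict

variable (D q)

lemma complY_le_big (w : D.W) : D.complY q w ≤ D.big w := by
  rintro x ⟨h1, h2⟩
  refine ⟨h1, (Set.finite_singleton (0 : I → ℤ)).subset ?_⟩
  rintro _ ⟨m, hm, rfl⟩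
  exact D.deg_eq_zero_of_mem q (h2 m hm)

variable {D} in
lemma mem_complY_iff (x : D.Om) : (∀ w, (x w : D.Series w) ∈ D.complY q w) ↔
    ∀ w m, cf x w m ≠ 0 → m ∈ D.monoY q :=
  ⟨fun h w m hm => (h w).2 ((D.toMono w).symm m) hm, fun h w => ⟨(x w).2.1, fun _ hm => h w _ hm⟩⟩

lemma theta_stable_complY (i : I) : Stable (D.complY q) (D.theta q i) := by
  intro x hx
  rw [mem_complY_iff] at hx ⊢
  exact fun w n hn => (theta_sharp D q i x hx w n hn).1

/-- The operator `Θ_i` on `Π`. -/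
def thetaY (i : I) : (∀ w, D.complY q w) →+* ∀ w, D.complY q w :=
  restrict (D.complY_le_big q) (D.theta q i) (D.theta_stable_complY q i)

lemma s_mul_s (i : I) : D.s i * D.s i = 1 := by simpa using D.s_mul_s_cancel 1 i

lemma thetaY_thetaY (i : I) (x : ∀ w, D.complY q w) : D.thetaY q i (D.thetaY q i x) = x := by
  refine toOm_injective (D.complY_le_big q) (cf_ext fun w n => ?_)
  have hx := (mem_complY_iff q (toOm (D.complY_le_big q) x)).1 fun w => (x w).2
  have h := (D.theta_good q i).mul (D.theta_good q i)
  rw [s_mul_s] at h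
  refine h.congr_on Good.one _ w n fun m hm => ?_
  exact congrArg (fun z => cf z w n) (theta_theta_E i (hx _ m hm))

/-- The automorphism `Θ_i` of `Π`. -/
def autY (i : I) : RingAut (∀ w, D.complY q w) :=
  RingEquiv.ofRingHom (D.thetaY q i) (D.thetaY q i)
    (RingHom.ext (D.thetaY_thetaY q i)) (RingHom.ext (D.thetaY_thetaY q i))

lemma autY_mul_self (i : I) : D.autY q i * D.autY q i = 1 :=
  RingEquiv.ext (D.thetaY_thetaY q i)

lemma autY_congr (i : I) {x y : ∀ w, D.complY q w} {v : D.W} (h : x (v * D.s i) = y (v * D.s i)) :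
    D.autY q i x v = D.autY q i y v := by
  refine Subtype.ext (HahnSeries.ext (funext fun n => ?_))
  refine (D.theta_good q i).component_congr (x := toOm (D.complY_le_big q) x)
    (y := toOm (D.complY_le_big q) y) (w := v) (fun m => ?_) (D.toMono v n)
  rw [cf_toOm, cf_toOm, h]

lemma _root_.mul_pow_of_mul_self_eq_one {G : Type*} [Monoid G] {g : G} (hg : g * g = 1) (h : G)
    (n : ℕ) : (g * h) ^ n = g * (h * g) ^ n * g := by
  induction n with
  | zero => rw [pow_zero, pow_zero, mul_one, hg]
  | succ n ih =>
    rw [pow_succ, ih, pow_succ]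
    simp only [mul_assoc]
    rw [← mul_assoc g g, hg, one_mul, mul_one]

/-- If s_i or s_j is a right descent of v, conjugation by the corresponding involution carries the
claim to the shorter element v s_i or v s_j. What remains is the case of v minimal in its coset,
where the common invariants apply. -/
lemma autY_pow_apply {i j : I} (hij : i ≠ j) (v : D.W) (x : ∀ w, D.complY q w) :
    ((D.autY q i * D.autY q j) ^ D.cox i j) x v = x v := by
  induction hn : D.len v using Nat.strong_induction_on generalizing v i j x with
  | _ n ih =>
  have hconj : ∀ i j : I, (D.autY q i * D.autY q j) ^ D.cox i j =
      D.autY q i * (D.autY q j * D.autY q i) ^ D.cox j i * D.autY q i := fun i j => by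
    rw [D.cox.symmetric j i]
    exact mul_pow_of_mul_self_eq_one (D.autY_mul_self q i) _ _
  have hconj' : ∀ i j : I, (D.autY q i * D.autY q j) ^ D.cox i j =
      D.autY q j * (D.autY q j * D.autY q i) ^ D.cox j i * D.autY q j := fun i j => by
    rw [hconj j i]
    have h := D.autY_mul_self q j
    rw [mul_assoc, mul_assoc _ _ (D.autY q j), h, mul_one, ← mul_assoc, h, one_mul]
  by_cases hi : D.Up v i
  · by_cases hj : D.Up v j
    · refine Subtype.ext (HahnSeries.ext (funext fun n => ?_))
      have key : ∀ N : ℕ, toOm (D.complY_le_big q) (((D.autY q i * D.autY q j) ^ N) x) =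
          ((D.theta q i * D.theta q j) ^ N) (toOm (D.complY_le_big q) x) := by
        intro N
        induction N with
        | zero => rfl
        | succ N ih =>
          rw [pow_succ', pow_succ']
          exact congrArg (fun z => D.theta q i (D.theta q j z)) ih
      have hx := (mem_complY_iff q (toOm (D.complY_le_big q) x)).1 fun w => (x w).2
      have h := ((D.theta_good q i).mul (D.theta_good q j)).pow (D.cox i j)
      rw [show (D.s i * D.s j) ^ D.cox i j = 1 from
        D.cox.toCoxeterSystem.simple_mul_simple_pow i j] at h
      have e := h.congr_on Good.one (toOm (D.complY_le_big q) x) v (D.toMono v n)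
        fun m hm => theta_braid_E hij hi hj (hx _ m hm) _
      have e' := congrArg (fun z => cf z v (D.toMono v n)) (key (D.cox i j))
      exact e'.trans e
    · have hl := (D.not_up_iff v j).1 hj
      rw [hconj']
      have := ih (D.len (v * D.s j)) (hn ▸ hl) hij.symm (v * D.s j) (D.autY q j x) rfl
      show D.autY q j (((D.autY q j * D.autY q i) ^ D.cox j i) (D.autY q j x)) v = x v
      rw [D.autY_congr q j this]
      exact congrFun (D.thetaY_thetaY q j x) v
  · have hl := (D.not_up_iff v i).1 hi
    rw [hconj]
    have := ih (D.len (v * D.s i)) (hn ▸ hl) hij.symm (v * D.s i) (D.autY q i x) rfl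
    show D.autY q i (((D.autY q j * D.autY q i) ^ D.cox j i) (D.autY q i x)) v = x v
    rw [D.autY_congr q i this]
    exact congrFun (D.thetaY_thetaY q i x) v

lemma autY_liftable : D.cox.IsLiftable (D.autY q) := by
  intro i j
  by_cases hij : i = j
  · subst hij
    rw [D.cox.diagonal, pow_one, autY_mul_self]
  · exact RingEquiv.ext fun x => funext fun v => D.autY_pow_apply q hij v x

/-- The action of the Weyl group on `Π`. -/
def weylAction : D.W →* RingAut (∀ w, D.complY q w) :=
  D.cox.toCoxeterSystem.lift ⟨D.autY q, D.autY_liftable q⟩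

lemma weylAction_s (i : I) : D.weylAction q (D.s i) = D.autY q i :=
  D.cox.toCoxeterSystem.lift_apply_simple (D.autY_liftable q) i

end CartanDatum
end

noncomputable section

open scoped Classical

namespace CartanDatum

variable {I : Type*} [Fintype I] (D : CartanDatum I) (q : ℂˣ)

/-! ### Shifts of the spectral parameter -/

variable {D} in
lemma ringHom_ext_E {S : Type*} [CommRing S] {f g : D.Om →+* S}
    (h1 : ∀ i a, f (D.E (psi i a)) = g (D.E (psi i a)))
    (h2 : ∀ x, f (D.E (wtMono x)) = g (D.E (wtMono x))) (m : Mono I) : f (D.E m) = g (D.E m) := by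
  let H : AddSubgroup (Mono I) :=
    { carrier := {m | f (D.E m) = g (D.E m)}
      zero_mem' := by simp [E_zero]
      add_mem' := by
        intro m n hm hn
        simp only [Set.mem_ofPred_eq] at hm hn ⊢
        rw [E_add, map_mul, map_mul, hm, hn]
      neg_mem' := by
        intro m hm
        simp only [Set.mem_ofPred_eq] at hm ⊢
        have hf : f (D.E m) * f (D.E (-m)) = 1 := by rw [← map_mul, E_mul_neg, map_one]
        have hg : g (D.E m) * g (D.E (-m)) = 1 := by rw [← map_mul, E_mul_neg, map_one]
        rw [hm] at hf
        calc f (D.E (-m)) = (g (D.E m) * g (D.E (-m))) * f (D.E (-m)) := by rw [hg, one_mul]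
          _ = g (D.E (-m)) * (g (D.E m) * f (D.E (-m))) := by ring
          _ = g (D.E (-m)) := by rw [hf, mul_one] }
  exact mem_of_generators (S := H) h1 h2 m

variable {D} in
lemma cf_E_ne_zero {m n : Mono I} {w : D.W} (h : cf (D.E m) w n ≠ 0) : n = m := by
  rw [cf_E] at h
  by_contra hne
  exact h (if_neg hne)

lemma exists_shift (b : ℂˣ) : ∃ Φ : D.Om →+* D.Om, (∀ m, Φ (D.E m) = D.E (shiftM b m)) ∧
    Good (1 : D.W) (Φ : D.Om →+ D.Om) := by
  obtain ⟨Φ, h1, h2, -⟩ := exists_extension (1 : D.W) (fun m => D.E (shiftM b m)) (by simp [E_zero])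
    (fun m n => by rw [map_add, E_add]) (fun _ l => {(0, l)}) (fun _ _ => Set.finite_singleton _)
    (fun w m n h => by
      obtain rfl := cf_E_ne_zero h
      exact ⟨_, rfl, by simp, by simpa using LeW.refl' D w _⟩)
  exact ⟨Φ, h1, h2⟩

/-- The operator `Ψ_{i,a} ↦ Ψ_{i,ab}`. -/
def shift (b : ℂˣ) : D.Om →+* D.Om := (D.exists_shift b).choose

lemma shift_E (b : ℂˣ) (m : Mono I) : D.shift b (D.E m) = D.E (shiftM b m) :=
  (D.exists_shift b).choose_spec.1 m

lemma shift_good (b : ℂˣ) : Good (1 : D.W) (D.shift b : D.Om →+ D.Om) :=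
  (D.exists_shift b).choose_spec.2

lemma shiftM_injective {I : Type*} (b : ℂˣ) : Function.Injective (shiftM b : Mono I → Mono I) := by
  intro m n h
  have := congrArg (shiftM b⁻¹) h
  rwa [shiftM_shiftM, shiftM_shiftM, mul_inv_cancel, shiftM_one, shiftM_one] at this

variable {D} in
lemma cf_shift (b : ℂˣ) (x : D.Om) (w : D.W) (n : Mono I) :
    cf (D.shift b x) w (shiftM b n) = cf x w n := by
  refine ((D.shift_good b).formula x w (shiftM b n)).2.trans ?_
  rw [finsum_eq_single _ n]
  · show cf x (w * 1) n * cf (D.shift b (D.E n)) w (shiftM b n) = _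
    rw [shift_E, cf_E, if_pos rfl, mul_one, mul_one]
  · intro m hm
    show cf x (w * 1) m * cf (D.shift b (D.E m)) w (shiftM b n) = _
    rw [shift_E, cf_E, if_neg, mul_zero]
    exact fun h => hm (shiftM_injective b h).symm

lemma shiftM_termE (b : ℂˣ) (i : I) (a : ℂˣ) (k : ℕ) :
    shiftM b (D.termE q i a k) = D.termE q i (a * b) k := by
  simp [termE, mul_right_comm]

lemma shiftM_termS (b : ℂˣ) (i : I) (a : ℂˣ) (k : ℕ) :
    shiftM b (D.termS q i a k) = D.termS q i (a * b) k := by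
  simp [termS, mul_right_comm]

lemma shift_sig (b : ℂˣ) (i : I) (a : ℂˣ) : D.shift b (D.sig q i a) = D.sig q i (a * b) := by
  refine cf_ext fun w n => ?_
  obtain ⟨n, rfl⟩ : ∃ n', n = shiftM b n' :=
    ⟨shiftM b⁻¹ n, by rw [shiftM_shiftM, inv_mul_cancel, shiftM_one]⟩
  rw [cf_shift, cf_sig, cf_sig]
  by_cases h : D.Up w i
  · rw [sigmaCoef_of_up D q h, sigmaCoef_of_up D q h]
    simp only [← shiftM_termE, (shiftM_injective b).eq_iff]
  · rw [sigmaCoef_of_not_up D q h, sigmaCoef_of_not_up D q h]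
    simp only [← shiftM_termS, (shiftM_injective b).eq_iff]

/-- The formulas defining the operator on generators are homogeneous in the spectral parameter, and
both composites are determined by their values on generators. -/
lemma theta_shift (b : ℂˣ) (i : I) (x : D.Om) :
    D.theta q i (D.shift b x) = D.shift b (D.theta q i x) := by
  have h1 := (D.theta_good q i).mul (D.shift_good b)
  have h2 := (D.shift_good b).mul (D.theta_good q i)
  rw [mul_one] at h1
  rw [one_mul] at h2
  refine DFunLike.congr_fun (h1.ext h2 fun m => ?_) x
  refine ringHom_ext_E (f := D.theta q i * D.shift b) (g := D.shift b * D.theta q i)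
    (fun j a => ?_) (fun x => ?_) m
  · show D.theta q i (D.shift b _) = D.shift b (D.theta q i _)
    by_cases h : j = i
    · subst h
      rw [shift_E, shiftM_psi, theta_psi_self, theta_psi_self, map_mul, shift_E, shift_sig,
        shiftM_psiTilde, mul_right_comm]
    · rw [shift_E, shiftM_psi, theta_psi_ne D q h, theta_psi_ne D q h, shift_E, shiftM_psi]
  · show D.theta q i (D.shift b _) = D.shift b (D.theta q i _)
    rw [shift_E, shiftM_wtMono, theta_wtMono, shift_E, shiftM_wtMono]

/-! ### Rigidity -/

variable {D q}

/-- A series that is invariant under a shift of infinite order involves pure weights only. -/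
lemma fst_eq_zero_of_shift_eq {x : D.Om} {c : ℂˣ} (hc : ∀ n : ℕ, 0 < n → c ^ n ≠ 1)
    (h : D.shift c x = x) {w : D.W} {m : Mono I} (hm : cf x w m ≠ 0) : m.1 = 0 := by
  -- All shifts of m occur in x with the same weight. Only finitely many monomials have that weight,
  -- so some positive power of the shift fixes m, and the finitely supported Ψ-part of m is periodic
  -- of infinite order.
  have h1 : ∀ n : ℕ, cf x w (shiftM (c ^ n) m) ≠ 0 := by
    intro n
    induction n with
    | zero => rwa [pow_zero, shiftM_one]
    | succ n ih =>
      rw [pow_succ, ← shiftM_shiftM]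
      have := cf_shift c x w (shiftM (c ^ n) m)
      rw [h] at this
      rwa [this]
  have h2 : ¬ Function.Injective fun n : ℕ => shiftM (c ^ n) m := by
    intro hinj
    exact Set.infinite_of_injective_forall_mem hinj (s := {n | cf x w n ≠ 0 ∧ n.2 = m.2})
      (fun n => ⟨h1 n, rfl⟩) (cf_fiber x w m.2)
  have h3 : ∃ k : ℕ, 0 < k ∧ shiftM (c ^ k) m = m := by
    simp only [Function.Injective, not_forall] at h2
    obtain ⟨a, b, hab, hne⟩ := h2
    wlog hlt : a < b generalizing a b
    · exact this b a hab.symm (Ne.symm hne) (by omega)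
    refine ⟨b - a, by omega, shiftM_injective (c ^ a) ?_⟩
    rw [shiftM_shiftM, ← pow_add, Nat.sub_add_cancel hlt.le]
    exact hab.symm
  obtain ⟨k, hk, e⟩ := h3
  ext ⟨i, a⟩
  refine eq_zero_of_periodic m.1 i (c ^ k) (fun n hn => ?_) (fun a => ?_) a
  · rw [← pow_mul]
    exact hc _ (by positivity)
  · conv_lhs => rw [← e]
    exact shiftM_fst_apply _ m i a

/-- Operators that commute with shifts are determined by their values on the `Y_{i,a}` and on the
weights, and by the weights and signs of the leading terms of the images of the `Ψ_{i,a}`. -/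
theorem rigidity (hq : ∀ n : ℕ, 0 < n → q ^ n ≠ 1) {u : D.W} {Φ Φ' : D.Om →+* D.Om}
    (hΦ : Good u (Φ : D.Om →+ D.Om)) (hΦ' : Good u (Φ' : D.Om →+ D.Om))
    (hs : ∀ b x, Φ (D.shift b x) = D.shift b (Φ x))
    (hs' : ∀ b x, Φ' (D.shift b x) = D.shift b (Φ' x))
    (hY : ∀ i a, Φ (D.E (D.Y q i a)) = Φ' (D.E (D.Y q i a)))
    (hw : ∀ x, Φ (D.E (wtMono x)) = Φ' (D.E (wtMono x)))
    (hl : ∀ i a, ∃ l l' c, Lead q (Φ (D.E (psi i a))) l c ∧ Lead q (Φ' (D.E (psi i a))) l' c ∧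
      ∀ w, (l w).2 = (l' w).2) : Φ = Φ' := by
  have key : ∀ i a, Φ (D.E (psi i a)) = Φ' (D.E (psi i a)) := by
    intro i a
    have inv : ∀ (Ψ : D.Om →+* D.Om) m, Ψ (D.E m) * Ψ (D.E (-m)) = 1 := fun Ψ m => by
      rw [← map_mul, E_mul_neg, map_one]
    -- The ratio of the two images has to be 1. Shifts translate its parameter, while agreement on
    -- Y_{i,aq_i} = [ω_i] Ψ_{i,a} Ψ_{i,aq_i²}⁻¹ makes it periodic under q_i²; hence r a is invariant
    -- under a shift of infinite order.
    let r : ℂˣ → D.Om := fun a => Φ (D.E (psi i a)) * Φ' (D.E (-psi i a))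
    have hr1 : ∀ b a, D.shift b (r a) = r (a * b) := by
      intro b a
      show D.shift b (_ * _) = _ * _
      rw [map_mul, ← hs, ← hs', shift_E, shift_E, shiftM_psi, map_neg, shiftM_psi]
    have hr2 : ∀ a, r (a * D.qi q i ^ 2) = r a := by
      intro a
      have h1 := hY i (a * D.qi q i)
      have e : D.Y q i (a * D.qi q i) = wtMono (Pi.single i 1) + psi i a +
          -psi i (a * D.qi q i ^ 2) := by
        rw [Y, mul_inv_cancel_right, mul_assoc, ← sq, sub_eq_add_neg]
      rw [e, E_add, E_add, map_mul, map_mul, map_mul, map_mul, hw] at h1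
      have i1 := inv Φ (psi i (a * D.qi q i ^ 2))
      have i2 := inv Φ' (psi i a)
      have i3 := inv Φ' (wtMono (Pi.single i 1))
      show Φ (D.E (psi i (a * D.qi q i ^ 2))) * Φ' (D.E (-psi i (a * D.qi q i ^ 2))) =
        Φ (D.E (psi i a)) * Φ' (D.E (-psi i a))
      generalize Φ (D.E (psi i (a * D.qi q i ^ 2))) = p at *
      generalize Φ (D.E (-psi i (a * D.qi q i ^ 2))) = p' at *
      generalize Φ' (D.E (-psi i (a * D.qi q i ^ 2))) = t at *
      generalize Φ' (D.E (wtMono (Pi.single i 1))) = z at *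
      generalize Φ' (D.E (-wtMono (Pi.single i 1))) = z' at *
      generalize Φ (D.E (psi i a)) = y at *
      generalize Φ' (D.E (psi i a)) = y' at *
      generalize Φ' (D.E (-psi i a)) = x' at *
      have h2 : y * p' = y' * t := by
        calc y * p' = (z * z') * (y * p') := by rw [i3, one_mul]
          _ = z' * (z * y * p') := by ring
          _ = z' * (z * y' * t) := by rw [h1]
          _ = (z * z') * (y' * t) := by ring
          _ = y' * t := by rw [i3, one_mul]
      calc p * t = p * t * (y' * x') := by rw [i2, mul_one]
        _ = p * x' * (y' * t) := by ring
        _ = p * x' * (y * p') := by rw [h2]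
        _ = (p * p') * (y * x') := by ring
        _ = y * x' := by rw [i1, one_mul]
    have hinv : D.shift (D.qi q i ^ 2) (r a) = r a := by rw [hr1, hr2]
    have hfst := fun w m => fst_eq_zero_of_shift_eq (w := w) (m := m)
      (D.qi_pow_ne_one q hq i 2 two_pos) hinv
    obtain ⟨l, l', c, h1, h2, h3⟩ := hl i a
    obtain ⟨v, hv, -, hv'⟩ := h2.exists_unit
    have hv'' : ((v⁻¹ : D.Omˣ) : D.Om) = Φ' (D.E (-psi i a)) := by
      refine Units.inv_eq_of_mul_eq_one_right ?_
      rw [hv, inv]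
    have h4 : Lead q (r a) (l + -l') (c * c⁻¹) := by
      refine h1.mul ?_
      rw [← hv'']
      exact hv'
    -- The leading monomial of the ratio has weight 0 because the two leading weights agree, and no
    -- Ψ-part because of periodicity.
    have h5 : l + -l' = 0 := by
      funext w
      refine Prod.ext ?_ ?_
      · refine hfst w _ ?_
        rw [h4.coeff]
        exact Units.ne_zero _
      · simp [h3 w]
    rw [h5, mul_inv_cancel] at h4
    -- Every other monomial of the ratio is a monomial in the Y_{j,b} without Ψ-part, hence trivial
    -- since q is not a root of unity.
    have h6 : r a = 1 := by
      refine cf_ext fun w n => ?_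
      rw [cf_one]
      by_cases hn : n = 0
      · subst hn
        rw [if_pos rfl]
        exact h4.coeff w
      · rw [if_neg hn]
        by_contra hne
        refine hn (D.eq_zero_of_mem_of_fst q hq ?_ (hfst w n hne))
        simpa using h4.mem w n hne
    calc Φ (D.E (psi i a)) = Φ (D.E (psi i a)) * (Φ' (D.E (psi i a)) * Φ' (D.E (-psi i a))) := by
          rw [inv, mul_one]
      _ = r a * Φ' (D.E (psi i a)) := by ring
      _ = Φ' (D.E (psi i a)) := by rw [h6, one_mul]
  have := hΦ.ext hΦ' fun m => ringHom_ext_E key hw m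
  exact RingHom.ext fun x => DFunLike.congr_fun this x

end CartanDatum
end

noncomputable section

open scoped Classical

namespace CartanDatum

variable {I : Type*} [Fintype I] (D : CartanDatum I) (q : ℂˣ)

/-! ### Leading terms of images under the operators -/

lemma refl_leW {w : D.W} {i : I} {x y : I → ℤ} (h : D.LeW (w * D.s i) x y) :
    D.LeW w (D.refl i x) (D.refl i y) := by
  rwa [LeW_mul_iff, act_s] at h

variable {D q} in
-- All monomials of one component of x have the same degree, so their leading weights receive the
-- same correction, while s_i carries the ordering attached to w s_i to the one attached to w. The
-- top of the image therefore comes from the leading monomial of x alone.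
lemma Lead.theta {x : D.Om} {l : D.W → Mono I} {c : D.W → ℤˣ} (h : Lead q x l c) (i : I) :
    Lead q (D.theta q i x) (fun w => D.thetaLead q i (l (w * D.s i)) w)
      (fun w => c (w * D.s i) * Additive.toMul (D.thetaSign i (l (w * D.s i))) w) := by
  have hdeg : ∀ w m, cf x w m ≠ 0 → deg I m = deg I (l w) := fun w m hm => by
    have := D.deg_eq_zero_of_mem q (h.mem w m hm)
    rwa [map_sub, sub_eq_zero] at this
  have hle : ∀ w m n, cf x (w * D.s i) m ≠ 0 → cf (D.thetaV q i m) w n ≠ 0 →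
      D.LeW w n.2 (D.thetaLead q i m w).2 ∧
      D.LeW w (D.thetaLead q i m w).2 (D.thetaLead q i (l (w * D.s i)) w).2 := by
    intro w m n hm hmn
    refine ⟨(D.lead_thetaV q i m).le w n hmn, ?_⟩
    rw [thetaLead_snd, thetaLead_snd, hdeg _ m hm, LeW.add_right_iff]
    exact D.refl_leW (h.le _ m hm)
  have heq : ∀ w m n, cf x (w * D.s i) m ≠ 0 → cf (D.thetaV q i m) w n ≠ 0 →
      n.2 = (D.thetaLead q i (l (w * D.s i)) w).2 → m = l (w * D.s i) ∧
        n = D.thetaLead q i (l (w * D.s i)) w := by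
    intro w m n hm hmn e
    obtain ⟨h1, h2⟩ := hle w m n hm hmn
    have h3 := h2.antisymm (e ▸ h1)
    have h4 : m = l (w * D.s i) := by
      refine h.eq_of_wt _ m hm ?_
      rw [thetaLead_snd, thetaLead_snd, hdeg _ m hm, add_left_inj, ← act_s] at h3
      exact D.act_injective _ h3
    refine ⟨h4, ?_⟩
    rw [← h4] at e ⊢
    exact (D.lead_thetaV q i m).eq_of_wt w n hmn e
  refine ⟨fun w => ?_, fun w n hn => ?_, fun w n hn e => ?_, fun w n hn => ?_⟩
  · have e := ((D.theta_good q i).formula x w (D.thetaLead q i (l (w * D.s i)) w)).2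
    refine e.trans ?_
    rw [finsum_eq_single _ (l (w * D.s i))]
    · show cf x (w * D.s i) (l (w * D.s i)) * cf (D.theta q i (D.E (l (w * D.s i)))) w _ = _
      rw [theta_E, h.coeff, (D.lead_thetaV q i _).coeff, Units.val_mul]
    · intro m hm
      by_contra hne
      obtain ⟨h1, h2⟩ := mul_ne_zero_iff.1 hne
      have h2' : cf (D.theta q i (D.E m)) w _ ≠ 0 := h2
      rw [theta_E] at h2'
      exact hm (heq w m _ h1 h2' rfl).1
  · obtain ⟨m, hm, hmn⟩ := D.theta_support q i hn
    obtain ⟨h1, h2⟩ := hle w m n hm hmn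
    exact h1.trans h2
  · obtain ⟨m, hm, hmn⟩ := D.theta_support q i hn
    exact (heq w m n hm hmn e).2
  · obtain ⟨m, hm, hmn⟩ := D.theta_support q i hn
    have h1 := add_mem ((D.lead_thetaV q i m).mem w n hmn)
      (D.thetaLead_mem q i (h.mem _ m hm) w)
    rwa [map_sub, Pi.sub_apply, sub_add_sub_cancel] at h1

/-- Turns the length condition into a sign condition on a root; in this form it makes sense for all
roots attached to a word and can be transported by reflections. -/
lemma up_iff_qPos (w : D.W) (i : I) : D.Up w i ↔ D.QPos (D.act w (D.root i)) := by
  refine ⟨D.act_root_pos w i, fun h => ?_⟩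
  by_contra hcon
  have h1 := D.act_root_neg w i ((D.not_up_iff w i).1 hcon)
  have h2 : D.LeW w 0 (D.root i) := by rwa [LeW, sub_zero]
  have h3 : D.LeW w (D.root i) 0 := by rwa [LeW, zero_sub, map_neg]
  have := congrFun (h2.antisymm h3) i
  rw [root_self] at this
  norm_num at this

lemma thetaSign_apply (i : I) (m : Mono I) (w : D.W) :
    Additive.toMul (D.thetaSign i m) w = if D.Up w i then 1 else (-1) ^ (deg I m i) := by
  have : D.thetaSign i m = deg I m i • Additive.ofMul fun w => if D.Up w i then (1 : ℤˣ) else -1 :=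
    rfl
  rw [this, toMul_zsmul, toMul_ofMul, Pi.pow_apply]
  split_ifs <;> simp

/-! ### Words in the operators -/

/-- The operator attached to a word in the simple reflections. -/
def word (ω : List I) : D.Om →+* D.Om := (ω.map (D.theta q)).prod

/-- The element of the Weyl group attached to a word. -/
def wordW (ω : List I) : D.W := (ω.map D.s).prod

lemma word_cons (i : I) (ω : List I) (x : D.Om) :
    D.word q (i :: ω) x = D.theta q i (D.word q ω x) := by
  rw [word, List.map_cons, List.prod_cons]
  rfl

lemma word_good (ω : List I) : Good (D.wordW ω) (D.word q ω : D.Om →+ D.Om) := by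
  induction ω with
  | nil => exact Good.one
  | cons i ω ih =>
    rw [word, wordW, List.map_cons, List.map_cons, List.prod_cons, List.prod_cons]
    exact (D.theta_good q i).mul ih

lemma word_shift (ω : List I) (b : ℂˣ) (x : D.Om) :
    D.word q ω (D.shift b x) = D.shift b (D.word q ω x) := by
  induction ω with
  | nil => rfl
  | cons i ω ih => rw [word_cons, word_cons, ih, theta_shift]

lemma word_wtMono (ω : List I) (x : I → ℤ) :
    D.word q ω (D.E (wtMono x)) = D.E (wtMono (D.act (D.wordW ω) x)) := by
  induction ω with
  | nil => simp [word, wordW]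
  | cons i ω ih =>
    rw [word_cons, ih, theta_wtMono, wordW, wordW, List.map_cons, List.prod_cons, map_mul,
      Module.End.mul_apply, act_s]

lemma toOm_weylAction (ω : List I) (x : ∀ w, D.complY q w) :
    toOm (D.complY_le_big q) (D.weylAction q (D.wordW ω) x) =
      D.word q ω (toOm (D.complY_le_big q) x) := by
  induction ω with
  | nil => simp [word, wordW]
  | cons i ω ih =>
    rw [word_cons, ← ih, wordW, List.map_cons, List.prod_cons, map_mul, weylAction_s]
    rfl

/-! ### Roots and degrees attached to a word, and its leading terms -/

/-- The root with given coordinates with respect to the simple roots. -/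
def rootOf : (I → ℤ) →+ (I → ℤ) where
  toFun b := ∑ k, b k • D.root k
  map_zero' := by simp
  map_add' b c := by simp [add_smul, Finset.sum_add_distrib]

/-- The simple reflection in coordinates with respect to the simple roots. -/
def coordRefl (i : I) (b : I → ℤ) : I → ℤ := b - Pi.single i (∑ j, D.C i j * b j)

lemma rootOf_apply (b : I → ℤ) : D.rootOf b = ∑ k, b k • D.root k := rfl

lemma rootOf_single (i : I) (n : ℤ) : D.rootOf (Pi.single i n) = n • D.root i := by
  simp [rootOf_apply, Pi.single_apply, ite_smul]

lemma rootOf_coordRefl (i : I) (b : I → ℤ) : D.rootOf (D.coordRefl i b) = D.refl i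
    (D.rootOf b) := by
  rw [coordRefl, map_sub, rootOf_single, refl_apply]
  congr 2
  rw [rootOf_apply, Finset.sum_apply]
  refine Finset.sum_congr rfl fun j _ => ?_
  simp [root, mul_comm]

lemma coordRefl_coordRefl (i : I) (b : I → ℤ) : D.coordRefl i (D.coordRefl i b) = b := by
  have : ∑ j, D.C i j * D.coordRefl i b j = -∑ j, D.C i j * b j := by
    simp only [coordRefl, Pi.sub_apply, mul_sub, Finset.sum_sub_distrib]
    simp [Pi.single_apply, D.diag_eq_two]
    ring
  rw [coordRefl, this, coordRefl]
  simp [Pi.single_neg]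

lemma degRefl_dotProduct (i : I) (l b : I → ℤ) :
    D.degRefl i l ⬝ᵥ b = l ⬝ᵥ D.coordRefl i b := by
  rw [coordRefl, dotProduct_sub, dotProduct_single, Finset.mul_sum]
  simp only [dotProduct, degRefl_apply]
  rw [← Finset.sum_sub_distrib]
  refine Finset.sum_congr rfl fun j _ => ?_
  ring

/-- The coordinates of the roots attached to a word. -/
def wordRoots : List I → List (I → ℤ)
  | [] => []
  | i :: ω => Pi.single i 1 :: (wordRoots ω).map (D.coordRefl i)

/-- The image of a degree under a word. -/
def wordDeg (ω : List I) (l : I → ℤ) : I → ℤ := ω.foldr (fun i => D.degRefl i) l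

/-- The contribution of a root to the weight of a leading term. -/
def wtTerm (l : I → ℤ) (w : D.W) (b : I → ℤ) : I → ℤ :=
  if D.QPos (D.act w (D.rootOf b)) then 0 else -(l ⬝ᵥ b) • D.rootOf b

/-- The contribution of a root to the sign of a leading term. -/
def signTerm (l : I → ℤ) (w : D.W) (b : I → ℤ) : ℤˣ :=
  if D.QPos (D.act w (D.rootOf b)) then 1 else (-1) ^ (l ⬝ᵥ b)

lemma act_mul_s_rootOf (w : D.W) (i : I) (b : I → ℤ) :
    D.act (w * D.s i) (D.rootOf b) = D.act w (D.rootOf (D.coordRefl i b)) := by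
  rw [map_mul, Module.End.mul_apply, act_s, rootOf_coordRefl]

/-- The pairing of degrees with roots is invariant under simultaneous reflection, and w s_i acts on
a root as w acts on its reflection. -/
lemma refl_wtTerm (i : I) (l : I → ℤ) (w : D.W) (b : I → ℤ) :
    D.refl i (D.wtTerm l (w * D.s i) b) = D.wtTerm (D.degRefl i l) w (D.coordRefl i b) := by
  rw [wtTerm, wtTerm, act_mul_s_rootOf]
  split_ifs
  · exact map_zero _
  · rw [map_smul, rootOf_coordRefl, degRefl_dotProduct, coordRefl_coordRefl]

lemma signTerm_mul_s (i : I) (l : I → ℤ) (w : D.W) (b : I → ℤ) :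
    D.signTerm l (w * D.s i) b = D.signTerm (D.degRefl i l) w (D.coordRefl i b) := by
  rw [signTerm, signTerm, act_mul_s_rootOf]
  rw [degRefl_dotProduct, coordRefl_coordRefl]

/-- A new letter s_i contributes its own simple root, paired with the reflected degree to -μ_i, and
reflects all previous contributions. The weight and the sign of the leading term thus depend on the
word only through the final degree and the multiset of its roots. -/
lemma exists_lead_word (ω : List I) (t : I) (a : ℂˣ) :
    ∃ l c, Lead q (D.word q ω (D.E (psi t a))) l c ∧ ∀ w,
      deg I (l w) = D.wordDeg ω (Pi.single t 1) ∧
      (l w).2 = ((D.wordRoots ω).map (D.wtTerm (D.wordDeg ω (Pi.single t 1)) w)).sum ∧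
      c w = ((D.wordRoots ω).map (D.signTerm (D.wordDeg ω (Pi.single t 1)) w)).prod := by
  induction ω with
  | nil => exact ⟨_, _, Lead.E _, fun w => ⟨by simp [wordDeg], by simp [wordRoots],
      by simp [wordRoots]⟩⟩
  | cons i ω ih =>
    obtain ⟨l, c, hl, h⟩ := ih
    rw [word_cons]
    refine ⟨_, _, hl.theta i, fun w => ?_⟩
    obtain ⟨h1, h2, h3⟩ := h (w * D.s i)
    set μ := D.wordDeg ω (Pi.single t 1) with hμ
    have hμ' : D.wordDeg (i :: ω) (Pi.single t 1) = D.degRefl i μ := rfl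
    have hi : (D.degRefl i μ ⬝ᵥ Pi.single i 1) = -μ i := by
      rw [dotProduct_single, degRefl_apply, D.diag_eq_two]
      ring
    rw [hμ']
    refine ⟨by rw [deg_thetaLead, h1], ?_, ?_⟩
    · rw [thetaLead_snd, h2, h1, wordRoots, List.map_cons, List.sum_cons, List.map_map,
        map_list_sum, List.map_map, add_comm]
      congr 1
      · rw [wtTerm, rootOf_single, one_smul, ← up_iff_qPos, hi, neg_neg]
        split_ifs <;> rfl
      · congr 1
        refine List.map_congr_left fun b _ => ?_
        exact D.refl_wtTerm i μ w b
    · rw [thetaSign_apply, h3, h1, wordRoots, List.map_cons, List.prod_cons, List.map_map, mul_comm]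
      congr 1
      · rw [signTerm, rootOf_single, one_smul, ← up_iff_qPos, hi, zpow_neg]
        simp
      · congr 1
        refine List.map_congr_left fun b _ => ?_
        exact D.signTerm_mul_s i μ w b

end CartanDatum
end

noncomputable section

open scoped Classical

namespace CartanDatum

variable {I : Type*} [Fintype I] (D : CartanDatum I) (q : ℂˣ)

/-! ### The squares of the operators -/

/-- The substitution `Ψ_{i,a} ↦ [-ε α_i] Ψ_{i,a}`. -/
def chiM (i : I) (ε : ℤ) : Mono I →+ Mono I :=
  AddMonoidHom.id _ - (zmultiplesHom (Mono I) (wtMono (ε • D.root i))).comp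
    ((Pi.evalAddMonoidHom (fun _ => ℤ) i).comp (deg I))

lemma chiM_apply (i : I) (ε : ℤ) (m : Mono I) :
    D.chiM i ε m = m - deg I m i • wtMono (ε • D.root i) := rfl

@[simp] lemma deg_chiM (i : I) (ε : ℤ) (m : Mono I) : deg I (D.chiM i ε m) = deg I m := by
  rw [chiM_apply, map_sub, map_zsmul, deg_wtMono, smul_zero, sub_zero]

lemma chiM_snd (i : I) (ε : ℤ) (m : Mono I) :
    (D.chiM i ε m).2 = m.2 + -(deg I m i * ε) • D.root i := by
  rw [chiM_apply, Prod.snd_sub, Prod.smul_snd, wtMono_snd, smul_smul, neg_smul, sub_eq_add_neg]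

/-- The image of a monomial under `Ψ_{i,a} ↦ -[-ε α_i] Ψ_{i,a}`. -/
def chiV (i : I) (ε : ℤ) (m : Mono I) : D.Om :=
  ((((-1 : ℤˣ) ^ (deg I m i) : ℤˣ)) : ℤ) • D.E (D.chiM i ε m)

lemma cf_chiV_ne_zero {i : I} {ε : ℤ} {m n : Mono I} {w : D.W}
    (h : cf (D.chiV i ε m) w n ≠ 0) : n = D.chiM i ε m := by
  rw [chiV, cf_zsmul] at h
  exact cf_E_ne_zero (right_ne_zero_of_mul h)

lemma exists_chi (i : I) (ε : ℤ) : ∃ Φ : D.Om →+* D.Om, (∀ m, Φ (D.E m) = D.chiV i ε m) ∧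
    Good (1 : D.W) (Φ : D.Om →+ D.Om) ∧
    ∀ x w n, cf (Φ x) w n ≠ 0 → ∃ m, cf x (w * 1) m ≠ 0 ∧ cf (D.chiV i ε m) w n ≠ 0 :=
  exists_extension (1 : D.W) (D.chiV i ε) (by simp [chiV, E_zero])
    (fun m n => by
      rw [chiV, chiV, chiV, smul_mul_smul_comm, map_add, map_add, E_add, Pi.add_apply, zpow_add,
        Units.val_mul])
    (fun _ l => {(-(l i * ε) • D.root i, l)}) (fun _ _ => Set.finite_singleton _)
    (fun w m n h => by
      obtain rfl := D.cf_chiV_ne_zero h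
      refine ⟨_, rfl, by simp, ?_⟩
      rw [chiM_snd, map_one, Module.End.one_apply]
      exact LeW.refl' D w _)

/-- The operator `Ψ_{i,a} ↦ -[-ε α_i] Ψ_{i,a}`. -/
def chi (i : I) (ε : ℤ) : D.Om →+* D.Om := (D.exists_chi i ε).choose

lemma chi_E (i : I) (ε : ℤ) (m : Mono I) : D.chi i ε (D.E m) = D.chiV i ε m :=
  (D.exists_chi i ε).choose_spec.1 m

lemma chi_good (i : I) (ε : ℤ) : Good (1 : D.W) (D.chi i ε : D.Om →+ D.Om) :=
  (D.exists_chi i ε).choose_spec.2.1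

lemma chi_support (i : I) (ε : ℤ) {x : D.Om} {w : D.W} {n : Mono I}
    (h : cf (D.chi i ε x) w n ≠ 0) : ∃ m, cf x w m ≠ 0 ∧ n = D.chiM i ε m := by
  obtain ⟨m, h1, h2⟩ := (D.exists_chi i ε).choose_spec.2.2 x w n h
  exact ⟨m, by simpa using h1, D.cf_chiV_ne_zero h2⟩

lemma chi_E_of_deg (i : I) (ε : ℤ) {m : Mono I} (h : deg I m = 0) : D.chi i ε (D.E m) = D.E m := by
  rw [chi_E, chiV, chiM_apply, h]
  simp

lemma chi_shift (i : I) (ε : ℤ) (b : ℂˣ) (x : D.Om) :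
    D.chi i ε (D.shift b x) = D.shift b (D.chi i ε x) := by
  have h1 := (D.chi_good i ε).mul (D.shift_good b)
  have h2 := (D.shift_good b).mul (D.chi_good i ε)
  refine DFunLike.congr_fun (h1.ext h2 fun m => ?_) x
  show D.chi i ε (D.shift b (D.E m)) = D.shift b (D.chi i ε (D.E m))
  rw [shift_E, chi_E, chi_E, chiV, chiV, map_zsmul, shift_E, deg_shiftM, chiM_apply, chiM_apply,
    deg_shiftM, map_sub, map_zsmul, shiftM_wtMono]

lemma chi_mul_chi (i : I) (ε : ℤ) : D.chi i ε * D.chi i (-ε) = 1 := by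
  have h1 := (D.chi_good i ε).mul (D.chi_good i (-ε))
  rw [one_mul] at h1
  have := h1.ext Good.one fun m => by
    show D.chi i ε (D.chi i (-ε) (D.E m)) = D.E m
    rw [chi_E, chiV, map_zsmul, chi_E, chiV, deg_chiM, smul_smul, ← Units.val_mul,
      Int.units_mul_self, Units.val_one, one_smul, chiM_apply, chiM_apply, map_sub, map_zsmul,
      deg_wtMono]
    congr 1
    refine Prod.ext ?_ ?_
    · simp
    · simp
  exact RingHom.ext fun x => DFunLike.congr_fun this x

lemma theta_Y_theta_Y (i j : I) (a : ℂˣ) :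
    D.theta q i (D.theta q i (D.E (D.Y q j a))) = D.E (D.Y q j a) :=
  theta_theta_E i (D.Y_mem q j a)

/-- The square of the operator attached to `s_i` maps `Ψ_{i,a}` to `-[-α_i] Ψ_{i,a}`. -/
theorem theta_mul_theta (hq : ∀ n : ℕ, 0 < n → q ^ n ≠ 1) (i : I) :
    D.theta q i * D.theta q i = D.chi i 1 := by
  have hg := (D.theta_good q i).mul (D.theta_good q i)
  rw [s_mul_s] at hg
  refine rigidity hq hg (D.chi_good i 1) (fun b x => ?_) (D.chi_shift i 1) (fun j a => ?_)
    (fun x => ?_) (fun t a => ?_)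
  · show D.theta q i (D.theta q i _) = D.shift b (D.theta q i (D.theta q i _))
    rw [theta_shift, theta_shift]
  · rw [D.chi_E_of_deg i 1 (D.deg_Y q j a)]
    exact D.theta_Y_theta_Y q i j a
  · rw [D.chi_E_of_deg i 1 (deg_wtMono x)]
    show D.theta q i (D.theta q i _) = _
    rw [theta_wtMono, theta_wtMono, ← Module.End.mul_apply, refl_sq, Module.End.one_apply]
  -- The word s_i s_i has the roots α_i and -α_i, and w makes exactly one of them negative.
  -- Whichever it is, it contributes the weight -δ_{it} α_i and the sign (-1)^{δ_{it}},
  -- independently of w.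
  · obtain ⟨l, c, h1, h2⟩ := D.exists_lead_word q [i, i] t a
    have hdeg : D.wordDeg [i, i] (Pi.single t 1) = Pi.single t 1 := by
      ext k
      simp only [wordDeg, List.foldr_cons, List.foldr_nil, degRefl_apply, D.diag_eq_two]
      ring
    have hroots : D.wordRoots [i, i] = [Pi.single i 1, -Pi.single i 1] := by
      simp only [wordRoots, List.map_cons, List.map_nil, coordRefl]
      congr 2
      rw [Finset.sum_eq_single i]
      · rw [D.diag_eq_two, Pi.single_eq_same, ← Pi.single_sub, ← Pi.single_neg]
        norm_num
      · intro j _ hj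
        simp [hj]
      · simp
    rw [hdeg, hroots] at h2
    have hneg : ∀ w, D.QPos (D.act w (-D.root i)) ↔ ¬ D.Up w i := by
      intro w
      rw [← up_mul_s, up_iff_qPos, map_mul, Module.End.mul_apply, act_s, refl_apply, root_self,
        two_smul, sub_add_cancel_left]
    have hl : ∀ w, (l w).2 = -(Pi.single t 1 : I → ℤ) i • D.root i := by
      intro w
      rw [(h2 w).2.1]
      simp only [List.map_cons, List.map_nil, List.sum_cons, List.sum_nil, wtTerm, map_neg,
        rootOf_single, one_smul, ← up_iff_qPos]
      rw [← map_neg, hneg]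
      by_cases hw : D.Up w i <;> simp [hw]
    have hc : ∀ w, c w = (-1) ^ ((Pi.single t 1 : I → ℤ) i) := by
      intro w
      rw [(h2 w).2.2]
      simp only [List.map_cons, List.map_nil, List.prod_cons, List.prod_nil, signTerm, map_neg,
        rootOf_single, one_smul, ← up_iff_qPos]
      rw [← map_neg, hneg]
      by_cases hw : D.Up w i <;> simp [hw]
    refine ⟨l, fun _ => D.chiM i 1 (psi t a), c, h1, ?_, fun w => ?_⟩
    · have : D.chi i 1 (D.E (psi t a)) = Em (fun _ => D.chiM i 1 (psi t a)) c := by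
        refine cf_ext fun w n => ?_
        rw [chi_E, chiV, cf_zsmul, cf_E, cf_Em, hc, deg_psi]
        simp
      rw [this]
      exact Lead.Em _ _
    · rw [hl, chiM_snd, psi_snd, deg_psi, zero_add, mul_one]

/-! ### The braid relations -/

/-- The Y_{i,a} lie in Π, where the operators already factor through the Weyl group. -/
lemma word_E_Y {ω ω' : List I} (h : D.wordW ω = D.wordW ω') (i : I) (a : ℂˣ) :
    D.word q ω (D.E (D.Y q i a)) = D.word q ω' (D.E (D.Y q i a)) := by
  have e := fun ω => D.toOm_weylAction q ω (D.diagMono (D.yMono_mem_complY q) (Finsupp.single (i,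
      a) 1))
  simp only [toOm_diagMono, yMono_single, one_smul] at e
  rw [← e, ← e, h]

/-- Rigidity leaves only the weights and signs of leading terms to compare. These are a sum and a
product over the roots of the word, insensitive to their order. -/
lemma word_eq_word (hq : ∀ n : ℕ, 0 < n → q ^ n ≠ 1) {ω ω' : List I}
    (hW : D.wordW ω = D.wordW ω')
    (hdeg : ∀ t, D.wordDeg ω (Pi.single t 1) = D.wordDeg ω' (Pi.single t 1))
    (hroots : (D.wordRoots ω).Perm (D.wordRoots ω')) : D.word q ω = D.word q ω' := by
  refine rigidity hq (D.word_good q ω) (hW ▸ D.word_good q ω') (D.word_shift q ω)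
    (D.word_shift q ω') (D.word_E_Y q hW) (fun x => ?_) (fun t a => ?_)
  · rw [word_wtMono, word_wtMono, hW]
  · obtain ⟨l, c, h1, h2⟩ := D.exists_lead_word q ω t a
    obtain ⟨l', c', h1', h2'⟩ := D.exists_lead_word q ω' t a
    have hc : c = c' := funext fun w => by
      rw [(h2 w).2.2, (h2' w).2.2, hdeg]
      exact (hroots.map _).prod_eq
    subst hc
    refine ⟨l, l', c, h1, h1', fun w => ?_⟩
    rw [(h2 w).2.1, (h2' w).2.1, hdeg]
    exact (hroots.map _).sum_eq

lemma wordW_alternatingWord (i j : I) :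
    D.wordW (CoxeterSystem.alternatingWord i j (D.cox i j)) =
      D.wordW (CoxeterSystem.alternatingWord j i (D.cox i j)) := by
  have := D.cox.toCoxeterSystem.wordProd_braidWord_eq i j
  rw [CoxeterSystem.braidWord, CoxeterSystem.braidWord, ← D.cox.symmetric i j] at this
  exact this

/-- A vector in the span of two simple roots. -/
def pairVec (i j : I) (x y : ℤ) : I → ℤ := Pi.single i x + Pi.single j y

lemma coordRefl_pairVec_left {i j : I} (hij : i ≠ j) (x y : ℤ) :
    D.coordRefl i (pairVec i j x y) = pairVec i j (-x - D.C i j * y) y := by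
  have : ∑ k, D.C i k * pairVec i j x y k = 2 * x + D.C i j * y := by
    simp [pairVec, mul_add, Finset.sum_add_distrib, Pi.single_apply, D.diag_eq_two]
  rw [coordRefl, this]
  ext k
  by_cases hk : k = i
  · subst hk
    simp [pairVec, hij]
    ring
  · simp [pairVec, hk]

lemma coordRefl_pairVec_right {i j : I} (hij : i ≠ j) (x y : ℤ) :
    D.coordRefl j (pairVec i j x y) = pairVec i j x (-y - D.C j i * x) := by
  have h := D.coordRefl_pairVec_left hij.symm y x
  simp only [pairVec] at h ⊢
  rw [add_comm, h, add_comm]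

theorem word_braid (hq : ∀ n : ℕ, 0 < n → q ^ n ≠ 1) (i j : I) :
    D.word q (CoxeterSystem.alternatingWord i j (D.cox i j)) =
      D.word q (CoxeterSystem.alternatingWord j i (D.cox i j)) := by
  by_cases hij : i = j
  · subst hij
    rfl
  refine D.word_eq_word q hq (D.wordW_alternatingWord i j) (fun t => ?_) ?_
  · ext k
    rcases D.cartan_cases i j hij with c | c | c | c | c | c <;> obtain ⟨c1, c2⟩ := c <;>
      simp only [cox, Matrix.of_apply, if_neg hij, c1, c2] <;>
      norm_num [CoxeterSystem.alternatingWord, List.concat_eq_append, wordDeg, degRefl_apply,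
        D.diag_eq_two, c1, c2] <;> ring
  · have hs : (Pi.single i 1 : I → ℤ) = pairVec i j 1 0 := by simp [pairVec]
    have hs' : (Pi.single j 1 : I → ℤ) = pairVec i j 0 1 := by simp [pairVec]
    -- The two reduced words of the longest element of a rank two Weyl group list its positive roots
    -- in opposite orders.
    suffices D.wordRoots (CoxeterSystem.alternatingWord i j (D.cox i j)) =
        (D.wordRoots (CoxeterSystem.alternatingWord j i (D.cox i j))).reverse by
      rw [this]
      exact List.reverse_perm _
    rcases D.cartan_cases i j hij with c | c | c | c | c | c <;> obtain ⟨c1, c2⟩ := c <;>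
      simp only [cox, Matrix.of_apply, if_neg hij, c1, c2] <;>
      norm_num [CoxeterSystem.alternatingWord, List.concat_eq_append, wordRoots, hs, hs',
        D.coordRefl_pairVec_left hij, D.coordRefl_pairVec_right hij, c1, c2]

end CartanDatum
end

noncomputable section

open scoped Classical

namespace CartanDatum

variable {I : Type*} [Fintype I] (D : CartanDatum I) (q : ℂˣ)

/-! ### The rings of finite sums of products -/

/-- The part of a series consisting of the monomials in a set `S`. -/
def cut (w : D.W) (S : Set (Mono I)) (x : D.Series w) : D.Series w where
  coeff m := if D.toMono w m ∈ S then x.coeff m else 0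
  isPWO_support' := x.isPWO_support.mono fun m hm h => hm (by simp only [h, ite_self])

variable {D} in
lemma coeff_cut (w : D.W) (S : Set (Mono I)) (x : D.Series w) (m : D.OrdMono w) :
    (D.cut w S x).coeff m = if D.toMono w m ∈ S then x.coeff m else 0 := rfl

variable {D} in
lemma support_cut (w : D.W) (S : Set (Mono I)) (x : D.Series w) (m : D.OrdMono w)
    (hm : m ∈ (D.cut w S x).support) : D.toMono w m ∈ S ∧ m ∈ x.support := by
  rw [HahnSeries.mem_support] at hm
  by_cases h : D.toMono w m ∈ S
  · exact ⟨h, by rw [HahnSeries.mem_support]; simpa [cut, h] using hm⟩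
  · exact absurd (if_neg h) hm

/-- Finite sums of products are traded for a condition on supports, which is easy to check for
images of operators. Conversely, a series meeting finitely many classes modulo N is cut into its
classes, and each piece is divided by a representative chosen in K. -/
lemma poly_sup_compl (w : D.W) {K N : AddSubgroup (Mono I)} (hKN : K ⊔ N = ⊤) :
    D.poly w K ⊔ D.compl w N = D.finIm (QuotientAddGroup.mk' N) w := by
  apply le_antisymm
  · refine sup_le ?_ ?_
    · rintro x ⟨h1, h2⟩
      exact ⟨ConeFinite.of_finite D w h1, h1.image _⟩
    · rintro x ⟨h1, h2⟩
      refine ⟨h1, (Set.finite_singleton 0).subset ?_⟩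
      rintro _ ⟨m, hm, rfl⟩
      exact (QuotientAddGroup.eq_zero_iff _).2 (h2 m hm)
  · rintro x ⟨h1, h2⟩
    have hrep : ∀ c : Mono I ⧸ N, ∃ k ∈ K, QuotientAddGroup.mk' N k = c := by
      intro c
      obtain ⟨m, rfl⟩ := QuotientAddGroup.mk'_surjective N c
      have hm : m ∈ K ⊔ N := by rw [hKN]; exact AddSubgroup.mem_top m
      obtain ⟨k, hk, n, hn, rfl⟩ := AddSubgroup.mem_sup.1 hm
      refine ⟨k, hk, ?_⟩
      have h0 : QuotientAddGroup.mk' N n = 0 := (QuotientAddGroup.eq_zero_iff n).2 hn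
      rw [map_add, h0, add_zero]
    choose k hk hkc using hrep
    let X : Mono I ⧸ N → D.Series w := fun c => D.cut w {m | QuotientAddGroup.mk' N m = c} x
    have hx : x = ∑ c ∈ h2.toFinset, X c := by
      refine HahnSeries.ext (funext fun m => ?_)
      rw [HahnSeries.coeff_sum]
      have : ∀ c, (X c).coeff m = if QuotientAddGroup.mk' N (D.toMono w m) = c then x.coeff m
        else 0 := fun c => by
          simp only [X, coeff_cut, Set.mem_ofPred_eq]
          congr
      simp only [this, Finset.sum_ite_eq, Set.Finite.mem_toFinset]
      split_ifs with h
      · rfl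
      · by_contra hne
        exact h ⟨m, hne, rfl⟩
    rw [hx]
    refine sum_mem fun c _ => ?_
    have e : X c = D.mono w (k c) * (D.mono w (-k c) * X c) := by
      rw [← mul_assoc]
      have : D.mono w (k c) * D.mono w (-k c) = 1 := by
        simp only [mono, HahnSeries.single_mul_single, ← map_add, mul_one, add_neg_cancel]
        rfl
      rw [this, one_mul]
    rw [e]
    refine mul_mem ((le_sup_left : _ ≤ D.poly w K ⊔ D.compl w N) (D.mono_mem_poly w (hk c)))
      ((le_sup_right : _ ≤ D.poly w K ⊔ D.compl w N) ?_)
    have hs := HahnSeries.support_mul_subset (x := D.mono w (-k c)) (y := X c)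
    have hk' : (D.mono w (-k c)).support ⊆ {(D.toMono w).symm (-k c)} :=
      HahnSeries.support_single_subset
    have hX := support_cut w {m | QuotientAddGroup.mk' N m = c} x
    refine ⟨ConeFinite.mono (ConeFinite.add (ConeFinite.of_finite D w (Set.finite_singleton _))
      (h1.mono fun m hm => (hX m hm).2)) (hs.trans (Set.add_subset_add_right hk')), fun m hm => ?_⟩
    obtain ⟨a, ha, b, hb, rfl⟩ := hs hm
    obtain rfl := hk' ha
    have hb' : QuotientAddGroup.mk' N (D.toMono w b) = c := (hX b hb).1
    refine (QuotientAddGroup.eq_zero_iff _).1 ?_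
    show QuotientAddGroup.mk' N _ = 0
    rw [map_add, map_add, AddEquiv.apply_symm_apply, map_neg, hkc, hb', neg_add_cancel]

lemma complY'_eq (w : D.W) : D.complY' q w = D.finIm (QuotientAddGroup.mk' (D.monoY q)) w :=
  D.poly_sup_compl w (top_sup_eq _)

lemma complYbar_eq (w : D.W) : D.complYbar q w = D.finIm (QuotientAddGroup.mk' (D.monoYy q)) w := by
  refine D.poly_sup_compl w (eq_top_iff.2 fun m _ => ?_)
  have e : m = (m.1, 0) + (0, m.2) := by simp
  rw [e]
  exact add_mem ((le_sup_left : monoPsi I ≤ _) ⟨m.1, rfl⟩)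
    ((le_sup_right : D.monoYy q ≤ _) ((le_sup_right : _ ≤ D.monoYy q) ⟨m.2, rfl⟩))

variable {D} in
lemma finIm_le_big {N : AddSubgroup (Mono I)} (hN : ∀ n ∈ N, deg I n = 0) (w : D.W) :
    D.finIm (QuotientAddGroup.mk' N) w ≤ D.big w := by
  rintro x ⟨h1, h2⟩
  refine ⟨h1, (h2.image (QuotientAddGroup.lift N (deg I) hN)).subset ?_⟩
  rintro _ ⟨m, hm, rfl⟩
  exact ⟨_, ⟨m, hm, rfl⟩, rfl⟩

variable {D} in
-- If all monomials in the image of m lie in the class of f m modulo N, then finitely many classes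
-- are carried to finitely many classes.
lemma stable_finIm {N : AddSubgroup (Mono I)} {Φ : D.Om →+* D.Om} (u : D.W) (f : Mono I →+ Mono I)
    (hf : ∀ n ∈ N, f n ∈ N)
    (h : ∀ x w n, cf (Φ x) w n ≠ 0 → ∃ m, cf x (w * u) m ≠ 0 ∧ n - f m ∈ N) :
    Stable (D.finIm (QuotientAddGroup.mk' N)) Φ := by
  intro x hx w
  refine ⟨(Φ x w).2.1, ((hx (w * u)).2.image (QuotientAddGroup.map N N f hf)).subset ?_⟩
  rintro _ ⟨n, hn, rfl⟩
  obtain ⟨m, hm, hmn⟩ := h x w _ hn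
  refine ⟨_, ⟨(D.toMono (w * u)).symm m, hm, rfl⟩, ?_⟩
  have : QuotientAddGroup.mk' N (D.toMono w n - f m) = 0 := (QuotientAddGroup.eq_zero_iff _).2 hmn
  rw [map_sub, sub_eq_zero] at this
  exact this.symm

lemma deg_eq_zero_of_mem_monoYy {n : Mono I} (hn : n ∈ D.monoYy q) : deg I n = 0 := by
  obtain ⟨a, ha, _, ⟨b, rfl⟩, rfl⟩ := AddSubgroup.mem_sup.1 hn
  rw [map_add, D.deg_eq_zero_of_mem q ha, zero_add]
  exact deg_wtMono b

lemma sigmaM_mem_monoYy {i : I} {n : Mono I} (hn : n ∈ D.monoYy q) :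
    D.sigmaM q i n ∈ D.monoYy q := by
  obtain ⟨a, ha, _, ⟨b, rfl⟩, rfl⟩ := AddSubgroup.mem_sup.1 hn
  rw [map_add]
  exact add_mem ((le_sup_left : _ ≤ D.monoYy q) (D.sigmaM_mem q ha))
    ((le_sup_right : _ ≤ D.monoYy q) ⟨D.refl i b, (D.sigmaM_wtMono q i b).symm⟩)

lemma theta_stable_finIm {N : AddSubgroup (Mono I)} (hN : D.monoY q ≤ N) (i : I)
    (hs : ∀ n ∈ N, D.sigmaM q i n ∈ N) :
    Stable (D.finIm (QuotientAddGroup.mk' N)) (D.theta q i) := by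
  refine stable_finIm (D.s i) (D.sigmaM q i) hs fun x w n hn => ?_
  obtain ⟨m, hm, hmn⟩ := D.theta_support q i hn
  refine ⟨m, hm, hN ?_⟩
  have h1 := (D.lead_thetaV q i m).mem w n hmn
  rw [thetaLead_apply] at h1
  have h2 : (if D.Up w i then 0 else D.aPart q i m) ∈ D.monoY q := by
    split_ifs
    · exact zero_mem _
    · exact D.aPart_mem q i m
  have := add_mem h1 h2
  rwa [← sub_sub, sub_add_cancel] at this

variable {D} in
lemma chi_stable_finIm {N : AddSubgroup (Mono I)} (hN : ∀ n ∈ N, deg I n = 0) (i : I) (ε : ℤ) :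
    Stable (D.finIm (QuotientAddGroup.mk' N)) (D.chi i ε) := by
  refine stable_finIm 1 (D.chiM i ε) (fun n hn => ?_) fun x w n hn => ?_
  · rw [chiM_apply, hN n hn]
    simpa using hn
  · obtain ⟨m, hm, rfl⟩ := D.chi_support i ε hn
    exact ⟨m, by simpa using hm, by rw [sub_self]; exact zero_mem _⟩

/-! ### The braid group action on the product of subrings -/

/-- Families of subrings on which the operators and their inverses act. -/
structure Admissible (R : ∀ w, Subring (D.Series w)) : Prop where
  le_big : ∀ w, R w ≤ D.big w
  theta : ∀ i, Stable R (D.theta q i)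
  chi : ∀ i, Stable R (D.chi i (-1))

lemma admissible_finIm {N : AddSubgroup (Mono I)} (hN : D.monoY q ≤ N)
    (hdeg : ∀ n ∈ N, deg I n = 0) (hs : ∀ i, ∀ n ∈ N, D.sigmaM q i n ∈ N) :
    D.Admissible q (D.finIm (QuotientAddGroup.mk' N)) :=
  ⟨finIm_le_big hdeg, fun i => D.theta_stable_finIm q hN i (hs i),
    fun i => chi_stable_finIm hdeg i _⟩

lemma admissible_complY' : D.Admissible q (D.complY' q) := by
  rw [show D.complY' q = _ from funext (D.complY'_eq q)]
  exact D.admissible_finIm q le_rfl (fun _ => D.deg_eq_zero_of_mem q) fun i _ => D.sigmaM_mem q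

lemma admissible_complYbar : D.Admissible q (D.complYbar q) := by
  rw [show D.complYbar q = _ from funext (D.complYbar_eq q)]
  exact D.admissible_finIm q le_sup_left (fun _ => D.deg_eq_zero_of_mem_monoYy q)
    fun i _ => D.sigmaM_mem_monoYy q

variable {D q}

lemma Stable.mul {R : ∀ w, Subring (D.Series w)} {Φ Φ' : D.Om →+* D.Om} (h : Stable R Φ)
    (h' : Stable R Φ') : Stable R (Φ * Φ') := fun x hx => h _ (h' x hx)

lemma chi_theta_theta (hq : ∀ n : ℕ, 0 < n → q ^ n ≠ 1) (i : I) :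
    D.chi i (-1) * D.theta q i * D.theta q i = 1 := by
  rw [mul_assoc, theta_mul_theta D q hq]
  simpa using D.chi_mul_chi i (-1)

/-- The square of the operator is the invertible χ, which yields a left inverse and a right inverse;
these coincide. -/
lemma theta_chi_theta (hq : ∀ n : ℕ, 0 < n → q ^ n ≠ 1) (i : I) :
    D.theta q i * (D.chi i (-1) * D.theta q i) = 1 := by
  have h1 := chi_theta_theta (D := D) hq i
  have h2 : D.theta q i * (D.theta q i * D.chi i (-1)) = 1 := by
    rw [← mul_assoc, theta_mul_theta D q hq]
    exact D.chi_mul_chi i 1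
  rw [left_inv_eq_right_inv h1 h2, h2]

namespace Admissible

variable {R : ∀ w, Subring (D.Series w)} (h : D.Admissible q R)
  (hq : ∀ n : ℕ, 0 < n → q ^ n ≠ 1)

/-- The automorphism attached to `s_i`. -/
def aut (i : I) : RingAut (∀ w, R w) :=
  RingEquiv.ofRingHom (restrict h.le_big (D.theta q i) (h.theta i))
    (restrict h.le_big (D.chi i (-1) * D.theta q i) ((h.chi i).mul (h.theta i)))
    (RingHom.ext fun x => toOm_injective h.le_big
      (DFunLike.congr_fun (theta_chi_theta hq i) (toOm h.le_big x)))
    (RingHom.ext fun x => toOm_injective h.le_big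
      (DFunLike.congr_fun (chi_theta_theta hq i) (toOm h.le_big x)))

lemma toOm_prod_aut (ω : List I) (x : ∀ w, R w) :
    toOm h.le_big ((ω.map (h.aut hq)).prod x) = D.word q ω (toOm h.le_big x) := by
  induction ω with
  | nil => rfl
  | cons i ω ih =>
    rw [word_cons, ← ih, List.map_cons, List.prod_cons]
    rfl

lemma aut_braid (r : FreeGroup I) (hr : r ∈ D.braidRels) :
    FreeGroup.lift (h.aut hq) r = 1 := by
  obtain ⟨i, j, rfl⟩ := hr
  rw [map_mul, map_inv, map_list_prod, map_list_prod, List.map_map, List.map_map,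
    mul_inv_eq_one]
  have e : ⇑(FreeGroup.lift (h.aut hq)) ∘ FreeGroup.of = h.aut hq :=
    funext fun i => FreeGroup.lift_apply_of
  rw [e]
  refine RingEquiv.ext fun x => toOm_injective h.le_big ?_
  rw [toOm_prod_aut, toOm_prod_aut, word_braid D q hq]

/-- The action of the braid group. -/
def braidAction : D.Braid →* RingAut (∀ w, R w) := PresentedGroup.toGroup (h.aut_braid hq)

lemma braidAction_gen (i : I) : h.braidAction hq (D.gen i) = h.aut hq i :=
  PresentedGroup.toGroup.of (h.aut_braid hq)

end Admissible

end CartanDatum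
end

noncomputable section

open scoped Classical

namespace CartanDatum

variable {I : Type*} [Fintype I] (D : CartanDatum I) (q : ℂˣ)

/-! ### Linear disjointness -/

/-- A representative of a class of monomials modulo monomials in the `Y_{i,a}`. -/
def rep (c : Mono I ⧸ D.monoY q) : Mono I := Quotient.out c

lemma mk_rep (c : Mono I ⧸ D.monoY q) : QuotientAddGroup.mk' (D.monoY q) (D.rep q c) = c :=
  Quotient.out_eq' c

lemma coeff_mul_mono (w : D.W) (x : D.Series w) (k : Mono I) (m : D.OrdMono w) :
    (x * D.mono w k).coeff m = x.coeff (m - (D.toMono w).symm k) := by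
  have := HahnSeries.coeff_mul_single_add (r := (1 : ℤ)) (x := x)
    (a := m - (D.toMono w).symm k) (b := (D.toMono w).symm k)
  rwa [sub_add_cancel, mul_one] at this

/-- The representatives are linearly independent over the completion of `𝒴`. -/
lemma eq_zero_of_sum_rep (w : D.W) (s : Finset (Mono I ⧸ D.monoY q))
    (x : Mono I ⧸ D.monoY q → D.Series w)
    (hx : ∀ c, ∀ m ∈ (x c).support, D.toMono w m ∈ D.monoY q)
    (h : ∑ c ∈ s, x c * D.mono w (D.rep q c) = 0) (c : Mono I ⧸ D.monoY q) (hc : c ∈ s) :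
    x c = 0 := by
  -- The class of a monomial modulo monomials in the Y_{i,a} tells from which summand it comes, so
  -- the summands have disjoint supports and vanish separately.
  have hx' : ∀ c' m, (x c').coeff (m - (D.toMono w).symm (D.rep q c')) ≠ 0 →
      c' = QuotientAddGroup.mk' (D.monoY q) (D.toMono w m) := by
    intro c' m hm
    have h1 : QuotientAddGroup.mk' (D.monoY q)
      (D.toMono w (m - (D.toMono w).symm (D.rep q c'))) = 0 :=
      (QuotientAddGroup.eq_zero_iff _).2 (hx c' _ hm)
    rw [map_sub, map_sub, AddEquiv.apply_symm_apply, mk_rep, sub_eq_zero] at h1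
    exact h1.symm
  refine HahnSeries.ext (funext fun n => ?_)
  by_contra hne
  set m := n + (D.toMono w).symm (D.rep q c) with hm
  have hn : n = m - (D.toMono w).symm (D.rep q c) := by rw [hm, add_sub_cancel_right]
  have h0 := congrArg (fun z : D.Series w => z.coeff m) h
  simp only [HahnSeries.coeff_sum, coeff_mul_mono] at h0
  rw [Finset.sum_eq_single_of_mem c hc] at h0
  · rw [hn] at hne
    exact hne h0
  · intro c' _ hc'
    by_contra hne'
    rw [hn] at hne
    exact hc' ((hx' c' m hne').trans (hx' c m hne).symm)

/-- The representatives as elements of `𝒴'`. -/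
def repY' (w : D.W) (c : Mono I ⧸ D.monoY q) : D.algY' q w :=
  ⟨D.mono w (D.rep q c), D.mono_mem_poly w (AddSubgroup.mem_top _)⟩

lemma linearIndependent_repY' (w : D.W) : LinearIndependent (D.ringY q w) (D.repY' q w) := by
  rw [linearIndependent_iff']
  intro s g hg c hc
  refine Subtype.ext (D.eq_zero_of_sum_rep q w s (fun c => g c) (fun c => (g c).2.2) ?_ c hc)
  have := congrArg (D.algY' q w).val hg
  rw [map_sum, map_zero] at this
  exact this

lemma span_repY' (w : D.W) : ⊤ ≤ Submodule.span (D.ringY q w) (Set.range (D.repY' q w)) := by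
  rintro ⟨x, hx⟩ -
  have hx' : x.support.Finite := hx.1
  have hsum : x = ∑ m ∈ hx'.toFinset, x.coeff m • D.mono w (D.toMono w m) := by
    refine HahnSeries.ext (funext fun n => ?_)
    rw [HahnSeries.coeff_sum]
    have : ∀ m : D.OrdMono w, (x.coeff m • D.mono w (D.toMono w m)).coeff n =
        if n = m then x.coeff m else 0 := by
      intro m
      rw [HahnSeries.coeff_smul, mono, AddEquiv.symm_apply_apply, HahnSeries.coeff_single]
      split_ifs <;> simp
    simp only [this, Finset.sum_ite_eq, Set.Finite.mem_toFinset]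
    split_ifs with h
    · rfl
    · by_contra hne
      exact h hne
  have hmem : ∀ m : Mono I, (⟨D.mono w m, D.mono_mem_poly w (AddSubgroup.mem_top _)⟩ :
      D.algY' q w) ∈ Submodule.span (D.ringY q w) (Set.range (D.repY' q w)) := by
    intro m
    set c := QuotientAddGroup.mk' (D.monoY q) m with hc
    have h1 : m - D.rep q c ∈ D.monoY q := by
      refine (QuotientAddGroup.eq_zero_iff _).1 ?_
      show QuotientAddGroup.mk' (D.monoY q) _ = 0
      rw [map_sub, mk_rep, sub_self]
    have h2 := Submodule.smul_mem _
      (⟨D.mono w (m - D.rep q c), D.mono_mem_poly w h1⟩ : D.ringY q w)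
      (Submodule.subset_span (R := D.ringY q w) (Set.mem_range_self (f := D.repY' q w) c))
    convert h2 using 1
    refine Subtype.ext ?_
    show D.mono w m = D.mono w (m - D.rep q c) * D.mono w (D.rep q c)
    simp only [mono, HahnSeries.single_mul_single, ← map_add, mul_one, sub_add_cancel]
  have hsum' : (⟨x, hx⟩ : D.algY' q w) = ∑ m ∈ hx'.toFinset,
      x.coeff m • (⟨D.mono w (D.toMono w m), D.mono_mem_poly w (AddSubgroup.mem_top _)⟩ :
        D.algY' q w) := by
    refine Subtype.ext ?_
    show x = (D.algY' q w).val _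
    rw [map_sum]
    simp only [map_zsmul]
    exact hsum
  rw [hsum']
  exact sum_mem fun m _ => zsmul_mem (hmem _) _

/-- Representatives of the classes modulo monomials in the Y_{i,a} form a basis of 𝒴' over 𝒴. The
argument for their independence uses only which classes occur, not finiteness of the coefficients,
and so it persists over the completion. -/
theorem linearDisjoint (w : D.W) : (D.algY' q w).LinearDisjoint (D.algComplY q w) := by
  refine Subalgebra.LinearDisjoint.of_basis_left _ _
    (Module.Basis.mk (D.linearIndependent_repY' q w) (D.span_repY' q w)) ?_
  rw [Module.Basis.coe_mk, linearIndependent_iff']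
  intro s g hg c hc
  refine Subtype.ext (D.eq_zero_of_sum_rep q w s (fun c => g c) (fun c => (g c).2.2) ?_ c hc)
  exact hg

/-! ### Characterization of the operators -/

section Diag

variable {D} {R : ∀ w, Subring (D.Series w)} {T : Type*} [AddCommGroup T] {κ : T → Mono I}
  (hκ : ∀ w t, D.mono w (κ t) ∈ R w)

lemma diagMono_add (hadd : ∀ s t, κ (s + t) = κ s + κ t) (s t : T) :
    D.diagMono hκ (s + t) = D.diagMono hκ s * D.diagMono hκ t := by
  funext w
  refine Subtype.ext ?_
  show D.mono w (κ (s + t)) = D.mono w (κ s) * D.mono w (κ t)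
  rw [hadd]
  simp only [mono, HahnSeries.single_mul_single, ← map_add, mul_one]

lemma diagMono_zero (hadd : ∀ s t, κ (s + t) = κ s + κ t) : D.diagMono hκ 0 = 1 := by
  have h0 : κ 0 = 0 := by simpa using hadd 0 0
  funext w
  refine Subtype.ext ?_
  show D.mono w (κ 0) = 1
  rw [h0]
  rfl

/-- The parameters of the monomials on which two operators agree. -/
def agree (hadd : ∀ s t, κ (s + t) = κ s + κ t) (F F' : (∀ w, R w) →+* (∀ w, R w)) :
    AddSubgroup T where
  carrier := {t | F (D.diagMono hκ t) = F' (D.diagMono hκ t)}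
  zero_mem' := by
    simp only [Set.mem_ofPred_eq, diagMono_zero hκ hadd, map_one]
  add_mem' := by
    intro s t hs ht
    simp only [Set.mem_ofPred_eq] at hs ht ⊢
    rw [diagMono_add hκ hadd, map_mul, map_mul, hs, ht]
  neg_mem' := by
    intro t ht
    simp only [Set.mem_ofPred_eq] at ht ⊢
    have hinv : ∀ G : (∀ w, R w) →+* (∀ w, R w),
        G (D.diagMono hκ t) * G (D.diagMono hκ (-t)) = 1 := fun G => by
      rw [← map_mul, ← diagMono_add hκ hadd, add_neg_cancel, diagMono_zero hκ hadd, map_one]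
    have h1 := hinv F
    rw [ht] at h1
    exact (left_inv_eq_right_inv ((mul_comm _ _).trans (hinv F')) h1).symm

end Diag

/-- The series Σ_{i,a} are units, so the quotient in the definition of Θ_i, stated with its
denominator cleared, determines the image of Y_{i,a}. -/
lemma sigma_cancel (w : D.W) (i : I) (a : ℂˣ) {x y : D.Series w}
    (h : x * D.sigma q w i a = y * D.sigma q w i a) : x = y := by
  have hu : D.sigma q w i a * (((D.sigU q i a)⁻¹ : D.Omˣ) : D.Om) w = 1 := by
    rw [sigma_eq, ← val_sigU]
    exact congrArg (fun z : D.Om => (z w : D.Series w)) (D.sigU q i a).mul_inv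
  rw [← mul_one x, ← hu, ← mul_assoc, h, mul_assoc, hu, mul_one]

variable {D q} in
lemma IsTheta.ext {i : I} {F F' : (∀ w, D.complY q w) →+* (∀ w, D.complY q w)}
    (h : D.IsTheta q i F) (h' : D.IsTheta q i F') : F = F' := by
  refine IsContinuousAt.ext _ h.continuous h'.continuous fun t => ?_
  suffices H : (⊤ : AddSubgroup _) ≤ agree (D.yMono_mem_complY q) (map_add (D.yMono q)) F F' from
    H (AddSubgroup.mem_top t)
  rintro t -
  have hgen : ∀ j a, Finsupp.single (j, a) 1 ∈
      agree (D.yMono_mem_complY q) (map_add (D.yMono q)) F F' := by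
    intro j a
    by_cases hj : j = i
    · subst hj
      refine funext fun w => Subtype.ext ?_
      exact D.sigma_cancel q w j _ ((h.map_Y a w).trans (h'.map_Y a w).symm)
    · exact (h.map_Y_of_ne j a hj).trans (h'.map_Y_of_ne j a hj).symm
  induction t using Finsupp.induction_linear with
  | zero => exact zero_mem _
  | add u v hu hv => exact add_mem hu hv
  | single p n =>
    have := zsmul_mem (hgen p.1 p.2) n
    rwa [Finsupp.smul_single, smul_eq_mul, mul_one] at this

variable {D q} in
lemma IsThetaPrime.ext {R : ∀ w, Subring (D.Series w)} {hR : ∀ w m, D.mono w m ∈ R w} {i : I}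
    {F F' : (∀ w, R w) →+* (∀ w, R w)} (h : D.IsThetaPrime q hR i F)
    (h' : D.IsThetaPrime q hR i F') : F = F' := by
  refine IsContinuousAt.ext _ h.continuous h'.continuous fun t => ?_
  refine mem_of_generators (S := agree (κ := id) hR (fun _ _ => rfl) F F') (fun j a => ?_)
    (fun x => ?_) t
  · by_cases hj : j = i
    · subst hj
      exact funext fun w => Subtype.ext ((h.map_psi a w).trans (h'.map_psi a w).symm)
    · exact (h.map_psi_of_ne j a hj).trans (h'.map_psi_of_ne j a hj).symm
  · exact (h.map_wt x).trans (h'.map_wt x).symm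

lemma isTheta_thetaY (hq : ∀ n : ℕ, 0 < n → q ^ n ≠ 1) (i : I) :
    D.IsTheta q i (D.thetaY q i) where
  continuous := isContinuousAt_restrict (D.complY_le_big q) (D.yMono_mem_complY q)
    (D.yMono_injective q hq)
    (fun x w m hm => (mem_complY_iff q (toOm (D.complY_le_big q) x)).1 (fun w => (x w).2) w m hm)
    (D.theta_good q i) _
  map_Y_of_ne j a hj := by
    refine toOm_injective (D.complY_le_big q) ?_
    show D.theta q i (D.E (D.yMono q _)) = D.E (D.yMono q _)
    rw [yMono_single, one_smul]
    exact D.theta_E_of_mem q (D.Y_mem_fixMono q hj a)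
  map_Y a w := by
    have h := D.theta_Y_self q i a
    have e : D.theta q i (toOm (D.complY_le_big q)
        (D.diagMono (D.yMono_mem_complY q) (Finsupp.single (i, a) 1))) =
        D.theta q i (D.E (D.Y q i a)) := by
      rw [toOm_diagMono, yMono_single, one_smul]
    rw [← e] at h
    rw [sigma_eq, sigma_eq]
    exact congrArg (fun z : D.Om => (z w : D.Series w)) h

variable {D q} in
lemma Admissible.isThetaPrime {R : ∀ w, Subring (D.Series w)} (h : D.Admissible q R)
    (hR : ∀ w m, D.mono w m ∈ R w) (i : I) :
    D.IsThetaPrime q hR i (restrict h.le_big (D.theta q i) (h.theta i)) where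
  continuous := isContinuousAt_restrict h.le_big (κ := id) hR Function.injective_id
    (fun _ _ m _ => ⟨m, rfl⟩) (D.theta_good q i) _
  map_wt x := toOm_injective h.le_big (D.theta_wtMono q i x)
  map_psi_of_ne j a hj := toOm_injective h.le_big (D.theta_psi_ne q hj a)
  map_psi a w := by
    rw [sigma_eq]
    exact congrArg (fun z : D.Om => (z w : D.Series w)) (D.theta_psi_self q i a)

end CartanDatum
end

/-! ### The Weyl group action and the braid group actions extending it -/

theorem proposition3p8 {I : Type*} [Fintype I] (D : CartanDatum I) (q : ℂˣ)
    (hq : ∀ n : ℕ, 0 < n → q ^ n ≠ 1) :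
    -- the series `Σ_{i,a}` exist in all the completions of `𝒴`
    (∀ w i a, D.sigma q w i a ∈ D.complY q w ∧
      ∀ m, D.coef w (D.sigma q w i a) m = D.sigmaCoef q w i a m) ∧
    -- multiplication identifies `𝒴' ⊗_𝒴 (completion of 𝒴)` with the summand of `Π'`
    (∀ w, (D.algY' q w).LinearDisjoint (D.algComplY q w)) ∧
    -- the Weyl group action on `Π` and the braid group actions on `Π'` and `Π̄'`
    ∃ (ρ : D.W →* RingAut (∀ w, D.complY q w))
      (ρ' : D.Braid →* RingAut (∀ w, D.complY' q w))
      (ρbar : D.Braid →* RingAut (∀ w, D.complYbar q w)),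
      (∀ i F, D.IsTheta q i F ↔ F = (ρ (D.s i)).toRingHom) ∧
      (∀ i F, D.IsThetaPrime q (D.mono_mem_complY' q) i F ↔ F = (ρ' (D.gen i)).toRingHom) ∧
      (∀ i F, D.IsThetaPrime q (D.mono_mem_complYbar q) i F ↔ F = (ρbar (D.gen i)).toRingHom) ∧
      -- the braid group actions extend the Weyl group action
      (∀ i (x : ∀ w, D.complY q w) (x' : ∀ w, D.complY' q w),
        (∀ w, (x w : D.Series w) = x' w) →
          ∀ w, (ρ (D.s i) x w : D.Series w) = ρ' (D.gen i) x' w) ∧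
      (∀ i (x : ∀ w, D.complY q w) (x' : ∀ w, D.complYbar q w),
        (∀ w, (x w : D.Series w) = x' w) →
          ∀ w, (ρ (D.s i) x w : D.Series w) = ρbar (D.gen i) x' w) := by
  refine ⟨fun w i a => ?_, D.linearDisjoint q, D.weylAction q,
    (D.admissible_complY' q).braidAction hq, (D.admissible_complYbar q).braidAction hq,
    fun i F => ?_, fun i F => ?_, fun i F => ?_, fun i x x' hx w => ?_, fun i x x' hx w => ?_⟩
  · rw [D.sigma_eq]
    exact ⟨D.sig_mem_complY q w i a, D.cf_sig q i a w⟩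
  · rw [D.weylAction_s]
    have h := D.isTheta_thetaY q hq i
    exact ⟨fun hF => hF.ext h, fun hF => hF ▸ h⟩
  · rw [CartanDatum.Admissible.braidAction_gen]
    have h := (D.admissible_complY' q).isThetaPrime (D.mono_mem_complY' q) i
    exact ⟨fun hF => hF.ext h, fun hF => hF ▸ h⟩
  · rw [CartanDatum.Admissible.braidAction_gen]
    have h := (D.admissible_complYbar q).isThetaPrime (D.mono_mem_complYbar q) i
    exact ⟨fun hF => hF.ext h, fun hF => hF ▸ h⟩
  · rw [D.weylAction_s, CartanDatum.Admissible.braidAction_gen]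
    -- Both automorphisms are restrictions of the same operator on the ambient ring, so it suffices
    -- that the two arguments have the same image there.
    have e : CartanDatum.toOm (D.complY_le_big q) x =
        CartanDatum.toOm (D.admissible_complY' q).le_big x' := funext fun w => Subtype.ext (hx w)
    exact congrArg (fun z : D.Om => (D.theta q i z w : D.Series w)) e
  · rw [D.weylAction_s, CartanDatum.Admissible.braidAction_gen]
    have e : CartanDatum.toOm (D.complY_le_big q) x =
        CartanDatum.toOm (D.admissible_complYbar q).le_big x' := funext fun w => Subtype.ext (hx w)
    exact congrArg (fun z : D.Om => (D.theta q i z w : D.Series w)) e
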